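/- Let $N$ be a connected (Hausdorff, second countable) smooth manifold of dimension $n$. A foliation $\mathcal F$ of $N$ with $s$-dimensional leaves is a partition of $N$ into connected immersed submanifolds $\mathcal F_k$ of dimension $s$. A $t$-dependent vector field $X$ on $N$ is a foliated Lie system with Vessiot–Guldberg Lie algebra $V$ if $$X(t,x)=\sum_{\alpha=1}^r g_\alpha(t,x)X_\alpha(x),\qquad t\in\mathbb R,\ x\in N,$$ where $X_1,\dots,X_r$ is a basis of a finite-dimensional real Lie algebra $V$ of smooth vector fields on $N$ such that the spaces $\mathcal D^V_x=\{Z(x):Z\in V\}$ have the same dimension for all $x\in N$, and $g_1,\dots,g_r\in C^\infty(\mathbb R\times N)$ satisfy $X_\alpha g_\beta=0$ for all $\alpha,\beta$. It is $\mathcal F$-foliated if moreover $T_x\mathcal F_k=\mathcal D^V_x$ for every leaf $\mathcal F_k$ and every $x\in\mathcal F_k$. A Lie system is a $t$-dependent vector field $\sum_\alpha b_\alpha(t)Y_\alpha$ with smooth $b_\alpha$ and with $Y_1,\dots,Y_r$ a basis of a finite-dimensional Lie algebra of smooth vector fields on $N$. Superposition rules are understood locally. Let $p\in N^m$. A superposition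 map near $p$ is a smooth map $\Psi:\Omega\to N$ on an open set $\Omega\subset N^m\times N$ with $\{p\}\times N\subset\Omega$, such that $W=\{(q,\Psi(q,c)):(q,c)\in\Omega\}$ is open in $N^m\times N$ and $\{p\}\times N\subset W$. Below, $J$ is any nonempty open interval. Such a $\Psi$ is a superposition rule for a system $Y$ if for all particular solutions $y_1,\dots,y_m$ of $Y$ on $J$: (a) if $c\in N$ and $(y_1(t),\dots,y_m(t),c)\in\Omega$ for all $t\in J$, then $t\mapsto\Psi(y_1(t),\dots,y_m(t),c)$ is a solution of $Y$ on $J$; (b) for every solution $x$ of $Y$ on $J$ with $(y_1(t),\dots,y_m(t),x(t))\in W$ for all $t\in J$ there is a unique $c\in N$ such that, for all $t\in J$, $(y_1(t),\dots,y_m(t),c)\in\Omega$ and $x(t)=\Psi(y_1(t),\dots,y_m(t),c)$. It is an $\mathcal F$-foliated superposition rule for $X$ if 1. $\Psi$ is a superposition rule for some Lie system on $N$; 2. $\Psi(\Omega\cap\mathcal F_k^{m+1})\subset\mathcal F_k$ for every leaf $\mathcal F_k$; 3. for every leaf $\mathcal F_k$ and all particular solutions $x_1,\dots,x_m$ of $X$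 on $J$ contained in $\mathcal F_k$: (a) if $\lambda\in\mathcal F_k$ and $(x_1(t),\dots,x_m(t),\lambda)\in\Omega$ for all $t\in J$, then $t\mapsto\Psi(x_1(t),\dots,x_m(t),\lambda)$ is a solution of $X$ on $J$; (b) for every solution $x$ of $X$ on $J$ with $x(t_0)\in\mathcal F_k$ for some $t_0\in J$ and $(x_1(t),\dots,x_m(t),x(t))\in W$ for all $t\in J$, there is a unique $\lambda\in\mathcal F_k$ such that, for all $t\in J$, $(x_1(t),\dots,x_m(t),\lambda)\in\Omega$ and $x(t)=\Psi(x_1(t),\dots,x_m(t),\lambda)$. The system $X$ admits an $\mathcal F$-foliated superposition rule depending on $m$ particular solutions if there is an open dense set $O\subset N$, a union of leaves, such that for every leaf $\mathcal F_k\subset O$ and every $p$ in some open dense subset of $\mathcal F_k^m$ (for the leaf topology) there is an $\mathcal F$-foliated superposition rule for $X$ near $p$ (with the same $m$ for all leaves and all $p$). **Theorem.** Let $X$ be an $\mathcal F$-foliated Lie system on $N$ with Vessiot–Guldberg Lie algebra $V$, and let $s$ be the dimension of the leaves of $\mathcal F$. Then there is an $m\in\mathbb N$ with $$m\,s\ \ge\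 \dim V$$ such that $X$ admits an $\mathcal F$-foliated superposition rule depending on $m$ particular solutions. -/

import Mathlib

open Set
open scoped Manifold ContDiff

noncomputable section

namespace FoliatedLie

variable {n : ℕ} {N : Type*} [TopologicalSpace N] [ChartedSpace (EuclideanSpace ℝ (Fin n)) N]

/-! ### Vector fields, distributions and Lie algebras of vector fields -/

/-- The real vector space of all (not necessarily smooth) vector fields on the
`n`-dimensional manifold `N`. -/
abbrev VField (n : ℕ) (N : Type*) [TopologicalSpace N]
    [ChartedSpace (EuclideanSpace ℝ (Fin n)) N] : Type _ :=
  (x : N) → TangentSpace (𝓡 n) x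

/-- Smoothness of a vector field, as a section of the tangent bundle. -/
def IsSmoothField [IsManifold (𝓡 n) ∞ N] (Z : VField n N) : Prop :=
  ContMDiff (𝓡 n) (𝓡 n).tangent ∞ (fun x => (⟨x, Z x⟩ : TangentBundle (𝓡 n) N))

/-- `V` is a finite-dimensional real Lie algebra of smooth vector fields on `N`. -/
structure IsLieAlgebraOfFields [IsManifold (𝓡 n) ∞ N] (V : Submodule ℝ (VField n N)) : Prop where
  smooth : ∀ Z ∈ V, IsSmoothField Z
  bracket_mem : ∀ Z ∈ V, ∀ W ∈ V, VectorField.mlieBracket (𝓡 n) Z W ∈ V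
  finite : FiniteDimensional ℝ V

/-- The generalised distribution `𝒟^V`: its value at `x` is `{Z x : Z ∈ V}`. -/
def distribution (V : Submodule ℝ (VField n N)) (x : N) :
    Submodule ℝ (TangentSpace (𝓡 n) x) :=
  V.map (LinearMap.proj x)

/-- A generalised distribution is regular if it has the same rank at every point. -/
def IsRegularDistribution (D : (x : N) → Submodule ℝ (TangentSpace (𝓡 n) x)) : Prop :=
  ∃ d : ℕ, ∀ x : N, Module.finrank ℝ (D x) = d

/-! ### Foliations -/

/-- A foliation of `N` with leaves of dimension `s`: a partition of `N` into connected immersed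
submanifolds of dimension `s`.  Every leaf carries its own manifold structure, and `incl k` is the
inclusion of the `k`-th leaf into `N`. -/
structure Foliation (n : ℕ) (N : Type*) [TopologicalSpace N]
    [ChartedSpace (EuclideanSpace ℝ (Fin n)) N] (s : ℕ) where
  ι : Type*
  Leaf : ι → Type*
  [topology : ∀ k, TopologicalSpace (Leaf k)]
  [charted : ∀ k, ChartedSpace (EuclideanSpace ℝ (Fin s)) (Leaf k)]
  [manifold : ∀ k, IsManifold (𝓡 s) ∞ (Leaf k)]
  [connected : ∀ k, ConnectedSpace (Leaf k)]
  incl : (k : ι) → Leaf k → N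
  injective : ∀ k, Function.Injective (incl k)
  immersion : ∀ k, Manifold.IsImmersion (𝓡 s) (𝓡 n) ∞ (incl k)
  partition : ∀ x : N, ∃! k, x ∈ range (incl k)

attribute [instance] Foliation.topology Foliation.charted Foliation.manifold Foliation.connected

/-- The `k`-th leaf, as a subset of `N`. -/
def Foliation.leaf {s : ℕ} (F : Foliation n N s) (k : F.ι) : Set N := range (F.incl k)

/-- The tangent spaces to the leaves of `F` are the spaces of the distribution `D`. -/
def Foliation.Integrates {s : ℕ} (F : Foliation n N s)
    (D : (x : N) → Submodule ℝ (TangentSpace (𝓡 n) x)) : Prop :=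
  ∀ (k : F.ι) (y : F.Leaf k),
    LinearMap.range (mfderiv (𝓡 s) (𝓡 n) (F.incl k) y).toLinearMap = D (F.incl k y)

/-! ### Lie systems and foliated Lie systems -/

/-- A `t`-dependent vector field on `N` (with no regularity assumption). -/
abbrev TField (n : ℕ) (N : Type*) [TopologicalSpace N]
    [ChartedSpace (EuclideanSpace ℝ (Fin n)) N] : Type _ :=
  ℝ → VField n N

/-- `X = ∑ α, b_α(t) X_α` with smooth functions `b_α` of `t` only and with `X_1, …, X_r` a basis of
a finite-dimensional Lie algebra of vector fields on `N`. -/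
def IsLieSystem [IsManifold (𝓡 n) ∞ N] (X : TField n N) : Prop :=
  ∃ (r : ℕ) (Z : Fin r → VField n N) (b : Fin r → ℝ → ℝ),
    LinearIndependent ℝ Z ∧
    IsLieAlgebraOfFields (Submodule.span ℝ (range Z)) ∧
    (∀ α, ContDiff ℝ ∞ (b α)) ∧
    ∀ t x, X t x = ∑ α, b α t • Z α x

/-- `X` is a foliated Lie system with Vessiot--Guldberg Lie algebra `V`: there is a basis
`X_1, …, X_r` of the Lie algebra of vector fields `V`, whose distribution is regular, and there are
smooth functions `g_1, …, g_r` on `ℝ × N` with `X_α g_β = 0` for all `α, β` and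
`X(t, x) = ∑ α, g_α(t, x) X_α(x)`. -/
def IsFoliatedLieSystem [IsManifold (𝓡 n) ∞ N] (X : TField n N)
    (V : Submodule ℝ (VField n N)) : Prop :=
  IsLieAlgebraOfFields V ∧
  IsRegularDistribution (distribution V) ∧
  ∃ (r : ℕ) (Z : Fin r → VField n N) (g : Fin r → ℝ → N → ℝ),
    LinearIndependent ℝ Z ∧
    Submodule.span ℝ (range Z) = V ∧
    (∀ α, ContMDiff (𝓘(ℝ, ℝ).prod (𝓡 n)) 𝓘(ℝ, ℝ) ∞ (fun q : ℝ × N => g α q.1 q.2)) ∧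
    (∀ (α β : Fin r) (t : ℝ) (x : N), mfderiv (𝓡 n) 𝓘(ℝ, ℝ) (g β t) x (Z α x) = 0) ∧
    ∀ t x, X t x = ∑ α, g α t x • Z α x

/-- `X` is an `F`-foliated Lie system with Vessiot--Guldberg Lie algebra `V`: it is a foliated Lie
system and the tangent spaces to the leaves of `F` form the distribution of `V`. -/
def IsFoliatedLieSystemAlong [IsManifold (𝓡 n) ∞ N] {s : ℕ} (F : Foliation n N s)
    (X : TField n N) (V : Submodule ℝ (VField n N)) : Prop :=
  IsFoliatedLieSystem X V ∧ F.Integrates (distribution V)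

/-! ### Particular solutions -/

/-- Nonempty open intervals of `ℝ`, bounded or not. -/
def IsOpenInterval (J : Set ℝ) : Prop := IsOpen J ∧ J.OrdConnected ∧ J.Nonempty

/-- `x` is a particular solution on `J` of the system `dx/dt = X(t, x)`. -/
def IsSolutionOn (X : TField n N) (x : ℝ → N) (J : Set ℝ) : Prop :=
  ∀ t ∈ J, HasMFDerivAt 𝓘(ℝ, ℝ) (𝓡 n) x t ((1 : ℝ →L[ℝ] ℝ).smulRight (X t (x t)))

/-! ### Superposition rules -/

/-- A smooth map `Ψ : N^m × N ⇀ N`, defined on an open neighbourhood `source` of `{p} × N`, where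
`p = (p_1, …, p_m)` is a point of `N^m`, such that the map `(q, c) ↦ (q, Ψ(q, c))` has an open image
`target`, and this image contains `{p} × N`. -/
structure SuperpositionMap (n : ℕ) {N : Type*} [TopologicalSpace N]
    [ChartedSpace (EuclideanSpace ℝ (Fin n)) N] {m : ℕ} (p : Fin m → N) where
  source : Set ((Fin m → N) × N)
  toFun : (Fin m → N) → N → N
  isOpen_source : IsOpen source
  mem_source : ∀ c : N, (p, c) ∈ source
  smooth : ContMDiffOn
    ((ModelWithCorners.pi (fun _ : Fin m => 𝓡 n)).prod (𝓡 n)) (𝓡 n) ∞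
    (fun z : (Fin m → N) × N => toFun z.1 z.2) source
  isOpen_target : IsOpen ((fun z : (Fin m → N) × N => (z.1, toFun z.1 z.2)) '' source)
  mem_target : ∀ x : N, (p, x) ∈ (fun z : (Fin m → N) × N => (z.1, toFun z.1 z.2)) '' source

/-- The image of `(q, c) ↦ (q, Ψ(q, c))`: the pairs `(q, x)` such that `x` is reached from `q`. -/
def SuperpositionMap.target {m : ℕ} {p : Fin m → N} (Ψ : SuperpositionMap n p) :
    Set ((Fin m → N) × N) :=
  (fun z : (Fin m → N) × N => (z.1, Ψ.toFun z.1 z.2)) '' Ψ.source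

/-- `Ψ` is a superposition rule for the system `Y`: given particular solutions `y_1, …, y_m`, the
particular solutions are the curves `Ψ(y_1(t), …, y_m(t), c)`, for a unique parameter `c`. -/
def SuperpositionMap.IsSuperpositionRule {m : ℕ} {p : Fin m → N} (Ψ : SuperpositionMap n p)
    (Y : TField n N) : Prop :=
  ∀ (J : Set ℝ) (y : Fin m → ℝ → N), IsOpenInterval J → (∀ i, IsSolutionOn Y (y i) J) →
    (∀ c : N, (∀ t ∈ J, ((fun i => y i t), c) ∈ Ψ.source) →
      IsSolutionOn Y (fun t => Ψ.toFun (fun i => y i t) c) J) ∧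
    (∀ x : ℝ → N, IsSolutionOn Y x J → (∀ t ∈ J, ((fun i => y i t), x t) ∈ Ψ.target) →
      ∃! c : N, ∀ t ∈ J, ((fun i => y i t), c) ∈ Ψ.source ∧ x t = Ψ.toFun (fun i => y i t) c)

/-- `Ψ` is an `F`-foliated superposition rule for the system `X`: it is a superposition rule for a
certain Lie system, it maps `F_k ^ (m + 1)` into `F_k` for every leaf `F_k`, and, given particular
solutions `x_1, …, x_m` of `X` contained in a leaf `F_k`, the particular solutions of `X` that meet
`F_k` are the curves `Ψ(x_1(t), …, x_m(t), c)`, for a unique parameter `c ∈ F_k`. -/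
structure SuperpositionMap.IsFoliatedSuperpositionRule [IsManifold (𝓡 n) ∞ N] {s m : ℕ}
    {p : Fin m → N} (Ψ : SuperpositionMap n p) (F : Foliation n N s) (X : TField n N) : Prop where
  lie_system : ∃ Y : TField n N, IsLieSystem Y ∧ Ψ.IsSuperpositionRule Y
  preserves_leaves : ∀ (k : F.ι) (q : Fin m → N) (c : N), (q, c) ∈ Ψ.source →
    (∀ i, q i ∈ F.leaf k) → c ∈ F.leaf k → Ψ.toFun q c ∈ F.leaf k
  solution : ∀ (k : F.ι) (J : Set ℝ) (y : Fin m → ℝ → N), IsOpenInterval J →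
    (∀ i, IsSolutionOn X (y i) J) → (∀ i, ∀ t ∈ J, y i t ∈ F.leaf k) →
    ∀ c ∈ F.leaf k, (∀ t ∈ J, ((fun i => y i t), c) ∈ Ψ.source) →
      IsSolutionOn X (fun t => Ψ.toFun (fun i => y i t) c) J
  general_solution : ∀ (k : F.ι) (J : Set ℝ) (y : Fin m → ℝ → N), IsOpenInterval J →
    (∀ i, IsSolutionOn X (y i) J) → (∀ i, ∀ t ∈ J, y i t ∈ F.leaf k) →
    ∀ x : ℝ → N, IsSolutionOn X x J → (∃ t₀ ∈ J, x t₀ ∈ F.leaf k) →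
      (∀ t ∈ J, ((fun i => y i t), x t) ∈ Ψ.target) →
      ∃! c : N, c ∈ F.leaf k ∧
        ∀ t ∈ J, ((fun i => y i t), c) ∈ Ψ.source ∧ x t = Ψ.toFun (fun i => y i t) c

/-- `X` admits an `F`-foliated superposition rule depending on `m` particular solutions, in the
usual local sense: there is an open dense set of `N`, union of leaves (the generic leaves), such
that for each of these leaves and for the `m`-tuples of an open dense subset of the `m`-th power of
the leaf (the generic `m`-tuples, in the topology of the leaf), there is an `F`-foliated
superposition rule near the `m`-tuple. -/
def AdmitsFoliatedSuperpositionRule [IsManifold (𝓡 n) ∞ N] {s : ℕ} (F : Foliation n N s)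
    (X : TField n N) (m : ℕ) : Prop :=
  ∃ O : Set N, IsOpen O ∧ Dense O ∧
    (∀ k : F.ι, (F.leaf k ∩ O).Nonempty → F.leaf k ⊆ O) ∧
    ∀ k : F.ι, F.leaf k ⊆ O →
      ∃ G : Set (Fin m → F.Leaf k), IsOpen G ∧ Dense G ∧
        ∀ q ∈ G, ∃ Ψ : SuperpositionMap n (fun i => F.incl k (q i)),
          Ψ.IsFoliatedSuperpositionRule F X

end FoliatedLie

end

/-!
A foliated Lie system is, on each leaf, a Lie system, and a superposition rule for it is the action
on the leaf of a local group of diffeomorphisms, in which the group element is expressed by means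
of its effect on sufficiently many points.

*Local action.* Given fields `X 1, …, X K` of `V`, let `e(a, c)` be the value at time `1` of the
solution of `x' = ∑ i, a i * β i(t) • X i(x)` with `x(0) = c`, where the controls `β i` are
continuous with integral `1`. It is smooth on a neighbourhood of `{0} × N` (`Flow.nonempty`): in a
chart the equation is solved in the Banach space of continuous curves by the implicit function
theorem. The derivative of `e` with respect to `a` satisfies an equation of variations that can be
written with the brackets `[X i, X l]` (`Flow.variation`). If on a leaf these brackets are
combinations of the `X l` with constant coefficients, then the derivative of `e(·, c)` in a
direction `w` is `∑ l, (M w) l • X l`, where the matrix `M` depends on `a` but not on `c`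
(`Flow.exists_paramDeriv_eq`).

*Leaves.* Curves driven by fields of `V` stay in the leaves (`IsSolutionOn.mem_leaf`) and locally
fill them (`Flow.eventually_exists_eq_incl`). Hence the functions `g α(t, ·)` are constant on the
leaves, and a space of fields of `V` that is stable under brackets with `V` vanishes on a whole
leaf as soon as it vanishes at one of its points. In particular a field of `V` that vanishes on an
open part of a leaf vanishes on the leaf (`Generates.mem_vanishingOn`).

*Genericity.* The dimension of the space `V_k` of fields of `V` that vanish on the leaf `k` is upper
semicontinuous, so the points near which it is constant form an open dense union of leaves. For
`m = dim V`, the fields that vanish at all the points of a tuple in a leaf are exactly those of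
`V_k` for an open dense set of tuples, since each
point in turn can be chosen to lower the dimension of that space until it is `V_k`. If `s = 0`, then
`V = 0`; otherwise `dim V ≤ m * s`.

*Superposition map.* Let `p` be such a tuple, and take for `X 1, …, X K` a basis of a complement of
`V_k` in `V`. By the choice of `p` the values of the `X i` at the points of `p` are independent, so
the action on the tuples near `p` has a slice, and a tuple `q` near `p` determines smooth parameters
`α(q)` (`ParamMap.exists_subset`). The superposition map is `Ψ(q, c) = e(α(q), c)`. On a leaf near
`p` the same fields span a complement, so that the system is `∑ l, b l(t) • X l` there, with
`b l(t) = (M w) l` for a suitable `w` (`M` is injective as the tuples are free). When the tuple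
moves along the system, its parameters move with velocity `w`, and therefore `e(α(q(t)), c)` is a
solution for every `c` in the leaf (`ParamMap.isSolutionOn`); uniqueness of solutions shows that all
the solutions arise in this way (`ParamMap.existsUnique`). As for the Lie system of which `Ψ` is a
superposition rule on all of `N`, one may take the single field `X 1`: with `β 1` acting after the
other controls, the parameter `a 1` moves every point along `X 1` (`Flow.paramDeriv_single`).
-/

noncomputable section

namespace FoliatedLie

open Filter Topology

/-! ### The superposition operator on spaces of continuous curves -/

section Superposition

variable {I : Type*} [TopologicalSpace I] [CompactSpace I]

/-- Pointwise application `(A, h) ↦ (u ↦ A u (h u))`, as a continuous bilinear map. -/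
def pointwiseApply (I : Type*) [TopologicalSpace I] [CompactSpace I]
    (E F : Type*) [NormedAddCommGroup E] [NormedSpace ℝ E]
    [NormedAddCommGroup F] [NormedSpace ℝ F] :
    C(I, E →L[ℝ] F) →L[ℝ] C(I, E) →L[ℝ] C(I, F) :=
  LinearMap.mkContinuous₂
    (LinearMap.mk₂ ℝ (fun (A : C(I, E →L[ℝ] F)) (h : C(I, E)) =>
        (⟨fun u => A u (h u), by fun_prop⟩ : C(I, F)))
      (fun _ _ _ => by ext; simp) (fun _ _ _ => by ext; simp)
      (fun _ _ _ => by ext; simp) (fun _ _ _ => by ext; simp)) 1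
    (fun A h => by
      refine (ContinuousMap.norm_le _ (by positivity)).2 fun u => ?_
      rw [one_mul]
      refine ((A u).le_opNorm _).trans ?_
      gcongr
      exacts [A.norm_coe_le_norm u, h.norm_coe_le_norm u])

@[simp] lemma pointwiseApply_apply {E F : Type*} [NormedAddCommGroup E] [NormedSpace ℝ E]
    [NormedAddCommGroup F] [NormedSpace ℝ F] (A : C(I, E →L[ℝ] F)) (h : C(I, E)) (u : I) :
    pointwiseApply I E F A h u = A u (h u) := rfl

lemma hasFDerivAt_comp_continuousMap {E F : Type*} [NormedAddCommGroup E] [NormedSpace ℝ E]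
    [NormedAddCommGroup F] [NormedSpace ℝ F] (f : C(E, F)) (f' : C(E, E →L[ℝ] F))
    (hf : ∀ x, HasFDerivAt f (f' x) x) (γ : C(I, E)) :
    HasFDerivAt (fun γ : C(I, E) => f.comp γ) (pointwiseApply I E F (f'.comp γ)) γ := by
  rw [hasFDerivAt_iff_isLittleO_nhds_zero, Asymptotics.isLittleO_iff]
  intro ε hε
  have hK : IsCompact (range γ) := isCompact_range γ.continuous
  have hu := hK.uniformContinuousAt_of_continuousAt f' (fun x _ => f'.continuous.continuousAt)
    (Metric.dist_mem_uniformity hε)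
  obtain ⟨δ, hδ, hsub⟩ := Metric.mem_uniformity_dist.1 hu
  filter_upwards [Metric.ball_mem_nhds (0 : C(I, E)) hδ] with h hh
  refine (ContinuousMap.norm_le _ (by positivity)).2 fun u => ?_
  have hhu : ‖h u‖ ≤ ‖h‖ := h.norm_coe_le_norm u
  have hhδ : ‖h‖ < δ := by simpa using hh
  -- the mean value inequality on the ball of radius `δ` around `γ u`
  have := (convex_ball (γ u) δ).norm_image_sub_le_of_norm_hasFDerivWithin_le'
    (f := f) (f' := fun x => f' x) (φ := f' (γ u)) (C := ε) (x := γ u) (y := γ u + h u)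
    (fun x _ => (hf x).hasFDerivWithinAt) (fun x hx => by
      have := hsub (a := γ u) (b := x) (by simpa [dist_comm] using hx) (mem_range_self u)
      have h2 : dist (f' (γ u)) (f' x) < ε := this
      rw [dist_comm, dist_eq_norm] at h2
      exact h2.le)
    (Metric.mem_ball_self hδ) (by simpa using hhu.trans_lt hhδ)
  simp only [add_sub_cancel_left] at this
  calc _ ≤ ε * ‖h u‖ := by simpa using this
    _ ≤ _ := by gcongr

lemma contDiff_comp_continuousMap_nat (n : ℕ) {E : Type} [NormedAddCommGroup E] [NormedSpace ℝ E] :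
    ∀ {F : Type} [NormedAddCommGroup F] [NormedSpace ℝ F] (f : C(E, F)), ContDiff ℝ n f →
    ContDiff ℝ n (fun γ : C(I, E) => f.comp γ) := by
  induction n with
  | zero =>
    intro F _ _ f _
    exact contDiff_zero.2 (ContinuousMap.continuous_postcomp f)
  | succ n ih =>
    intro F _ _ f hf
    have hf' : ContDiff ℝ n (fderiv ℝ f) := hf.fderiv_right le_rfl
    let f' : C(E, E →L[ℝ] F) := ⟨fderiv ℝ f, hf'.continuous⟩
    have hd : ∀ x, HasFDerivAt f (f' x) x := fun x =>
      (hf.differentiable (by simp) x).hasFDerivAt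
    refine (contDiff_succ_iff_hasFDerivAt (n := n)).2
      ⟨fun γ => pointwiseApply I E F (f'.comp γ), ?_, fun γ =>
        hasFDerivAt_comp_continuousMap f f' hd γ⟩
    exact (pointwiseApply I E F).contDiff.comp (ih f' hf')

/-- Composition on the left with a smooth map is a smooth map between spaces of continuous
curves. -/
lemma contDiff_comp_continuousMap {E F : Type} [NormedAddCommGroup E] [NormedSpace ℝ E]
    [NormedAddCommGroup F] [NormedSpace ℝ F] (f : C(E, F)) (hf : ContDiff ℝ ∞ f) :
    ContDiff ℝ ∞ (fun γ : C(I, E) => f.comp γ) :=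
  contDiff_infty.2 fun n => contDiff_comp_continuousMap_nat n f (contDiff_infty.1 hf n)

end Superposition

/-! ### Volterra operators -/

section Volterra

variable {E : Type*} [NormedAddCommGroup E] [NormedSpace ℝ E]

/-- The primitive of a continuous curve on `[0, 1]`, extended to `ℝ` by constants before
integration. -/
def primitive (f : C(unitInterval, E)) (t : ℝ) : E :=
  ∫ τ in (0 : ℝ)..t, f (projIcc 0 1 zero_le_one τ)

lemma hasDerivAt_primitive [CompleteSpace E] (f : C(unitInterval, E)) (t : ℝ) :
    HasDerivAt (primitive f) (f (projIcc 0 1 zero_le_one t)) t := by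
  have hc : Continuous fun τ : ℝ => f (projIcc 0 1 zero_le_one τ) :=
    f.continuous.comp continuous_projIcc
  exact intervalIntegral.integral_hasDerivAt_right (hc.intervalIntegrable _ _)
    (hc.stronglyMeasurableAtFilter _ _) hc.continuousAt

lemma norm_primitive_le (f : C(unitInterval, E)) {t : ℝ} (ht : t ∈ Icc (0 : ℝ) 1) :
    ‖primitive f t‖ ≤ ‖f‖ := by
  have := intervalIntegral.norm_integral_le_of_norm_le_const (a := 0) (b := t) (C := ‖f‖)
    (f := fun τ => f (projIcc 0 1 zero_le_one τ)) (fun x _ => f.norm_coe_le_norm _)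
  refine this.trans ?_
  rw [sub_zero, abs_of_nonneg ht.1]
  exact mul_le_of_le_one_right (norm_nonneg _) ht.2

/-- The operator sending a continuous curve on `[0, 1]` to its primitive. -/
def volterra (E : Type*) [NormedAddCommGroup E] [NormedSpace ℝ E] [CompleteSpace E] :
    C(unitInterval, E) →L[ℝ] C(unitInterval, E) :=
  LinearMap.mkContinuous
    { toFun := fun f => ⟨fun u => primitive f u, by
        have : Continuous (primitive f) :=
          continuous_iff_continuousAt.2 fun t => (hasDerivAt_primitive f t).continuousAt
        fun_prop⟩
      map_add' := fun f g => by
        ext u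
        have hc : ∀ f : C(unitInterval, E),
            Continuous fun τ : ℝ => f (projIcc 0 1 zero_le_one τ) :=
          fun f => f.continuous.comp continuous_projIcc
        exact intervalIntegral.integral_add ((hc f).intervalIntegrable _ _)
          ((hc g).intervalIntegrable _ _)
      map_smul' := fun c f => by
        ext u
        exact intervalIntegral.integral_smul c _ } 1
    (fun f => by
      refine (ContinuousMap.norm_le _ (by positivity)).2 fun u => ?_
      rw [one_mul]
      exact norm_primitive_le f u.2)

lemma volterra_apply [CompleteSpace E] (f : C(unitInterval, E)) (u : unitInterval) :
    volterra E f u = primitive f u := rfl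

end Volterra

section Linear

variable {E : Type*} [NormedAddCommGroup E] [NormedSpace ℝ E] [CompleteSpace E]

lemma norm_volterra_pow_le (A : C(unitInterval, E →L[ℝ] E)) (k : ℕ) (f : C(unitInterval, E))
    (u : unitInterval) :
    ‖((volterra E ∘L pointwiseApply unitInterval E E A) ^ k) f u‖ ≤
      (‖A‖ * u) ^ k / k.factorial * ‖f‖ := by
  induction k generalizing u with
  | zero => simpa using f.norm_coe_le_norm u
  | succ k ih =>
    rw [pow_succ', mul_apply_eq_comp]
    set g := ((volterra E ∘L pointwiseApply unitInterval E E A) ^ k) f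
    have hu := u.2
    change ‖primitive (pointwiseApply unitInterval E E A g) u‖ ≤ _
    have h1 : ‖primitive (pointwiseApply unitInterval E E A g) u‖ ≤
        ∫ τ in (0 : ℝ)..u, ‖A‖ * ((‖A‖ * τ) ^ k / k.factorial * ‖f‖) := by
      refine intervalIntegral.norm_integral_le_of_norm_le hu.1 ?_ ?_
      · refine .of_forall fun τ hτ => ?_
        have hτ' : τ ∈ Icc (0 : ℝ) 1 := ⟨hτ.1.le, hτ.2.trans hu.2⟩
        rw [projIcc_of_mem _ hτ', pointwiseApply_apply]
        refine ((A _).le_opNorm _).trans ?_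
        have := ih ⟨τ, hτ'⟩
        gcongr
        exact A.norm_coe_le_norm _
      · exact Continuous.intervalIntegrable (by fun_prop) _ _
    refine h1.trans (le_of_eq ?_)
    have : (fun τ : ℝ => ‖A‖ * ((‖A‖ * τ) ^ k / k.factorial * ‖f‖)) =
        fun τ => (‖A‖ ^ (k + 1) / k.factorial * ‖f‖) * τ ^ k := by
      ext τ; rw [mul_pow]; ring
    rw [this, intervalIntegral.integral_const_mul, integral_pow, Nat.factorial_succ]
    push_cast
    field_simp
    ring

/-- A linear fixed point equation `m = T m + b` is solvable when the powers of `T` decay like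
`a ^ k / k !`: the Neumann series converges. -/
lemma exists_eq_apply_add_of_norm_pow_le {G : Type*} [NormedAddCommGroup G] [NormedSpace ℝ G]
    [CompleteSpace G] (T : G →L[ℝ] G) (a : ℝ) (hn : ∀ k : ℕ, ‖T ^ k‖ ≤ a ^ k / k.factorial)
    (b : G) : ∃ m : G, m = T m + b := by
  have hs : Summable fun k => T ^ k :=
    Summable.of_norm_bounded (Real.summable_pow_div_factorial a) hn
  refine ⟨(∑' k, T ^ k) b, ?_⟩
  have h2 := DFunLike.congr_fun hs.one_sub_mul_tsum_pow b
  exact sub_eq_iff_eq_add'.1 h2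

/-- Linear Volterra equations on `[0, 1]` are solvable. -/
lemma exists_volterra_eq (A : C(unitInterval, E →L[ℝ] E)) (b : C(unitInterval, E)) :
    ∃ m : C(unitInterval, E),
      m = volterra E (pointwiseApply unitInterval E E A m) + b := by
  have hA : 0 ≤ ‖A‖ := norm_nonneg A
  refine exists_eq_apply_add_of_norm_pow_le
    (volterra E ∘L pointwiseApply unitInterval E E A) ‖A‖ (fun k => ?_) b
  refine ContinuousLinearMap.opNorm_le_bound _ (by positivity) fun f => ?_
  refine (ContinuousMap.norm_le _ (by positivity)).2 fun u => ?_
  refine (norm_volterra_pow_le A k f u).trans ?_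
  have h0 := u.2.1
  have h1 := u.2.2
  gcongr
  exact mul_le_of_le_one_right hA h1

end Linear

/-! ### Smooth dependence of solutions of ordinary differential equations -/

section Flow

variable {E : Type} [NormedAddCommGroup E] [NormedSpace ℝ E] [CompleteSpace E]
  {ι : Type} [Fintype ι]

/-- The operator `f ↦ (u ↦ ∫₀ᵘ β f)`. -/
def weightedVolterra (E : Type*) [NormedAddCommGroup E] [NormedSpace ℝ E] [CompleteSpace E]
    (β : C(ℝ, ℝ)) : C(unitInterval, E) →L[ℝ] C(unitInterval, E) :=
  volterra E ∘L pointwiseApply unitInterval E E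
    ⟨fun u => β u • ContinuousLinearMap.id ℝ E, by fun_prop⟩

/-- Constant curves, as a continuous linear map. -/
def constCurve (E : Type*) [NormedAddCommGroup E] [NormedSpace ℝ E] :
    E →L[ℝ] C(unitInterval, E) :=
  LinearMap.mkContinuous
    { toFun := fun x => ContinuousMap.const _ x
      map_add' := fun _ _ => rfl
      map_smul' := fun _ _ => rfl } 1
    (fun x => (ContinuousMap.norm_le _ (by positivity)).2 fun _ => (one_mul ‖x‖).ge)

@[simp] lemma constCurve_apply {E : Type*} [NormedAddCommGroup E] [NormedSpace ℝ E]
    (x : E) (u : unitInterval) : constCurve E x u = x := rfl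

/-- A solution of a smooth implicit equation is smooth near every point where the equation is
regular. -/
lemma eventually_contDiffAt_of_implicit {E₁ E₂ G : Type*} [NormedAddCommGroup E₁] [NormedSpace ℝ E₁]
    [CompleteSpace E₁] [NormedAddCommGroup E₂] [NormedSpace ℝ E₂] [CompleteSpace E₂]
    [NormedAddCommGroup G] [NormedSpace ℝ G] [CompleteSpace G]
    {f : E₁ × E₂ → G} (hf : ContDiff ℝ ∞ f) {γ : E₁ → E₂} {z₀ : E₁} {y : G}
    (hγ : ∀ᶠ z in 𝓝 z₀, ContinuousAt γ z) (h : ∀ᶠ z in 𝓝 z₀, f (z, γ z) = y)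
    (hinv : (fderiv ℝ f (z₀, γ z₀) ∘L .inr ℝ E₁ E₂).IsInvertible) :
    ∀ᶠ z in 𝓝 z₀, ContDiffAt ℝ ∞ γ z := by
  have hc : ContinuousAt (fun z => fderiv ℝ f (z, γ z) ∘L .inr ℝ E₁ E₂) z₀ := by
    have h1 : Continuous (fderiv ℝ f) := hf.continuous_fderiv (by simp)
    have h2 : ContinuousAt (fun z => (z, γ z)) z₀ := continuousAt_id.prodMk hγ.self_of_nhds
    exact (ContinuousLinearMap.compL ℝ E₂ (E₁ × E₂) G |>.flip
      (.inr ℝ E₁ E₂)).continuous.continuousAt.comp (h1.continuousAt.comp h2)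
  obtain ⟨e, he⟩ := hinv
  have h3 : ∀ᶠ z in 𝓝 z₀, (fderiv ℝ f (z, γ z) ∘L .inr ℝ E₁ E₂).IsInvertible := by
    have := e.nhds
    rw [he] at this
    filter_upwards [hc.preimage_mem_nhds this] with z hz
    exact hz
  filter_upwards [hγ, h.eventually_nhds, h3] with z hz hzf hzi
  have hcd : ContDiffAt ℝ ∞ f (z, γ z) := hf.contDiffAt
  refine (hcd.contDiffAt_implicitFunction (by simp) hzi).congr_of_eventuallyEq ?_
  have h2 : ContinuousAt (fun z => (z, γ z)) z := continuousAt_id.prodMk hz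
  filter_upwards [h2.eventually (hcd.eventually_apply_eq_iff_implicitFunction (by simp) hzi),
    hzf] with z' hz' hzf'
  exact (hz'.1 (hzf'.trans hzf.self_of_nhds.symm)).symm

/-- Smooth dependence on parameters and initial conditions for the equation
`γ' = ∑ i, a i * β i(u) • v i(γ)` near `a = 0`: the equation in integral form is solved on all of
`[0, 1]` by the implicit function theorem in the Banach space of continuous curves. The linearised
equation at `a = 0` is the identity. -/
lemma exists_contDiff_flow (v : ι → C(E, E)) (hv : ∀ i, ContDiff ℝ ∞ (v i)) (β : ι → C(ℝ, ℝ))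
    (w₀ : E) :
    ∃ γ : (ι → ℝ) × E → C(unitInterval, E), (∀ᶠ z in 𝓝 (0, w₀), ContDiffAt ℝ ∞ γ z) ∧
      γ (0, w₀) = constCurve E w₀ ∧
      ∀ᶠ z in 𝓝 ((0, w₀) : (ι → ℝ) × E),
        γ z = constCurve E z.2 + ∑ i, z.1 i • weightedVolterra E (β i) ((v i).comp (γ z)) := by
  let G : ((ι → ℝ) × E) × C(unitInterval, E) → C(unitInterval, E) := fun p =>
    p.2 - constCurve E p.1.2 - ∑ i, p.1.1 i • weightedVolterra E (β i) ((v i).comp p.2)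
  have hG : ContDiff ℝ ∞ G := by
    refine (contDiff_snd.sub ((constCurve E).contDiff.comp contDiff_fst.snd)).sub ?_
    refine ContDiff.sum fun i _ => ContDiff.fun_smul ?_ ?_
    · exact (contDiff_apply ℝ ℝ i).comp contDiff_fst.fst
    · exact (weightedVolterra E (β i)).contDiff.comp
        ((contDiff_comp_continuousMap (v i) (hv i)).comp contDiff_snd)
  let u₀ : ((ι → ℝ) × E) × C(unitInterval, E) := ((0, w₀), constCurve E w₀)
  have hd : fderiv ℝ G u₀ ∘L .inr ℝ ((ι → ℝ) × E) C(unitInterval, E) =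
      ContinuousLinearMap.id ℝ _ := by
    have h1 : HasFDerivAt G (fderiv ℝ G u₀) u₀ :=
      (hG.differentiable (by simp) u₀).hasFDerivAt
    have h2 := h1.comp (constCurve E w₀) (hasFDerivAt_prodMk_right ((0, w₀) : (ι → ℝ) × E) _)
    have h3 : HasFDerivAt (G ∘ fun γ => (((0, w₀) : (ι → ℝ) × E), γ))
        (ContinuousLinearMap.id ℝ _) (constCurve E w₀) := by
      have : (G ∘ fun γ => (((0, w₀) : (ι → ℝ) × E), γ)) = fun γ => γ - constCurve E w₀ := by
        ext γ; simp [G]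
      rw [this]
      exact (hasFDerivAt_id _).sub_const _
    exact h2.unique h3
  have hinv : (fderiv ℝ G u₀ ∘L .inr ℝ ((ι → ℝ) × E) C(unitInterval, E)).IsInvertible := by
    rw [hd]; exact ⟨.refl ℝ _, rfl⟩
  have hcd : ContDiffAt ℝ ∞ G u₀ := hG.contDiffAt
  have h0 : hcd.implicitFunction (by simp) hinv (0, w₀) = constCurve E w₀ :=
    hcd.implicitFunction_apply_self (by simp) hinv
  refine ⟨hcd.implicitFunction (by simp) hinv, ?_, h0, ?_⟩
  · refine eventually_contDiffAt_of_implicit hG ?_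
      (hcd.eventually_apply_implicitFunction (by simp) hinv) (by rw [h0]; exact hinv)
    have h1 := (hcd.contDiffAt_implicitFunction (by simp) hinv).of_le (m := 1) (by simp)
    filter_upwards [h1.eventually (by simp)] with z hz
    exact hz.continuousAt
  filter_upwards [hcd.eventually_apply_implicitFunction (by simp) hinv] with z hz
  have h0 : G u₀ = 0 := by simp [G, u₀]
  rw [h0] at hz
  simp only [G] at hz
  rw [sub_eq_zero, sub_eq_iff_eq_add'] at hz
  exact hz

/-- The equation of variations, in integral form. -/
lemma fderiv_flow_apply (v : ι → C(E, E)) (hv : ∀ i, ContDiff ℝ ∞ (v i)) (β : ι → C(ℝ, ℝ))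
    {γ : (ι → ℝ) × E → C(unitInterval, E)} {z : (ι → ℝ) × E} (hγ : DifferentiableAt ℝ γ z)
    (h : ∀ᶠ z in 𝓝 z,
        γ z = constCurve E z.2 + ∑ i, z.1 i • weightedVolterra E (β i) ((v i).comp (γ z)))
    (v' : ι → C(E, E →L[ℝ] E)) (hv' : ∀ i x, v' i x = fderiv ℝ (v i) x)
    (w : ι → ℝ) (ξ : E) :
    fderiv ℝ γ z (w, ξ) = constCurve E ξ +
      ∑ i, (z.1 i • weightedVolterra E (β i)
          (pointwiseApply unitInterval E E ((v' i).comp (γ z)) (fderiv ℝ γ z (w, ξ))) +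
        w i • weightedVolterra E (β i) ((v i).comp (γ z))) := by
  have h1 : HasFDerivAt γ (fderiv ℝ γ z) z := hγ.hasFDerivAt
  have h2 : ∀ i, HasFDerivAt (fun z => (v i).comp (γ z))
      (pointwiseApply unitInterval E E ((v' i).comp (γ z)) ∘L fderiv ℝ γ z) z := fun i =>
    (hasFDerivAt_comp_continuousMap (v i) (v' i) (fun x => by
      rw [hv']; exact ((hv i).differentiable (by simp) x).hasFDerivAt) (γ z)).comp z h1
  have h3 : ∀ i, HasFDerivAt (fun z : (ι → ℝ) × E => z.1 i)
      (ContinuousLinearMap.proj i ∘L ContinuousLinearMap.fst ℝ (ι → ℝ) E) z := fun i =>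
    (ContinuousLinearMap.proj (R := ℝ) (φ := fun _ : ι => ℝ) i ∘L
      ContinuousLinearMap.fst ℝ (ι → ℝ) E).hasFDerivAt
  have h4 := ((constCurve E).hasFDerivAt.comp z (hasFDerivAt_snd (𝕜 := ℝ) (p := z))).add
    (HasFDerivAt.fun_sum fun i (_ : i ∈ Finset.univ) =>
      (h3 i).smul (((weightedVolterra E (β i)).hasFDerivAt).comp z (h2 i)))
  have h5 := (h4.congr_of_eventuallyEq h).unique h1
  have h6 := DFunLike.congr_fun h5.symm (w, ξ)
  refine h6.trans ?_
  simp

end Flow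

/-! ### Gronwall's lemma and propagation along curves -/

/-- A differentiable curve with `‖z'‖ ≤ C ‖z‖` that vanishes at one point of an interval vanishes
on the interval, to the left and to the right of the point. -/
lemma eq_zero_of_norm_deriv_le {E : Type*} [NormedAddCommGroup E] [NormedSpace ℝ E]
    {z z' : ℝ → E} {S : Set ℝ} {C : ℝ} (hS : S.OrdConnected)
    (hz : ∀ t ∈ S, HasDerivAt z (z' t) t) (hC : ∀ t ∈ S, ‖z' t‖ ≤ C * ‖z t‖)
    {t₀ : ℝ} (ht₀ : t₀ ∈ S) (h₀ : z t₀ = 0) : ∀ t ∈ S, z t = 0 := by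
  intro t ht
  rcases le_total t₀ t with h | h
  · have hsub : Icc t₀ t ⊆ S := hS.out ht₀ ht
    exact eq_zero_of_abs_deriv_le_mul_abs_self_of_eq_zero_right
      (fun x hx => (hz x (hsub hx)).continuousAt.continuousWithinAt)
      (fun x hx => (hz x (hsub (Ico_subset_Icc_self hx))).hasDerivWithinAt) h₀
      (fun x hx => hC x (hsub (Ico_subset_Icc_self hx))) t (right_mem_Icc.2 h)
  · have hsub : Icc t t₀ ⊆ S := hS.out ht ht₀
    have hm : ∀ x ∈ Icc (-t₀) (-t), -x ∈ S := fun x hx =>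
      hsub ⟨by linarith [hx.2], by linarith [hx.1]⟩
    have hd : ∀ x ∈ Icc (-t₀) (-t), HasDerivAt (fun x => z (-x)) (-z' (-x)) x := fun x hx => by
      simpa [Function.comp_def] using (hz (-x) (hm x hx)).scomp x (hasDerivAt_neg x)
    have := eq_zero_of_abs_deriv_le_mul_abs_self_of_eq_zero_right (f := fun x => z (-x))
      (f' := fun x => -z' (-x)) (K := C)
      (fun x hx => (hd x hx).continuousAt.continuousWithinAt)
      (fun x hx => (hd x (Ico_subset_Icc_self hx)).hasDerivWithinAt) (by simpa using h₀)
      (fun x hx => by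
        rw [norm_neg]
        exact hC _ (hm x (Ico_subset_Icc_self hx))) (-t) (right_mem_Icc.2 (by linarith))
    simpa using this

/-- A property that is locally constant along a preconnected set is constant along it. -/
lemma forall_mem_of_locally {α : Type*} [TopologicalSpace α] {J : Set α} (hJ : IsPreconnected J)
    {P : α → Prop}
    (h : ∀ t ∈ J, ∃ U ∈ 𝓝 t, ∀ t₁ ∈ U, t₁ ∈ J → ∀ t₂ ∈ U, t₂ ∈ J → P t₁ → P t₂)
    {t₀ : α} (ht₀ : t₀ ∈ J) (h₀ : P t₀) : ∀ t ∈ J, P t := by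
  have : PreconnectedSpace J := isPreconnected_iff_preconnectedSpace.1 hJ
  have hclopen : IsClopen {t : J | P t} := by
    refine ⟨⟨isOpen_iff_mem_nhds.2 fun t ht => ?_⟩, isOpen_iff_mem_nhds.2 fun t ht => ?_⟩
    · obtain ⟨U, hU, hP⟩ := h t t.2
      filter_upwards [continuous_subtype_val.continuousAt.preimage_mem_nhds hU] with t' ht' hp
      exact ht (hP t' ht' t'.2 t (mem_of_mem_nhds hU) t.2 hp)
    · obtain ⟨U, hU, hP⟩ := h t t.2
      filter_upwards [continuous_subtype_val.continuousAt.preimage_mem_nhds hU] with t' ht'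
      exact hP t (mem_of_mem_nhds hU) t.2 t' ht' t'.2 ht
  have huniv := hclopen.eq_univ ⟨⟨t₀, ht₀⟩, h₀⟩
  exact fun t ht => (huniv.symm ▸ mem_univ (⟨t, ht⟩ : J) : (⟨t, ht⟩ : J) ∈ {t : J | P t})

/-! ### Vector fields in a chart -/

section Charts

variable {n : ℕ} {N : Type*} [TopologicalSpace N] [ChartedSpace (EuclideanSpace ℝ (Fin n)) N]
  {φ : OpenPartialHomeomorph N (EuclideanSpace ℝ (Fin n))}

/-- The derivative of a chart, with values in the model space. -/
def chartDeriv (φ : OpenPartialHomeomorph N (EuclideanSpace ℝ (Fin n))) (x : N) :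
    TangentSpace (𝓡 n) x →L[ℝ] EuclideanSpace ℝ (Fin n) :=
  mfderiv (𝓡 n) (𝓡 n) φ x

/-- The expression of the vector field `Z` in the chart `φ`. -/
def chartRep (φ : OpenPartialHomeomorph N (EuclideanSpace ℝ (Fin n))) (Z : VField n N)
    (w : EuclideanSpace ℝ (Fin n)) : EuclideanSpace ℝ (Fin n) :=
  chartDeriv φ (φ.symm w) (Z (φ.symm w))

lemma mdifferentiable_of_mem_maximalAtlas (hφ : φ ∈ IsManifold.maximalAtlas (𝓡 n) ∞ N) :
    φ.MDifferentiable (𝓡 n) (𝓡 n) :=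
  ⟨(contMDiffOn_of_mem_maximalAtlas hφ).mdifferentiableOn (by simp),
    (contMDiffOn_symm_of_mem_maximalAtlas hφ).mdifferentiableOn (by simp)⟩

lemma chartDeriv_injective (hφ : φ ∈ IsManifold.maximalAtlas (𝓡 n) ∞ N) {x : N}
    (hx : x ∈ φ.source) : Function.Injective (chartDeriv φ x) :=
  (mdifferentiable_of_mem_maximalAtlas hφ).mfderiv_injective hx

lemma chartDeriv_surjective (hφ : φ ∈ IsManifold.maximalAtlas (𝓡 n) ∞ N) {x : N}
    (hx : x ∈ φ.source) : Function.Surjective (chartDeriv φ x) :=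
  (mdifferentiable_of_mem_maximalAtlas hφ).mfderiv_surjective hx

lemma mfderiv_symm_chartDeriv (hφ : φ ∈ IsManifold.maximalAtlas (𝓡 n) ∞ N)
    {w : EuclideanSpace ℝ (Fin n)} (hw : w ∈ φ.target) (v : TangentSpace (𝓡 n) (φ.symm w)) :
    mfderiv (𝓡 n) (𝓡 n) φ.symm w (chartDeriv φ (φ.symm w) v) = v := by
  have h1 := (mdifferentiable_of_mem_maximalAtlas hφ).symm_comp_deriv (φ.map_target hw)
  rw [φ.right_inv hw] at h1
  exact DFunLike.congr_fun h1 v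

lemma isInvertible_mfderiv_symm (hφ : φ ∈ IsManifold.maximalAtlas (𝓡 n) ∞ N)
    {w : EuclideanSpace ℝ (Fin n)} (hw : w ∈ φ.target) :
    (mfderiv (𝓡 n) (𝓡 n) φ.symm w).IsInvertible := by
  have h := mdifferentiable_of_mem_maximalAtlas hφ
  have h1 := h.symm_comp_deriv (φ.map_target hw)
  rw [φ.right_inv hw] at h1
  exact ContinuousLinearMap.IsInvertible.of_inverse h1 (h.comp_symm_deriv hw)

lemma mpullback_symm_eq_chartRep (hφ : φ ∈ IsManifold.maximalAtlas (𝓡 n) ∞ N) (Z : VField n N)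
    {w : EuclideanSpace ℝ (Fin n)} (hw : w ∈ φ.target) :
    VectorField.mpullback (𝓡 n) (𝓡 n) φ.symm Z w = chartRep φ Z w := by
  exact (isInvertible_mfderiv_symm hφ hw).inverse_apply_eq.2 (mfderiv_symm_chartDeriv hφ hw _).symm

lemma contDiffOn_chartRep [IsManifold (𝓡 n) ∞ N] (hφ : φ ∈ IsManifold.maximalAtlas (𝓡 n) ∞ N)
    {Z : VField n N} (hZ : IsSmoothField Z) : ContDiffOn ℝ ∞ (chartRep φ Z) φ.target := by
  intro w hw
  have h1 := ContMDiffAt.mpullback_vectorField_preimage (n := ∞) (m := ∞) (hZ (φ.symm w))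
    (contMDiffAt_symm_of_mem_maximalAtlas hφ hw) (isInvertible_mfderiv_symm hφ hw) (by simp)
  have h2 := contMDiffAt_vectorSpace_iff_contDiffAt.1 h1
  refine (h2.congr_of_eventuallyEq ?_).contDiffWithinAt
  filter_upwards [φ.open_target.mem_nhds hw] with w' hw'
  exact (mpullback_symm_eq_chartRep hφ Z hw').symm

lemma chartRep_mlieBracket [IsManifold (𝓡 n) ∞ N] (hφ : φ ∈ IsManifold.maximalAtlas (𝓡 n) ∞ N)
    {Z W : VField n N} (hZ : IsSmoothField Z) (hW : IsSmoothField W)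
    {w : EuclideanSpace ℝ (Fin n)} (hw : w ∈ φ.target) :
    chartRep φ (VectorField.mlieBracket (𝓡 n) Z W) w =
      VectorField.lieBracket ℝ (chartRep φ Z) (chartRep φ W) w := by
  have h2 : minSmoothness ℝ 2 ≤ (∞ : WithTop ℕ∞) := by
    simp only [minSmoothness_of_isRCLikeNormedField]
    exact ENat.LEInfty.out
  have h3 : minSmoothness ℝ 3 ≤ (∞ : WithTop ℕ∞) := by
    simp only [minSmoothness_of_isRCLikeNormedField]
    exact ENat.LEInfty.out
  have : IsManifold (𝓡 n) (minSmoothness ℝ 2) N := IsManifold.of_le h2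
  have : IsManifold (𝓡 n) (minSmoothness ℝ 3) N := IsManifold.of_le h3
  have he : ∀ Z : VField n N,
      VectorField.mpullback (𝓡 n) (𝓡 n) φ.symm Z =ᶠ[𝓝 w] chartRep φ Z := fun Z => by
    filter_upwards [φ.open_target.mem_nhds hw] with w' hw'
    exact mpullback_symm_eq_chartRep hφ Z hw'
  have h4 := VectorField.mpullback_mlieBracket (n := ∞) (I := 𝓡 n) (I' := 𝓡 n) (f := φ.symm)
    (x₀ := w) ((hZ _).mdifferentiableAt (by simp)) ((hW _).mdifferentiableAt (by simp))
    (contMDiffAt_symm_of_mem_maximalAtlas hφ hw) h2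
  rw [mpullback_symm_eq_chartRep hφ _ hw] at h4
  refine h4.trans ?_
  rw [← VectorField.mlieBracketWithin_univ, VectorField.mlieBracketWithin_eq_lieBracketWithin]
  refine (congrFun VectorField.lieBracketWithin_univ w).trans ?_
  exact Filter.EventuallyEq.lieBracket_vectorField_eq (he Z) (he W)

lemma chartRep_sum_smul {ι : Type*} [Fintype ι] (u : ι → ℝ) (Z : ι → VField n N)
    (w : EuclideanSpace ℝ (Fin n)) :
    chartRep φ (fun x => ∑ i, u i • Z i x) w = ∑ i, u i • chartRep φ (Z i) w := by
  simp only [chartRep]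
  rw [map_sum]
  exact Finset.sum_congr rfl fun i _ => map_smul _ _ _

lemma chartRep_apply {Z : VField n N} {x : N} (hx : x ∈ φ.source) :
    chartRep φ Z (φ x) = chartDeriv φ x (Z x) := by
  rw [chartRep, φ.left_inv hx]

/-- The expression in a chart of the velocity of a curve. -/
lemma hasDerivAt_chart_comp (hφ : φ ∈ IsManifold.maximalAtlas (𝓡 n) ∞ N) {γ : ℝ → N} {t : ℝ}
    {v : TangentSpace (𝓡 n) (γ t)}
    (h : HasMFDerivAt 𝓘(ℝ, ℝ) (𝓡 n) γ t ((1 : ℝ →L[ℝ] ℝ).smulRight v))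
    (ht : γ t ∈ φ.source) :
    HasDerivAt (fun τ => φ (γ τ)) (chartDeriv φ (γ t) v) t := by
  have h1 := (((mdifferentiable_of_mem_maximalAtlas hφ).mdifferentiableAt ht).hasMFDerivAt).comp t h
  have h2 : HasFDerivAt (fun τ => φ (γ τ))
      ((chartDeriv φ (γ t)).comp ((1 : ℝ →L[ℝ] ℝ).smulRight v)) t := h1.hasFDerivAt
  refine h2.hasDerivAt.congr_deriv ?_
  simp

/-- A curve whose expression in a chart has the velocity given by the expression of `Z` has
velocity `Z`. -/
lemma hasMFDerivAt_symm_comp (hφ : φ ∈ IsManifold.maximalAtlas (𝓡 n) ∞ N)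
    {c : ℝ → EuclideanSpace ℝ (Fin n)} {t : ℝ} {Z : VField n N} (ht : c t ∈ φ.target)
    (h : HasDerivAt c (chartRep φ Z (c t)) t) :
    HasMFDerivAt 𝓘(ℝ, ℝ) (𝓡 n) (fun τ => φ.symm (c τ)) t
      ((1 : ℝ →L[ℝ] ℝ).smulRight (Z (φ.symm (c t)))) := by
  have h0 := mdifferentiable_of_mem_maximalAtlas hφ
  have h1 : HasMFDerivAt 𝓘(ℝ, ℝ) (𝓡 n) c t
      (ContinuousLinearMap.toSpanSingleton ℝ (chartRep φ Z (c t))) :=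
    h.hasFDerivAt.hasMFDerivAt
  have h2 := ((h0.mdifferentiableAt_symm ht).hasMFDerivAt).comp t h1
  have h3 := mfderiv_symm_chartDeriv hφ ht (Z (φ.symm (c t)))
  refine h2.congr_mfderiv ?_
  refine ContinuousLinearMap.ext fun (r : ℝ) => ?_
  change mfderiv (𝓡 n) (𝓡 n) φ.symm (c t) (r • chartRep φ Z (c t)) = r • Z (φ.symm (c t))
  rw [← h3]
  exact map_smul _ _ _

end Charts

/-! ### Curves driven by finitely many vector fields -/

section Controlled

variable {n : ℕ} {N : Type*} [TopologicalSpace N] [ChartedSpace (EuclideanSpace ℝ (Fin n)) N]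
  {φ : OpenPartialHomeomorph N (EuclideanSpace ℝ (Fin n))} {ι : Type*} [Fintype ι]

/-- The `t`-dependent vector field `∑ i, u_i(t) Z_i`. -/
def controlled (Z : ι → VField n N) (u : ι → ℝ → ℝ) : TField n N :=
  fun t x => ∑ i, u i t • Z i x

lemma eventually_abs_le_of_continuousOn {u : ι → ℝ → ℝ} {J : Set ℝ}
    (hu : ∀ i, ContinuousOn (u i) J) {t : ℝ} (ht : t ∈ J) :
    ∃ M : ℝ, 0 ≤ M ∧ ∀ᶠ t' in 𝓝 t, t' ∈ J → ∀ i, |u i t'| ≤ M := by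
  refine ⟨∑ i, |u i t| + 1, by positivity, ?_⟩
  rw [← eventually_nhdsWithin_iff, eventually_all]
  intro i
  have h1 : ∀ᶠ t' in 𝓝[J] t, |u i t'| < |u i t| + 1 :=
    ((hu i t ht).abs).eventually_lt_const (by linarith)
  filter_upwards [h1] with t' h
  have := Finset.single_le_sum (f := fun i => |u i t|) (fun i _ => abs_nonneg _)
    (Finset.mem_univ i)
  linarith

lemma exists_ball_of_eventually {J : Set ℝ} {t : ℝ} {p : ℝ → Prop}
    (h : ∀ᶠ t' in 𝓝 t, t' ∈ J → p t') :
    ∃ δ > 0, ∀ t' ∈ J ∩ Metric.ball t δ, p t' := by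
  obtain ⟨δ, hδ, hp⟩ := Metric.eventually_nhds_iff_ball.1 h
  exact ⟨δ, hδ, fun t' ht' => hp t' ht'.2 ht'.1⟩

lemma ordConnected_inter_ball {J : Set ℝ} (hJ : IsPreconnected J) (t δ : ℝ) :
    (J ∩ Metric.ball t δ).OrdConnected :=
  hJ.ordConnected.inter (convex_ball t δ).ordConnected

lemma IsSolutionOn.mono {X : TField n N} {γ : ℝ → N} {J J' : Set ℝ} (h : IsSolutionOn X γ J)
    (hJ : J' ⊆ J) : IsSolutionOn X γ J' := fun t ht => h t (hJ ht)

lemma IsSolutionOn.continuousAt {X : TField n N} {γ : ℝ → N} {J : Set ℝ}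
    (h : IsSolutionOn X γ J) {t : ℝ} (ht : t ∈ J) : ContinuousAt γ t := (h t ht).continuousAt

lemma IsSolutionOn.hasDerivAt_chart {Z : ι → VField n N} {u : ι → ℝ → ℝ} {γ : ℝ → N} {J : Set ℝ}
    (h : IsSolutionOn (controlled Z u) γ J) (hφ : φ ∈ IsManifold.maximalAtlas (𝓡 n) ∞ N)
    {t : ℝ} (ht : t ∈ J) (hs : γ t ∈ φ.source) :
    HasDerivAt (fun τ => φ (γ τ)) (∑ i, u i t • chartRep φ (Z i) (φ (γ t))) t := by
  have h1 := hasDerivAt_chart_comp hφ (h t ht) hs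
  refine h1.congr_deriv ?_
  rw [← chartRep_sum_smul, chartRep_apply hs]
  rfl

variable [IsManifold (𝓡 n) ∞ N]

lemma eventually_lipschitz_chartRep (hφ : φ ∈ IsManifold.maximalAtlas (𝓡 n) ∞ N)
    {Z : ι → VField n N} (hZ : ∀ i, IsSmoothField (Z i)) {w : EuclideanSpace ℝ (Fin n)}
    (hw : w ∈ φ.target) :
    ∃ C : ℝ, 0 ≤ C ∧ ∃ Q ∈ 𝓝 w, ∀ a ∈ Q, ∀ b ∈ Q, ∀ i,
      ‖chartRep φ (Z i) a - chartRep φ (Z i) b‖ ≤ C * ‖a - b‖ := by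
  have h1 : ∀ i, ∃ K : NNReal, ∃ Q ∈ 𝓝 w, LipschitzOnWith K (chartRep φ (Z i)) Q := fun i =>
    ((((contDiffOn_chartRep hφ (hZ i)).contDiffAt (φ.open_target.mem_nhds hw)).of_le
      (m := 1) (by simp))).exists_lipschitzOnWith
  choose K Q hQ hL using h1
  refine ⟨∑ i, (K i : ℝ), by positivity, ⋂ i, Q i, Filter.iInter_mem.2 hQ, ?_⟩
  intro a ha b hb i
  have h2 := (hL i).dist_le_mul a (mem_iInter.1 ha i) b (mem_iInter.1 hb i)
  rw [dist_eq_norm, dist_eq_norm] at h2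
  refine h2.trans ?_
  gcongr
  exact Finset.single_le_sum (f := fun i => (K i : ℝ)) (fun i _ => (K i).2) (Finset.mem_univ i)

/-- Uniqueness of the solutions of `x' = ∑ i, u_i(t) Z_i(x)`. -/
lemma IsSolutionOn.eq_of_eq_at [T2Space N] {Z : ι → VField n N} (hZ : ∀ i, IsSmoothField (Z i))
    {u : ι → ℝ → ℝ} {J : Set ℝ} (hJ : IsPreconnected J) (hu : ∀ i, ContinuousOn (u i) J)
    {γ₁ γ₂ : ℝ → N} (h₁ : IsSolutionOn (controlled Z u) γ₁ J)
    (h₂ : IsSolutionOn (controlled Z u) γ₂ J) {t₀ : ℝ} (ht₀ : t₀ ∈ J) (h₀ : γ₁ t₀ = γ₂ t₀) :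
    ∀ t ∈ J, γ₁ t = γ₂ t := by
  refine forall_mem_of_locally hJ (P := fun t => γ₁ t = γ₂ t) (fun t ht => ?_) ht₀ h₀
  by_cases heq : γ₁ t = γ₂ t
  swap
  · obtain ⟨U, V, hU, hV, hxU, hyV, hUV⟩ := t2_separation heq
    refine ⟨_, inter_mem ((h₁.continuousAt ht).preimage_mem_nhds (hU.mem_nhds hxU))
      ((h₂.continuousAt ht).preimage_mem_nhds (hV.mem_nhds hyV)), ?_⟩
    intro t₁ ht₁ _ _ _ _ hP
    exact (disjoint_left.1 hUV ht₁.1 (hP ▸ ht₁.2)).elim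
  set φ := chartAt (EuclideanSpace ℝ (Fin n)) (γ₁ t) with hφdef
  have hφ : φ ∈ IsManifold.maximalAtlas (𝓡 n) ∞ N := IsManifold.chart_mem_maximalAtlas _
  have hs : γ₁ t ∈ φ.source := mem_chart_source _ _
  obtain ⟨M, hM, hMu⟩ := eventually_abs_le_of_continuousOn hu ht
  obtain ⟨C, hC, Q, hQ, hL⟩ := eventually_lipschitz_chartRep hφ hZ (φ.map_source hs)
  have hW : φ.source ∩ φ ⁻¹' Q ∈ 𝓝 (γ₁ t) := inter_mem (φ.open_source.mem_nhds hs)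
    ((φ.continuousAt hs).preimage_mem_nhds hQ)
  obtain ⟨δ, hδ, hball⟩ := exists_ball_of_eventually (J := J)
    (p := fun t' => (∀ i, |u i t'| ≤ M) ∧ γ₁ t' ∈ φ.source ∩ φ ⁻¹' Q ∧
      γ₂ t' ∈ φ.source ∩ φ ⁻¹' Q) (by
      filter_upwards [hMu, (h₁.continuousAt ht).preimage_mem_nhds hW,
        (h₂.continuousAt ht).preimage_mem_nhds (heq ▸ hW)] with t' a b c ht'
      exact ⟨a ht', b, c⟩)
  refine ⟨_, Metric.ball_mem_nhds t hδ, fun t₁ ht₁ hJ₁ t₂ ht₂ hJ₂ hP => ?_⟩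
  have key := eq_zero_of_norm_deriv_le (ordConnected_inter_ball hJ t δ)
    (z := fun τ => φ (γ₁ τ) - φ (γ₂ τ))
    (z' := fun τ => ∑ i, u i τ • chartRep φ (Z i) (φ (γ₁ τ)) -
      ∑ i, u i τ • chartRep φ (Z i) (φ (γ₂ τ))) (C := ∑ _i : ι, M * C)
    (fun τ hτ => (h₁.hasDerivAt_chart hφ hτ.1 (hball τ hτ).2.1.1).sub
      (h₂.hasDerivAt_chart hφ hτ.1 (hball τ hτ).2.2.1))
    (fun τ hτ => by
      obtain ⟨a, b, c⟩ := hball τ hτ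
      rw [← Finset.sum_sub_distrib, Finset.sum_mul]
      refine norm_sum_le_of_le _ fun i _ => ?_
      rw [← smul_sub, norm_smul, Real.norm_eq_abs, mul_assoc]
      exact mul_le_mul (a i) (hL _ b.2 _ c.2 i) (norm_nonneg _) hM)
    (t₀ := t₁) ⟨hJ₁, ht₁⟩ (by rw [hP, sub_self]) t₂ ⟨hJ₂, ht₂⟩
  obtain ⟨_, b, c⟩ := hball t₂ ⟨hJ₂, ht₂⟩
  exact φ.injOn b.1 c.1 (sub_eq_zero.1 key)

/-- The derivative of a vector field along a curve, in a chart, expressed through brackets. -/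
lemma IsSolutionOn.hasDerivAt_chartRep {Z : ι → VField n N} (hZ : ∀ i, IsSmoothField (Z i))
    {W : VField n N} (hW : IsSmoothField W)
    {u : ι → ℝ → ℝ} {γ : ℝ → N} {J : Set ℝ}
    (h : IsSolutionOn (controlled Z u) γ J) (hφ : φ ∈ IsManifold.maximalAtlas (𝓡 n) ∞ N)
    {t : ℝ} (ht : t ∈ J) (hs : γ t ∈ φ.source) :
    HasDerivAt (fun τ => chartRep φ W (φ (γ τ)))
      (∑ i, u i t • (chartRep φ (VectorField.mlieBracket (𝓡 n) (Z i) W) (φ (γ t)) +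
        fderiv ℝ (chartRep φ (Z i)) (φ (γ t)) (chartRep φ W (φ (γ t))))) t := by
  have hd : DifferentiableAt ℝ (chartRep φ W) (φ (γ t)) :=
    ((contDiffOn_chartRep hφ hW).contDiffAt
      (φ.open_target.mem_nhds (φ.map_source hs))).differentiableAt (by simp)
  refine (hd.hasFDerivAt.comp_hasDerivAt t (h.hasDerivAt_chart hφ ht hs)).congr_deriv ?_
  rw [map_sum]
  refine Finset.sum_congr rfl fun i _ => ?_
  rw [map_smul, chartRep_mlieBracket hφ (hZ i) hW (φ.map_source hs), VectorField.lieBracket]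
  simp

/-- A finite family of vector fields whose span is normalised by the driving fields and which
vanishes at one point of a curve vanishes along the whole curve. -/
lemma IsSolutionOn.eq_zero_of_bracket {Z : ι → VField n N} (hZ : ∀ i, IsSmoothField (Z i))
    {κ : Type*} [Fintype κ] {W : κ → VField n N} (hW : ∀ j, IsSmoothField (W j))
    {c : ι → κ → κ → ℝ}
    (hc : ∀ i j x, VectorField.mlieBracket (𝓡 n) (Z i) (W j) x = ∑ k, c i j k • W k x)
    {u : ι → ℝ → ℝ} {J : Set ℝ} (hJ : IsPreconnected J) (hu : ∀ i, ContinuousOn (u i) J)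
    {γ : ℝ → N} (h : IsSolutionOn (controlled Z u) γ J) {t₀ : ℝ} (ht₀ : t₀ ∈ J)
    (h₀ : ∀ j, W j (γ t₀) = 0) : ∀ t ∈ J, ∀ j, W j (γ t) = 0 := by
  refine forall_mem_of_locally hJ (P := fun t => ∀ j, W j (γ t) = 0) (fun t ht => ?_) ht₀ h₀
  set φ := chartAt (EuclideanSpace ℝ (Fin n)) (γ t) with hφdef
  have hφ : φ ∈ IsManifold.maximalAtlas (𝓡 n) ∞ N := IsManifold.chart_mem_maximalAtlas _
  have hs : γ t ∈ φ.source := mem_chart_source _ _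
  obtain ⟨M, hM, hMu⟩ := eventually_abs_le_of_continuousOn hu ht
  have hD : ∀ i, ∀ᶠ w in 𝓝 (φ (γ t)), ‖fderiv ℝ (chartRep φ (Z i)) w‖ <
      ‖fderiv ℝ (chartRep φ (Z i)) (φ (γ t))‖ + 1 := fun i => by
    have h1 : ContDiffAt ℝ ∞ (chartRep φ (Z i)) (φ (γ t)) :=
      (contDiffOn_chartRep hφ (hZ i)).contDiffAt
      (φ.open_target.mem_nhds (φ.map_source hs))
    have h2 : ContDiffAt ℝ 0 (fderiv ℝ (chartRep φ (Z i))) (φ (γ t)) :=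
      h1.fderiv_right (by simp)
    exact h2.continuousAt.norm.eventually_lt_const (by linarith)
  set B : ι → ℝ := fun i => ‖fderiv ℝ (chartRep φ (Z i)) (φ (γ t))‖ + 1
  have hW' : ∀ᶠ x in 𝓝 (γ t), x ∈ φ.source ∧ ∀ i, ‖fderiv ℝ (chartRep φ (Z i)) (φ x)‖ ≤ B i := by
    filter_upwards [φ.open_source.mem_nhds hs,
      (φ.continuousAt hs).eventually (eventually_all.2 hD)] with x hx hx'
    exact ⟨hx, fun i => (hx' i).le⟩
  obtain ⟨δ, hδ, hball⟩ := exists_ball_of_eventually (J := J)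
    (p := fun t' => (∀ i, |u i t'| ≤ M) ∧ γ t' ∈ φ.source ∧
      ∀ i, ‖fderiv ℝ (chartRep φ (Z i)) (φ (γ t'))‖ ≤ B i) (by
      filter_upwards [hMu, (h.continuousAt ht).eventually hW'] with t' a b ht'
      exact ⟨a ht', b⟩)
  refine ⟨_, Metric.ball_mem_nhds t hδ, fun t₁ ht₁ hJ₁ t₂ ht₂ hJ₂ hP => ?_⟩
  have hB : ∀ i, 0 ≤ B i := fun i => by positivity
  have key := eq_zero_of_norm_deriv_le (ordConnected_inter_ball hJ t δ)
    (z := fun τ j => chartRep φ (W j) (φ (γ τ)))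
    (z' := fun τ j => ∑ i, u i τ •
      (chartRep φ (VectorField.mlieBracket (𝓡 n) (Z i) (W j)) (φ (γ τ)) +
        fderiv ℝ (chartRep φ (Z i)) (φ (γ τ)) (chartRep φ (W j) (φ (γ τ)))))
    (C := ∑ i, M * (∑ j, ∑ k, |c i j k| + B i))
    (fun τ hτ => hasDerivAt_pi.2 fun j =>
      h.hasDerivAt_chartRep hZ (hW j) hφ hτ.1 (hball τ hτ).2.1)
    (fun τ hτ => by
      obtain ⟨a, b, d⟩ := hball τ hτ
      have hn : ∀ k, ‖chartRep φ (W k) (φ (γ τ))‖ ≤ ‖fun j => chartRep φ (W j) (φ (γ τ))‖ :=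
        fun k => norm_le_pi_norm (fun j => chartRep φ (W j) (φ (γ τ))) k
      set z := ‖fun j => chartRep φ (W j) (φ (γ τ))‖
      have hz : 0 ≤ z := norm_nonneg _
      refine (pi_norm_le_iff_of_nonneg (by positivity)).2 fun j => ?_
      rw [Finset.sum_mul]
      refine norm_sum_le_of_le _ fun i _ => ?_
      rw [norm_smul, Real.norm_eq_abs, mul_assoc]
      refine mul_le_mul (a i) ?_ (norm_nonneg _) hM
      rw [add_mul]
      refine norm_add_le_of_le ?_ ?_
      · have : chartRep φ (VectorField.mlieBracket (𝓡 n) (Z i) (W j)) (φ (γ τ)) =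
            ∑ k, c i j k • chartRep φ (W k) (φ (γ τ)) := by
          rw [← chartRep_sum_smul, chartRep_apply b, chartRep_apply b, hc]
        rw [this]
        have h3 : ∑ k, |c i j k| ≤ ∑ j, ∑ k, |c i j k| :=
          Finset.single_le_sum (f := fun j => ∑ k, |c i j k|)
            (fun j _ => Finset.sum_nonneg fun k _ => abs_nonneg _) (Finset.mem_univ j)
        refine le_trans ?_ (mul_le_mul_of_nonneg_right h3 hz)
        rw [Finset.sum_mul]
        refine norm_sum_le_of_le _ fun k _ => ?_
        rw [norm_smul, Real.norm_eq_abs]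
        exact mul_le_mul_of_nonneg_left (hn k) (abs_nonneg _)
      · exact (ContinuousLinearMap.le_opNorm _ _).trans
          (mul_le_mul (d i) (hn j) (norm_nonneg _) (hB i)))
    (t₀ := t₁) ⟨hJ₁, ht₁⟩ (by
      funext j
      rw [chartRep_apply (hball t₁ ⟨hJ₁, ht₁⟩).2.1, hP j, map_zero]; rfl) t₂ ⟨hJ₂, ht₂⟩
  intro j
  have h4 := congrFun key j
  have hb := (hball t₂ ⟨hJ₂, ht₂⟩).2.1
  simp only [Pi.zero_apply] at h4
  rw [chartRep_apply hb] at h4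
  exact chartDeriv_injective hφ hb (h4.trans (map_zero _).symm)

end Controlled

/-! ### Curves tangent to a foliation -/

section Leaves

variable {n s : ℕ} {N : Type*} [TopologicalSpace N] [ChartedSpace (EuclideanSpace ℝ (Fin n)) N]

/-- A chart of `N` around a point of a leaf, with values in `ℝˢ × C`, in which the leaf is locally
the plaque `ℝˢ × {0}`: `φ` is the chart of `N`, `ψ` a chart of the leaf, and `A` splits the model
space of `N`. -/
structure PlaqueChart (F : Foliation n N s) (k : F.ι) (y : F.Leaf k) (C : Type)
    [NormedAddCommGroup C] [NormedSpace ℝ C] where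
  φ : OpenPartialHomeomorph N (EuclideanSpace ℝ (Fin n))
  ψ : OpenPartialHomeomorph (F.Leaf k) (EuclideanSpace ℝ (Fin s))
  A : (EuclideanSpace ℝ (Fin s) × C) ≃L[ℝ] EuclideanSpace ℝ (Fin n)
  φ_mem : φ ∈ IsManifold.maximalAtlas (𝓡 n) ∞ N
  ψ_mem : ψ ∈ IsManifold.maximalAtlas (𝓡 s) ∞ (F.Leaf k)
  mem_ψ : y ∈ ψ.source
  maps : ∀ y' ∈ ψ.source, F.incl k y' ∈ φ.source
  eq : ∀ y' ∈ ψ.source, φ (F.incl k y') = A (ψ y', 0)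

lemma Foliation.exists_plaqueChart (F : Foliation n N s) (k : F.ι) (y : F.Leaf k) :
    ∃ (C : Type) (_ : NormedAddCommGroup C) (_ : NormedSpace ℝ C),
      Nonempty (PlaqueChart F k y C) := by
  have h := (F.immersion k).isImmersionAt y
  refine ⟨h.complement, inferInstance, inferInstance, ⟨⟨h.codChart, h.domChart, h.equiv,
    h.codChart_mem_maximalAtlas, h.domChart_mem_maximalAtlas, h.mem_domChart_source,
    fun y' hy' => h.source_subset_preimage_source hy', fun y' hy' => ?_⟩⟩⟩
  have h0 : h.domChart y' ∈ (h.domChart.extend (𝓡 s)).target := by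
    simpa using h.domChart.map_source hy'
  have h1 := h.writtenInCharts h0
  simpa [h.domChart.left_inv hy'] using h1

namespace PlaqueChart

variable {F : Foliation n N s} {k : F.ι} {y : F.Leaf k} {C : Type}
  [NormedAddCommGroup C] [NormedSpace ℝ C] (P : PlaqueChart F k y C)

/-- The coordinate along the plaques. -/
def base (x : N) : EuclideanSpace ℝ (Fin s) := (P.A.symm (P.φ x)).1

/-- The transverse coordinate. -/
def height (x : N) : C := (P.A.symm (P.φ x)).2

lemma chartDeriv_mfderiv_incl {y' : F.Leaf k} (hy' : y' ∈ P.ψ.source)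
    (ξ : TangentSpace (𝓡 s) y') :
    chartDeriv P.φ (F.incl k y') (mfderiv (𝓡 s) (𝓡 n) (F.incl k) y' ξ) =
      P.A (chartDeriv P.ψ y' ξ, 0) := by
  have h1 : MDifferentiableAt (𝓡 s) (𝓡 n) (F.incl k) y' :=
    ((F.immersion k).contMDiff y').mdifferentiableAt (by simp)
  have h2 := ((mdifferentiable_of_mem_maximalAtlas P.φ_mem).mdifferentiableAt
    (P.maps y' hy')).hasMFDerivAt.comp y' h1.hasMFDerivAt
  have h3 := ((mdifferentiable_of_mem_maximalAtlas P.ψ_mem).mdifferentiableAt hy').hasMFDerivAt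
  let L : EuclideanSpace ℝ (Fin s) →L[ℝ] EuclideanSpace ℝ (Fin n) :=
    (P.A : _ →L[ℝ] _).comp (ContinuousLinearMap.inl ℝ _ C)
  have h4 : HasMFDerivAt (𝓡 s) (𝓡 n) L (P.ψ y') L := L.hasFDerivAt.hasMFDerivAt
  have h5 := h4.comp y' h3
  have h6 : (L ∘ P.ψ) =ᶠ[𝓝 y'] (P.φ ∘ F.incl k) := by
    filter_upwards [P.ψ.open_source.mem_nhds hy'] with z hz
    exact (P.eq z hz).symm
  exact DFunLike.congr_fun (hasMFDerivAt_unique h2 (h5.congr_of_eventuallyEq h6.symm)) ξ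

variable {D : (x : N) → Submodule ℝ (TangentSpace (𝓡 n) x)}

lemma exists_chartDeriv_eq (hF : F.Integrates D) {y' : F.Leaf k} (hy' : y' ∈ P.ψ.source)
    {v : TangentSpace (𝓡 n) (F.incl k y')} (hv : v ∈ D (F.incl k y')) :
    ∃ ζ, chartDeriv P.φ (F.incl k y') v = P.A (ζ, 0) := by
  rw [← hF k y'] at hv
  obtain ⟨ξ, rfl⟩ := hv
  exact ⟨_, P.chartDeriv_mfderiv_incl hy' ξ⟩

lemma exists_mem_of_base (hF : F.Integrates D) {y' : F.Leaf k} (hy' : y' ∈ P.ψ.source)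
    (ζ : EuclideanSpace ℝ (Fin s)) :
    ∃ v ∈ D (F.incl k y'), chartDeriv P.φ (F.incl k y') v = P.A (ζ, 0) := by
  obtain ⟨ξ, rfl⟩ := chartDeriv_surjective P.ψ_mem hy' ζ
  refine ⟨mfderiv (𝓡 s) (𝓡 n) (F.incl k) y' ξ, ?_, P.chartDeriv_mfderiv_incl hy' ξ⟩
  rw [← hF k y']
  exact ⟨ξ, rfl⟩

lemma height_incl {y' : F.Leaf k} (hy' : y' ∈ P.ψ.source) : P.height (F.incl k y') = 0 := by
  simp [height, P.eq y' hy']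

/-- Vector fields tangent to the leaves have transverse components bounded by the distance to the
plaque. -/
lemma exists_nhds_height_le [IsManifold (𝓡 n) ∞ N] (hF : F.Integrates D)
    {ι : Type*} [Fintype ι] {Z : ι → VField n N}
    (hZ : ∀ i, IsSmoothField (Z i)) (hZD : ∀ i x, Z i x ∈ D x) {Q : Set (F.Leaf k)} (hQ : Q ∈ 𝓝 y) :
    ∃ U ∈ 𝓝 (F.incl k y), U ⊆ P.φ.source ∧ ∃ K : ℝ, 0 ≤ K ∧ ∀ x ∈ U,
      (∀ i, ‖(P.A.symm (chartRep P.φ (Z i) (P.φ x))).2‖ ≤ K * ‖P.height x‖) ∧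
      (P.height x = 0 → ∃ y' ∈ Q ∩ P.ψ.source, P.ψ y' = P.base x ∧ F.incl k y' = x) := by
  set w₀ := P.φ (F.incl k y) with hw₀
  let A : (EuclideanSpace ℝ (Fin s) × C) →L[ℝ] EuclideanSpace ℝ (Fin n) := P.A
  let A' : EuclideanSpace ℝ (Fin n) →L[ℝ] (EuclideanSpace ℝ (Fin s) × C) := P.A.symm
  have hs := P.maps y P.mem_ψ
  have hw₀A : P.A.symm w₀ = (P.ψ y, 0) := by rw [hw₀, P.eq y P.mem_ψ]; simp
  -- the projection onto the plaque
  let π : EuclideanSpace ℝ (Fin n) → EuclideanSpace ℝ (Fin n) := fun w => P.A ((P.A.symm w).1, 0)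
  have hπc : Continuous π := by fun_prop
  have hπ₀ : π w₀ = w₀ := by simp only [π]; rw [hw₀A]; simp [hw₀, P.eq y P.mem_ψ]
  obtain ⟨K, hK, Q₁, hQ₁, hL⟩ := eventually_lipschitz_chartRep P.φ_mem hZ (P.φ.map_source hs)
  have e1 : ∀ᶠ w in 𝓝 w₀, (P.A.symm w).1 ∈ P.ψ.target ∩ P.ψ.symm ⁻¹' Q := by
    have hc : ContinuousAt (fun w => (P.A.symm w).1) w₀ := by fun_prop
    refine hc.preimage_mem_nhds ?_
    rw [hw₀A]
    refine inter_mem (P.ψ.open_target.mem_nhds (P.ψ.map_source P.mem_ψ)) ?_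
    refine (P.ψ.symm.continuousAt (P.ψ.map_source P.mem_ψ)).preimage_mem_nhds ?_
    simpa [P.ψ.left_inv P.mem_ψ] using hQ
  have e2 : ∀ᶠ w in 𝓝 w₀, π w ∈ Q₁ := by
    have : π ⁻¹' Q₁ ∈ 𝓝 w₀ := hπc.continuousAt.preimage_mem_nhds (by rwa [hπ₀])
    exact this
  have e3 : ∀ᶠ x in 𝓝 (F.incl k y), x ∈ P.φ.source ∧ P.φ x ∈ Q₁ ∧ π (P.φ x) ∈ Q₁ ∧
      (P.A.symm (P.φ x)).1 ∈ P.ψ.target ∩ P.ψ.symm ⁻¹' Q := by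
    filter_upwards [P.φ.open_source.mem_nhds hs, (P.φ.continuousAt hs).eventually hQ₁,
      (P.φ.continuousAt hs).eventually e2, (P.φ.continuousAt hs).eventually e1] with x a b c d
    exact ⟨a, b, c, d⟩
  refine ⟨_, e3, fun x hx => hx.1,
    ‖A'‖ * (K * ‖A‖), by positivity, ?_⟩
  rintro x ⟨hx, hxQ, hxπ, hxt, hxQ'⟩
  set y' := P.ψ.symm (P.base x) with hy'
  have hy's : y' ∈ P.ψ.source := P.ψ.map_target hxt
  have hψy' : P.ψ y' = P.base x := P.ψ.right_inv hxt
  have hπx : P.φ (F.incl k y') = π (P.φ x) := by rw [P.eq y' hy's, hψy']; rfl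
  have hsub : P.φ x - π (P.φ x) = P.A (0, P.height x) := by
    have : P.φ x = P.A (P.A.symm (P.φ x)) := by simp
    conv_lhs => rw [this]
    simp only [π, ← map_sub]
    congr 1
    ext <;> simp [height]
  constructor
  · intro i
    obtain ⟨ζ, hζ⟩ := P.exists_chartDeriv_eq hF hy's (hZD i _)
    rw [← chartRep_apply (P.maps y' hy's), hπx] at hζ
    have h1 : (P.A.symm (chartRep P.φ (Z i) (P.φ x))).2 =
        (P.A.symm (chartRep P.φ (Z i) (P.φ x) - chartRep P.φ (Z i) (π (P.φ x)))).2 := by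
      rw [map_sub, hζ]; simp
    rw [h1]
    calc _ ≤ ‖P.A.symm (chartRep P.φ (Z i) (P.φ x) - chartRep P.φ (Z i) (π (P.φ x)))‖ :=
          norm_snd_le _
      _ ≤ ‖A'‖ *
          ‖chartRep P.φ (Z i) (P.φ x) - chartRep P.φ (Z i) (π (P.φ x))‖ :=
          A'.le_opNorm _
      _ ≤ ‖A'‖ * (K * (‖A‖ * ‖P.height x‖)) := by
          gcongr
          refine (hL _ hxQ _ hxπ i).trans ?_
          gcongr
          rw [hsub]
          refine (A.le_opNorm _).trans (le_of_eq ?_)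
          simp [Prod.norm_def]
      _ = _ := by ring
  · intro h0
    refine ⟨y', ⟨hxQ', hy's⟩, hψy', ?_⟩
    refine P.φ.injOn (P.maps y' hy's) hx ?_
    rw [hπx]
    rw [h0] at hsub
    have : P.φ x - π (P.φ x) = 0 := by rw [hsub]; simp
    exact (sub_eq_zero.1 this).symm

/-- A curve tangent to the leaves that stays near the plaque keeps the height `0`. -/
lemma height_eq_zero [IsManifold (𝓡 n) ∞ N] {ι : Type*} [Fintype ι] {Z : ι → VField n N}
    {u : ι → ℝ → ℝ} {S : Set ℝ} (hS : S.OrdConnected) {γ : ℝ → N}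
    (h : IsSolutionOn (controlled Z u) γ S) {M : ℝ} (hM : 0 ≤ M)
    (hu : ∀ t ∈ S, ∀ i, |u i t| ≤ M) {U : Set N} (hU : U ⊆ P.φ.source) {K : ℝ}
    (hK : ∀ x ∈ U, ∀ i, ‖(P.A.symm (chartRep P.φ (Z i) (P.φ x))).2‖ ≤ K * ‖P.height x‖)
    (hγ : ∀ t ∈ S, γ t ∈ U) {t₀ : ℝ} (ht₀ : t₀ ∈ S) (h₀ : P.height (γ t₀) = 0) :
    ∀ t ∈ S, P.height (γ t) = 0 := by
  let L : EuclideanSpace ℝ (Fin n) →L[ℝ] C :=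
    (ContinuousLinearMap.snd ℝ (EuclideanSpace ℝ (Fin s)) C).comp (P.A.symm : _ →L[ℝ] _)
  refine eq_zero_of_norm_deriv_le hS (z := fun t => L (P.φ (γ t)))
    (z' := fun t => L (∑ i, u i t • chartRep P.φ (Z i) (P.φ (γ t)))) (C := ∑ _i : ι, M * K)
    (fun t ht => L.hasFDerivAt.comp_hasDerivAt t
      (h.hasDerivAt_chart P.φ_mem ht (hU (hγ t ht)))) (fun t ht => ?_) ht₀ h₀
  rw [map_sum, Finset.sum_mul]
  refine norm_sum_le_of_le _ fun i _ => ?_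
  rw [map_smul, norm_smul, Real.norm_eq_abs, mul_assoc]
  exact mul_le_mul (hu t ht i) (hK _ (hγ t ht) i) (norm_nonneg _) hM

end PlaqueChart

lemma Foliation.leaf_unique (F : Foliation n N s) {k j : F.ι} {x : N} (hk : x ∈ F.leaf k)
    (hj : x ∈ F.leaf j) : k = j :=
  (F.partition x).unique hk hj

/-- Curves driven by vector fields tangent to the leaves stay in a leaf. -/
lemma IsSolutionOn.mem_leaf [IsManifold (𝓡 n) ∞ N] {F : Foliation n N s}
    {D : (x : N) → Submodule ℝ (TangentSpace (𝓡 n) x)} (hF : F.Integrates D)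
    {ι : Type*} [Fintype ι] {Z : ι → VField n N}
    (hZ : ∀ i, IsSmoothField (Z i)) (hZD : ∀ i x, Z i x ∈ D x) {u : ι → ℝ → ℝ} {J : Set ℝ}
    (hJ : IsPreconnected J) (hu : ∀ i, ContinuousOn (u i) J) {γ : ℝ → N}
    (h : IsSolutionOn (controlled Z u) γ J) {k : F.ι} {t₀ : ℝ} (ht₀ : t₀ ∈ J)
    (h₀ : γ t₀ ∈ F.leaf k) : ∀ t ∈ J, γ t ∈ F.leaf k := by
  refine forall_mem_of_locally hJ (P := fun t => γ t ∈ F.leaf k) (fun t ht => ?_) ht₀ h₀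
  obtain ⟨j, ⟨y, hy⟩, -⟩ := F.partition (γ t)
  obtain ⟨C, _, _, ⟨P⟩⟩ := F.exists_plaqueChart j y
  obtain ⟨U, hU, hUs, K, hK, hUK⟩ := P.exists_nhds_height_le hF hZ hZD (Q := univ) univ_mem
  obtain ⟨M, hM, hMu⟩ := eventually_abs_le_of_continuousOn hu ht
  obtain ⟨δ, hδ, hball⟩ := exists_ball_of_eventually (J := J)
    (p := fun t' => (∀ i, |u i t'| ≤ M) ∧ γ t' ∈ U) (by
      filter_upwards [hMu, (h.continuousAt ht).preimage_mem_nhds (hy ▸ hU)] with t' a b ht'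
      exact ⟨a ht', b⟩)
  have hz := P.height_eq_zero (ordConnected_inter_ball hJ t δ) (h.mono inter_subset_left) hM
    (fun t' ht' => (hball t' ht').1) hUs (fun x hx => (hUK x hx).1)
    (fun t' ht' => (hball t' ht').2) (t₀ := t) ⟨ht, Metric.mem_ball_self hδ⟩
    (by rw [← hy, P.height_incl P.mem_ψ])
  have hleaf : ∀ t' ∈ J ∩ Metric.ball t δ, γ t' ∈ F.leaf j := fun t' ht' => by
    obtain ⟨y', -, -, hy'⟩ := (hUK _ (hball t' ht').2).2 (hz t' ht')
    exact ⟨y', hy'⟩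
  refine ⟨_, Metric.ball_mem_nhds t hδ, fun t₁ ht₁ hJ₁ t₂ ht₂ hJ₂ hP => ?_⟩
  rw [F.leaf_unique hP (hleaf t₁ ⟨hJ₁, ht₁⟩)]
  exact hleaf t₂ ⟨hJ₂, ht₂⟩

end Leaves

/-! ### Flows in a chart -/

section ModelFlow

variable {E : Type} [NormedAddCommGroup E] [NormedSpace ℝ E] [CompleteSpace E]
  {ι : Type} [Fintype ι]

/-- The primitive of `β • f`, as a function on the whole real line. -/
def weightedPrimitive {E : Type*} [NormedAddCommGroup E] [NormedSpace ℝ E]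
    (β : C(ℝ, ℝ)) (f : C(unitInterval, E)) (t : ℝ) : E :=
  primitive (pointwiseApply unitInterval E E
    ⟨fun u => β u • ContinuousLinearMap.id ℝ E, by fun_prop⟩ f) t

lemma weightedVolterra_apply (β : C(ℝ, ℝ)) (f : C(unitInterval, E)) (u : unitInterval) :
    weightedVolterra E β f u = weightedPrimitive β f u := rfl

lemma weightedPrimitive_zero {E : Type*} [NormedAddCommGroup E] [NormedSpace ℝ E]
    (β : C(ℝ, ℝ)) (f : C(unitInterval, E)) :
    weightedPrimitive β f 0 = 0 := by simp [weightedPrimitive, primitive]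

lemma hasDerivAt_weightedPrimitive (β : C(ℝ, ℝ)) (f : C(unitInterval, E)) {t : ℝ}
    (ht : t ∈ Icc (0 : ℝ) 1) :
    HasDerivAt (weightedPrimitive β f) (β t • f ⟨t, ht⟩) t := by
  refine (hasDerivAt_primitive _ t).congr_deriv ?_
  rw [projIcc_of_mem _ ht]
  simp

/-- Existence and smooth dependence on parameters and initial conditions for
`c' = ∑ i, a i * β i(t) • v i(c)` on `[0, 1]`, for `a` near `0`. The last clause is the equation of
variations for the time-one map. -/
lemma exists_model_flow (v : ι → C(E, E)) (hv : ∀ i, ContDiff ℝ ∞ (v i)) (β : ι → C(ℝ, ℝ))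
    (w₀ : E) :
    ∃ c : (ι → ℝ) × E → ℝ → E,
      (∀ᶠ z in 𝓝 (0, w₀), ContDiffAt ℝ ∞ (fun z => c z 1) z) ∧
      (∀ V ∈ 𝓝 w₀, ∀ᶠ z in 𝓝 ((0, w₀) : (ι → ℝ) × E), ∀ t ∈ Icc (0 : ℝ) 1, c z t ∈ V) ∧
      ∀ᶠ z in 𝓝 ((0, w₀) : (ι → ℝ) × E), c z 0 = z.2 ∧
        (∀ t ∈ Icc (0 : ℝ) 1, HasDerivAt (c z) (∑ i, (z.1 i * β i t) • v i (c z t)) t) ∧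
        ∀ (w : ι → ℝ) (ξ : E) (ζ : ℝ → E), ζ 0 = ξ →
          (∀ t ∈ Icc (0 : ℝ) 1, HasDerivAt ζ (∑ i, ((z.1 i * β i t) •
            fderiv ℝ (v i) (c z t) (ζ t) + (w i * β i t) • v i (c z t))) t) →
          fderiv ℝ (fun z => c z 1) z (w, ξ) = ζ 1 := by
  obtain ⟨γ, hγs, hγ₀, hγ⟩ := exists_contDiff_flow v hv β w₀
  let c : (ι → ℝ) × E → ℝ → E := fun z t =>
    z.2 + ∑ i, z.1 i • weightedPrimitive (β i) ((v i).comp (γ z)) t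
  have hcγ : ∀ᶠ z in 𝓝 ((0, w₀) : (ι → ℝ) × E), ∀ t (ht : t ∈ Icc (0 : ℝ) 1),
      c z t = γ z ⟨t, ht⟩ := by
    filter_upwards [hγ] with z hz t ht
    have := DFunLike.congr_fun hz ⟨t, ht⟩
    rw [this]
    simp only [ContinuousMap.add_apply, constCurve_apply, ContinuousMap.coe_sum,
      Finset.sum_apply, ContinuousMap.smul_apply, weightedVolterra_apply, c]
  have hc1 : ∀ᶠ z in 𝓝 ((0, w₀) : (ι → ℝ) × E), c z 1 = γ z 1 := by
    filter_upwards [hcγ] with z hz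
    exact hz 1 (by simp)
  let ev : C(unitInterval, E) →L[ℝ] E := ContinuousMap.evalCLM ℝ (1 : unitInterval)
  refine ⟨c, ?_, ?_, ?_⟩
  · filter_upwards [hγs, hc1.eventually_nhds] with z hz hz1
    exact (ev.contDiff.contDiffAt.comp z hz).congr_of_eventuallyEq hz1
  · intro V hV
    obtain ⟨ε, hε, hεV⟩ := Metric.mem_nhds_iff.1 hV
    have h1 : ∀ᶠ z in 𝓝 ((0, w₀) : (ι → ℝ) × E), γ z ∈ Metric.ball (constCurve E w₀) ε :=
      hγs.self_of_nhds.continuousAt.preimage_mem_nhds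
        (by rw [hγ₀]; exact Metric.ball_mem_nhds _ hε)
    filter_upwards [h1, hcγ] with z hz hcz t ht
    rw [hcz t ht]
    refine hεV ?_
    exact (ContinuousMap.dist_apply_le_dist (⟨t, ht⟩ : unitInterval)).trans_lt hz
  · filter_upwards [hcγ, hγ.eventually_nhds, hγs, hc1.eventually_nhds] with z hz hzγ hzs hz1
    have hcd : ∀ t ∈ Icc (0 : ℝ) 1,
        HasDerivAt (c z) (∑ i, (z.1 i * β i t) • v i (c z t)) t := fun t ht => by
      refine (HasDerivAt.const_add z.2 (HasDerivAt.fun_sum fun i (_ : i ∈ Finset.univ) =>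
        (hasDerivAt_weightedPrimitive (β i) ((v i).comp (γ z)) ht).const_smul (z.1 i))).congr_deriv
        ?_
      refine Finset.sum_congr rfl fun i _ => ?_
      rw [hz t ht, smul_smul]; rfl
    refine ⟨by simp [c, weightedPrimitive_zero], hcd, fun w ξ ζ hζ₀ hζ => ?_⟩
    let v' : ι → C(E, E →L[ℝ] E) := fun i => ⟨fderiv ℝ (v i), (hv i).continuous_fderiv (by simp)⟩
    have hvar := fderiv_flow_apply v hv β (hzs.differentiableAt (by simp)) hzγ v'
      (fun _ _ => rfl) w ξ
    set η := fderiv ℝ γ z (w, ξ) with hη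
    -- the extension of `η` to the real line
    let ηx : ℝ → E := fun t => ξ + ∑ i, (z.1 i • weightedPrimitive (β i)
      (pointwiseApply unitInterval E E ((v' i).comp (γ z)) η) t +
        w i • weightedPrimitive (β i) ((v i).comp (γ z)) t)
    have hηx : ∀ t (ht : t ∈ Icc (0 : ℝ) 1), ηx t = η ⟨t, ht⟩ := fun t ht => by
      have := DFunLike.congr_fun hvar ⟨t, ht⟩
      rw [this]
      simp only [ContinuousMap.add_apply, constCurve_apply, ContinuousMap.coe_sum,
        Finset.sum_apply, ContinuousMap.smul_apply, weightedVolterra_apply, ηx]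
    have hηd : ∀ t ∈ Icc (0 : ℝ) 1, HasDerivAt ηx (∑ i, ((z.1 i * β i t) •
        fderiv ℝ (v i) (c z t) (ηx t) + (w i * β i t) • v i (c z t))) t := fun t ht => by
      refine (HasDerivAt.const_add ξ (HasDerivAt.fun_sum fun i (_ : i ∈ Finset.univ) =>
        ((hasDerivAt_weightedPrimitive (β i) _ ht).const_smul (z.1 i)).add
        ((hasDerivAt_weightedPrimitive (β i) ((v i).comp (γ z)) ht).const_smul (w i)))).congr_deriv
        ?_
      refine Finset.sum_congr rfl fun i _ => ?_
      rw [hz t ht, hηx t ht, smul_smul, smul_smul]; rfl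
    have hcc : ContinuousOn (c z) (Icc 0 1) := fun t ht => (hcd t ht).continuousAt.continuousWithinAt
    have hbd : ContinuousOn (fun t => ∑ i, |z.1 i * β i t| * ‖fderiv ℝ (v i) (c z t)‖)
        (Icc 0 1) := by
      refine continuousOn_finsetSum _ fun i _ => ?_
      have h1 : ContinuousOn (fun t => fderiv ℝ (v i) (c z t)) (Icc 0 1) :=
        (v' i).continuous.comp_continuousOn hcc
      exact ContinuousOn.mul (Continuous.continuousOn (by fun_prop)) h1.norm
    obtain ⟨M, hM⟩ := isCompact_Icc.exists_bound_of_continuousOn hbd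
    have key := eq_zero_of_norm_deriv_le (S := Icc (0 : ℝ) 1) ordConnected_Icc
      (z := fun t => ηx t - ζ t) (z' := fun t => ∑ i, (z.1 i * β i t) •
        fderiv ℝ (v i) (c z t) (ηx t - ζ t)) (C := M)
      (fun t ht => ((hηd t ht).sub (hζ t ht)).congr_deriv (by
        rw [← Finset.sum_sub_distrib]
        refine Finset.sum_congr rfl fun i _ => ?_
        rw [add_sub_add_right_eq_sub, map_sub, smul_sub]))
      (fun t ht => by
        have h1 := (le_abs_self _).trans (hM t ht)
        refine le_trans ?_ (mul_le_mul_of_nonneg_right h1 (norm_nonneg _))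
        rw [Finset.sum_mul]
        refine norm_sum_le_of_le _ fun i _ => ?_
        rw [norm_smul, Real.norm_eq_abs, mul_assoc]
        gcongr
        exact ContinuousLinearMap.le_opNorm _ _)
      (t₀ := 0) (by simp) (by simp [ηx, weightedPrimitive_zero, hζ₀]) 1 (by simp)
    have h2 : fderiv ℝ (fun z => c z 1) z = ev ∘L fderiv ℝ γ z :=
      ((ev.hasFDerivAt.comp z (hzs.differentiableAt (by simp)).hasFDerivAt).congr_of_eventuallyEq
        hz1).fderiv
    rw [h2, ← sub_eq_zero.1 key, hηx 1 (by simp)]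
    rfl

end ModelFlow

section LocalFlow

variable {n : ℕ} {N : Type*} [TopologicalSpace N] [ChartedSpace (EuclideanSpace ℝ (Fin n)) N]
  {ι : Type} [Fintype ι]

/-- The equation `x' = ∑ i, a i * β i(t) • X i(x)` solved on `[0, 1]` in a chart around `c₀`, for
small `a` and initial conditions near `c₀`. -/
structure LocalFlow (X : ι → VField n N) (β : ι → C(ℝ, ℝ)) (c₀ : N) where
  φ : OpenPartialHomeomorph N (EuclideanSpace ℝ (Fin n))
  φ_mem : φ ∈ IsManifold.maximalAtlas (𝓡 n) ∞ N
  mem_source : c₀ ∈ φ.source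
  B : Set ((ι → ℝ) × EuclideanSpace ℝ (Fin n))
  isOpen_B : IsOpen B
  zero_mem : (0, φ c₀) ∈ B
  curve : (ι → ℝ) × EuclideanSpace ℝ (Fin n) → ℝ → EuclideanSpace ℝ (Fin n)
  mem_target : ∀ z ∈ B, ∀ t ∈ Icc (0 : ℝ) 1, curve z t ∈ φ.target
  curve_zero : ∀ z ∈ B, curve z 0 = z.2
  hasDerivAt_curve : ∀ z ∈ B, ∀ t ∈ Icc (0 : ℝ) 1,
    HasDerivAt (curve z) (∑ i, (z.1 i * β i t) • chartRep φ (X i) (curve z t)) t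
  contDiffAt : ∀ z ∈ B, ContDiffAt ℝ ∞ (fun z => curve z 1) z
  invertible : ∀ z ∈ B, (fderiv ℝ (fun z => curve z 1) z ∘L
    .inr ℝ (ι → ℝ) (EuclideanSpace ℝ (Fin n))).IsInvertible
  small : ∀ V ∈ 𝓝 (φ c₀), ∀ᶠ z in 𝓝 ((0, φ c₀) : (ι → ℝ) × EuclideanSpace ℝ (Fin n)),
    ∀ t ∈ Icc (0 : ℝ) 1, curve z t ∈ V
  variation : ∀ z ∈ B, ∀ (w : ι → ℝ) (ζ : ℝ → EuclideanSpace ℝ (Fin n)), ζ 0 = 0 →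
    (∀ t ∈ Icc (0 : ℝ) 1, HasDerivAt ζ (∑ i, ((z.1 i * β i t) •
      fderiv ℝ (chartRep φ (X i)) (curve z t) (ζ t) +
      (w i * β i t) • chartRep φ (X i) (curve z t))) t) →
    fderiv ℝ (fun z => curve z 1) z (w, 0) = ζ 1

lemma LocalFlow.nonempty [IsManifold (𝓡 n) ∞ N] {X : ι → VField n N}
    (hX : ∀ i, IsSmoothField (X i)) (β : ι → C(ℝ, ℝ)) (c₀ : N) : Nonempty (LocalFlow X β c₀) := by
  set φ := chartAt (EuclideanSpace ℝ (Fin n)) c₀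
  have hφ : φ ∈ IsManifold.maximalAtlas (𝓡 n) ∞ N := IsManifold.chart_mem_maximalAtlas _
  have hs : c₀ ∈ φ.source := mem_chart_source _ _
  set w₀ := φ c₀
  -- the fields are cut off, in order to have globally defined fields in the model space
  obtain ⟨ε, hε, hεt⟩ := Metric.nhds_basis_closedBall.mem_iff.1
    (φ.open_target.mem_nhds (φ.map_source hs))
  let χ : ContDiffBump w₀ := ⟨ε / 2, ε, by positivity, by linarith⟩
  have hvs : ∀ i, ContDiff ℝ ∞ (fun w => χ w • chartRep φ (X i) w) := fun i => by
    refine contDiff_iff_contDiffAt.2 fun w => ?_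
    by_cases hw : w ∈ φ.target
    · exact χ.contDiff.contDiffAt.smul
        ((contDiffOn_chartRep hφ (hX i)).contDiffAt (φ.open_target.mem_nhds hw))
    · refine (contDiffAt_const (c := (0 : EuclideanSpace ℝ (Fin n)))).congr_of_eventuallyEq ?_
      have : w ∈ (Metric.closedBall w₀ ε)ᶜ := fun h => hw (hεt h)
      filter_upwards [Metric.isClosed_closedBall.isOpen_compl.mem_nhds this] with w' hw'
      have h1 : ε < dist w' w₀ := by simpa using hw'
      rw [χ.zero_of_le_dist h1.le, zero_smul]
  let v : ι → C(EuclideanSpace ℝ (Fin n), EuclideanSpace ℝ (Fin n)) := fun i =>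
    ⟨fun w => χ w • chartRep φ (X i) w, (hvs i).continuous⟩
  set V₀ := Metric.ball w₀ (ε / 2)
  have hv : ∀ i, ∀ w ∈ V₀, v i w = chartRep φ (X i) w := fun i w hw => by
    change χ w • chartRep φ (X i) w = chartRep φ (X i) w
    rw [χ.one_of_mem_closedBall (Metric.ball_subset_closedBall hw), one_smul]
  have hdv : ∀ i, ∀ w ∈ V₀, fderiv ℝ (v i) w = fderiv ℝ (chartRep φ (X i)) w := fun i w hw => by
    refine Filter.EventuallyEq.fderiv_eq ?_
    filter_upwards [Metric.isOpen_ball.mem_nhds hw] with w' hw'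
    exact hv i w' hw'
  have hV₀t : V₀ ⊆ φ.target := (Metric.ball_subset_closedBall.trans
    (Metric.closedBall_subset_closedBall (by linarith))).trans hεt
  have hV₀ : V₀ ∈ 𝓝 w₀ := Metric.ball_mem_nhds _ (by positivity)
  obtain ⟨c, hcs, hcV, hc⟩ := exists_model_flow v hvs β w₀
  have hid : fderiv ℝ (fun z => c z 1) (0, w₀) ∘L .inr ℝ (ι → ℝ) (EuclideanSpace ℝ (Fin n)) =
      ContinuousLinearMap.id ℝ _ := by
    ext1 ξ
    exact hc.self_of_nhds.2.2 0 ξ (fun _ => ξ) rfl fun t _ => by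
      simpa using hasDerivAt_const t ξ
  have hinv : ∀ᶠ z in 𝓝 ((0, w₀) : (ι → ℝ) × EuclideanSpace ℝ (Fin n)),
      (fderiv ℝ (fun z => c z 1) z ∘L .inr ℝ (ι → ℝ) (EuclideanSpace ℝ (Fin n))).IsInvertible := by
    have h1 : ContDiffAt ℝ 0 (fderiv ℝ (fun z => c z 1)) (0, w₀) :=
      hcs.self_of_nhds.fderiv_right (by simp)
    have h2 : ContinuousAt (fun z => fderiv ℝ (fun z => c z 1) z ∘L
        .inr ℝ (ι → ℝ) (EuclideanSpace ℝ (Fin n))) (0, w₀) :=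
      (ContinuousLinearMap.compL ℝ (EuclideanSpace ℝ (Fin n))
        ((ι → ℝ) × EuclideanSpace ℝ (Fin n)) (EuclideanSpace ℝ (Fin n)) |>.flip
        (.inr ℝ (ι → ℝ) (EuclideanSpace ℝ (Fin n)))).continuous.continuousAt.comp h1.continuousAt
    have h3 := (ContinuousLinearEquiv.refl ℝ (EuclideanSpace ℝ (Fin n))).nhds
    have h4 := h2.preimage_mem_nhds (t := range ((↑) :
      (EuclideanSpace ℝ (Fin n) ≃L[ℝ] EuclideanSpace ℝ (Fin n)) → _)) (by rw [hid]; exact h3)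
    filter_upwards [h4] with z hz
    exact hz
  obtain ⟨B, hB, hBo, hB₀⟩ := mem_nhds_iff.1 (((hcs.and (hcV V₀ hV₀)).and hc).and hinv)
  exact ⟨{
    φ := φ
    φ_mem := hφ
    mem_source := hs
    B := B
    isOpen_B := hBo
    zero_mem := hB₀
    curve := c
    mem_target := fun z hz t ht => hV₀t ((hB hz).1.1.2 t ht)
    curve_zero := fun z hz => (hB hz).1.2.1
    hasDerivAt_curve := fun z hz t ht => ((hB hz).1.2.2.1 t ht).congr_deriv
      (Finset.sum_congr rfl fun i _ => by rw [hv i _ ((hB hz).1.1.2 t ht)])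
    contDiffAt := fun z hz => (hB hz).1.1.1
    invertible := fun z hz => (hB hz).2
    small := hcV
    variation := fun z hz w ζ hζ₀ hζ => (hB hz).1.2.2.2 w 0 ζ hζ₀ fun t ht =>
      (hζ t ht).congr_deriv (Finset.sum_congr rfl fun i _ => by
        rw [hv i _ ((hB hz).1.1.2 t ht), hdv i _ ((hB hz).1.1.2 t ht)]) }⟩

end LocalFlow

/-! ### Time-one maps on the manifold -/

section Flow

variable {n : ℕ} {N : Type*} [TopologicalSpace N] [ChartedSpace (EuclideanSpace ℝ (Fin n)) N]
  {ι : Type} [Fintype ι]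

/-- The control functions `t ↦ a i * β i(t)`. -/
def control {ι : Type*} (β : ι → C(ℝ, ℝ)) (a : ι → ℝ) : ι → ℝ → ℝ := fun i t => a i * β i t

lemma continuousOn_control {ι : Type*} (β : ι → C(ℝ, ℝ)) (a : ι → ℝ) (i : ι) (J : Set ℝ) :
    ContinuousOn (control β a i) J :=
  Continuous.continuousOn (by unfold control; fun_prop)

namespace LocalFlow

variable {X : ι → VField n N} {β : ι → C(ℝ, ℝ)} {c₀ : N} (L : LocalFlow X β c₀)

/-- The domain of a local flow, as a set of pairs of a parameter and a point of the manifold. -/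
def box : Set ((ι → ℝ) × N) := {z | z.2 ∈ L.φ.source ∧ (z.1, L.φ z.2) ∈ L.B}

/-- The integral curves of a local flow. -/
def lift (z : (ι → ℝ) × N) (t : ℝ) : N := L.φ.symm (L.curve (z.1, L.φ z.2) t)

lemma continuousAt_chart {z : (ι → ℝ) × N} (hz : z.2 ∈ L.φ.source) :
    ContinuousAt (fun z : (ι → ℝ) × N => (z.1, L.φ z.2)) z :=
  continuousAt_fst.prodMk ((L.φ.continuousAt hz).comp continuousAt_snd)

lemma isOpen_box : IsOpen L.box := by
  refine isOpen_iff_mem_nhds.2 fun z hz => ?_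
  filter_upwards [continuousAt_snd.preimage_mem_nhds (L.φ.open_source.mem_nhds hz.1),
    (L.continuousAt_chart hz.1).preimage_mem_nhds (L.isOpen_B.mem_nhds hz.2)] with z' h1 h2
  exact ⟨h1, h2⟩

lemma zero_mem_box : (0, c₀) ∈ L.box := ⟨L.mem_source, L.zero_mem⟩

lemma lift_zero {z : (ι → ℝ) × N} (hz : z ∈ L.box) : L.lift z 0 = z.2 := by
  rw [lift, L.curve_zero _ hz.2, L.φ.left_inv hz.1]

lemma lift_mem {z : (ι → ℝ) × N} (hz : z ∈ L.box) {t : ℝ} (ht : t ∈ Icc (0 : ℝ) 1) :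
    L.lift z t ∈ L.φ.source := L.φ.map_target (L.mem_target _ hz.2 t ht)

lemma chart_lift {z : (ι → ℝ) × N} (hz : z ∈ L.box) {t : ℝ} (ht : t ∈ Icc (0 : ℝ) 1) :
    L.φ (L.lift z t) = L.curve (z.1, L.φ z.2) t := L.φ.right_inv (L.mem_target _ hz.2 t ht)

lemma isSolutionOn_lift {z : (ι → ℝ) × N} (hz : z ∈ L.box) :
    IsSolutionOn (controlled X (control β z.1)) (L.lift z) (Icc 0 1) := by
  intro t ht
  refine hasMFDerivAt_symm_comp L.φ_mem (Z := controlled X (control β z.1) t)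
    (L.mem_target _ hz.2 t ht) ?_
  refine (L.hasDerivAt_curve _ hz.2 t ht).congr_deriv ?_
  rw [← chartRep_sum_smul]
  rfl

lemma contMDiffAt_lift {z : (ι → ℝ) × N} (hz : z ∈ L.box) :
    ContMDiffAt (𝓘(ℝ, ι → ℝ).prod (𝓡 n)) (𝓡 n) ∞ (fun z => L.lift z 1) z := by
  have h1 : ContMDiffAt (𝓘(ℝ, ι → ℝ).prod (𝓡 n)) 𝓘(ℝ, (ι → ℝ) × EuclideanSpace ℝ (Fin n)) ∞
      (fun z : (ι → ℝ) × N => (z.1, L.φ z.2)) z :=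
    contMDiffAt_fst.prodMk_space
      ((contMDiffAt_of_mem_maximalAtlas L.φ_mem hz.1).comp z contMDiffAt_snd)
  have h2 := (L.contDiffAt _ hz.2).contMDiffAt.comp z h1
  have h3 := contMDiffAt_symm_of_mem_maximalAtlas L.φ_mem (L.mem_target _ hz.2 1 (by simp))
  exact h3.comp z h2

lemma map_nhds_lift {z : (ι → ℝ) × N} (hz : z ∈ L.box) :
    map (fun z : (ι → ℝ) × N => (z.1, L.lift z 1)) (𝓝 z) = 𝓝 (z.1, L.lift z 1) := by
  set g : (ι → ℝ) × EuclideanSpace ℝ (Fin n) → (ι → ℝ) × EuclideanSpace ℝ (Fin n) :=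
    fun z => (z.1, L.curve z 1) with hg
  set p : (ι → ℝ) × EuclideanSpace ℝ (Fin n) := (z.1, L.φ z.2) with hp
  have hstrict : HasStrictFDerivAt g ((ContinuousLinearMap.fst ℝ (ι → ℝ) _).prod
      (fderiv ℝ (fun z => L.curve z 1) p)) p :=
    hasStrictFDerivAt_fst.prodMk ((L.contDiffAt _ hz.2).hasStrictFDerivAt (by simp))
  have hmap : map g (𝓝 p) = 𝓝 (g p) := by
    refine hstrict.map_nhds_eq_of_surj ?_
    refine LinearMap.range_eq_top.2 fun q => ?_
    obtain ⟨ξ, hξ⟩ := (L.invertible _ hz.2).surjective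
      (q.2 - fderiv ℝ (fun z => L.curve z 1) p (q.1, 0))
    refine ⟨(q.1, ξ), ?_⟩
    have h1 : ((q.1, ξ) : (ι → ℝ) × EuclideanSpace ℝ (Fin n)) = (q.1, 0) + (0, ξ) := by simp
    have h2 : fderiv ℝ (fun z => L.curve z 1) p (q.1, ξ) = q.2 := by
      rw [h1, map_add]
      change _ + (fderiv ℝ (fun z => L.curve z 1) p ∘L
        .inr ℝ (ι → ℝ) (EuclideanSpace ℝ (Fin n))) ξ = _
      rw [hξ]; abel
    exact Prod.ext rfl h2
  have h1 : map (Prod.map id L.φ) (𝓝 z) = 𝓝 p := by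
    change map (fun z : (ι → ℝ) × N => (id z.1, L.φ z.2)) (𝓝 (z.1, z.2)) = 𝓝 p
    rw [nhds_prod_eq, ← Filter.prod_map_map_eq, map_id,
      L.φ.map_nhds_eq hz.1, ← nhds_prod_eq]
  have h2 : map (Prod.map id L.φ.symm) (𝓝 (g p)) = 𝓝 (z.1, L.lift z 1) := by
    change map (fun z : (ι → ℝ) × EuclideanSpace ℝ (Fin n) => (id z.1, L.φ.symm z.2))
      (𝓝 ((g p).1, (g p).2)) = _
    rw [nhds_prod_eq, ← Filter.prod_map_map_eq, map_id,
      L.φ.symm.map_nhds_eq (L.mem_target _ hz.2 1 (by simp)), ← nhds_prod_eq]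
    rfl
  rw [← h2, ← hmap, ← h1, map_map, map_map]
  rfl

/-- The equation of variations for the time-one map, expressed with brackets. -/
lemma mfderiv_lift [IsManifold (𝓡 n) ∞ N] (hX : ∀ i, IsSmoothField (X i))
    {a : ι → ℝ} {c : N} (hz : (a, c) ∈ L.box) (w : ι → ℝ) {κ : Type} [Fintype κ]
    {W : κ → VField n N} (hW : ∀ l, IsSmoothField (W l)) {m m' : κ → ℝ → ℝ} (hm₀ : ∀ l, m l 0 = 0)
    (hm : ∀ l, ∀ t ∈ Icc (0 : ℝ) 1, HasDerivAt (m l) (m' l t) t)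
    (hid : ∀ t ∈ Icc (0 : ℝ) 1, ∑ l, (m' l t • W l (L.lift (a, c) t) + m l t • ∑ i,
      control β a i t • VectorField.mlieBracket (𝓡 n) (X i) (W l) (L.lift (a, c) t)) =
      ∑ i, control β w i t • X i (L.lift (a, c) t)) :
    mfderiv 𝓘(ℝ, ι → ℝ) (𝓡 n) (fun a => L.lift (a, c) 1) a w =
      ∑ l, m l 1 • W l (L.lift (a, c) 1) := by
  have h1 : (1 : ℝ) ∈ Icc (0 : ℝ) 1 := by simp
  have hdiff : MDifferentiableAt 𝓘(ℝ, ι → ℝ) (𝓡 n) (fun a => L.lift (a, c) 1) a := by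
    have h2 : ContMDiffAt 𝓘(ℝ, ι → ℝ) (𝓘(ℝ, ι → ℝ).prod (𝓡 n)) ∞ (fun a => (a, c)) a :=
      contMDiffAt_id.prodMk contMDiffAt_const
    exact ((L.contMDiffAt_lift hz).comp a h2).mdifferentiableAt (by simp)
  refine chartDeriv_injective L.φ_mem (L.lift_mem hz h1) ?_
  -- the derivative of the time-one map in the chart
  have h3 : chartDeriv L.φ (L.lift (a, c) 1)
      (mfderiv 𝓘(ℝ, ι → ℝ) (𝓡 n) (fun a => L.lift (a, c) 1) a w) =
      fderiv ℝ (fun z => L.curve z 1) (a, L.φ c) (w, 0) := by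
    have h4 := ((mdifferentiable_of_mem_maximalAtlas L.φ_mem).mdifferentiableAt
      (L.lift_mem hz h1)).hasMFDerivAt.comp a hdiff.hasMFDerivAt
    have h5 : HasFDerivAt (fun a => L.curve (a, L.φ c) 1)
        ((fderiv ℝ (fun z => L.curve z 1) (a, L.φ c)).comp
          (.inl ℝ (ι → ℝ) (EuclideanSpace ℝ (Fin n)))) a :=
      HasFDerivAt.comp (g := fun z => L.curve z 1) (f := fun a => (a, L.φ c)) a
        ((L.contDiffAt _ hz.2).differentiableAt (by simp)).hasFDerivAt
        (hasFDerivAt_prodMk_left a (L.φ c))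
    have h6 : (L.φ ∘ fun a => L.lift (a, c) 1) =ᶠ[𝓝 a] fun a => L.curve (a, L.φ c) 1 := by
      have hc : ContinuousAt (fun a : ι → ℝ => (a, c)) a := by fun_prop
      filter_upwards [hc.preimage_mem_nhds (L.isOpen_box.mem_nhds hz)] with a' ha'
      exact L.chart_lift ha' h1
    exact DFunLike.congr_fun (hasMFDerivAt_unique h4 (h5.hasMFDerivAt.congr_of_eventuallyEq h6)) w
  rw [h3]
  let ζ : ℝ → EuclideanSpace ℝ (Fin n) := fun t =>
    ∑ l, m l t • chartRep L.φ (W l) (L.φ (L.lift (a, c) t))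
  have hζ₀ : ζ 0 = 0 := by simp [ζ, hm₀]
  rw [L.variation _ hz.2 w ζ hζ₀ fun t ht => ?_]
  · simp only [ζ]
    rw [map_sum]
    refine Finset.sum_congr rfl fun l _ => ?_
    rw [map_smul, chartRep_apply (L.lift_mem hz h1)]
  · have hs := L.lift_mem hz ht
    have hsol := L.isSolutionOn_lift hz
    refine (HasDerivAt.fun_sum fun l (_ : l ∈ Finset.univ) => (hm l t ht).smul
      (hsol.hasDerivAt_chartRep hX (hW l) L.φ_mem ht hs)).congr_deriv ?_
    have h7 := congrArg (chartDeriv L.φ (L.lift (a, c) t)) (hid t ht)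
    simp only [map_add, map_smul, map_sum, Finset.sum_add_distrib, Finset.smul_sum] at h7
    rw [← L.chart_lift hz ht]
    simp only [chartRep_apply hs, smul_add, Finset.sum_add_distrib, Finset.smul_sum]
    change _ = _ + ∑ i, control β w i t • chartDeriv L.φ (L.lift (a, c) t) (X i (L.lift (a, c) t))
    rw [← h7]
    simp only [ζ, map_sum, map_smul, Finset.smul_sum, chartRep_apply hs]
    rw [Finset.sum_comm (f := fun i l => (a i * β i t) • m l t • fderiv ℝ (chartRep L.φ (X i))
      (L.φ (L.lift (a, c) t)) (chartDeriv L.φ (L.lift (a, c) t) (W l (L.lift (a, c) t))))]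
    simp only [smul_comm (m _ t) (control β a _ t)]
    simp only [control]
    abel

end LocalFlow

end Flow

section GlobalFlow

variable {n : ℕ} {N : Type*} [TopologicalSpace N] [ChartedSpace (EuclideanSpace ℝ (Fin n)) N]
  [IsManifold (𝓡 n) ∞ N] {ι : Type} [Fintype ι]

/-- The time-one maps `e(a, ·)` of the equations `x' = ∑ i, a i * β i(t) • X i(x)`, on an open
neighbourhood `D` of `{0} × N`. -/
structure Flow (X : ι → VField n N) (β : ι → C(ℝ, ℝ)) where
  D : Set ((ι → ℝ) × N)
  e : (ι → ℝ) × N → N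
  isOpen_D : IsOpen D
  zero_mem : ∀ c, (0, c) ∈ D
  contMDiffAt : ∀ z ∈ D, ContMDiffAt (𝓘(ℝ, ι → ℝ).prod (𝓡 n)) (𝓡 n) ∞ e z
  map_nhds : ∀ z ∈ D, map (fun z : (ι → ℝ) × N => (z.1, e z)) (𝓝 z) = 𝓝 (z.1, e z)
  exists_curve : ∀ z ∈ D, ∃ Γ : ℝ → N,
    IsSolutionOn (controlled X (control β z.1)) Γ (Icc 0 1) ∧ Γ 0 = z.2 ∧ Γ 1 = e z
  small : ∀ c, ∀ U ∈ 𝓝 c, ∀ᶠ z in 𝓝 ((0, c) : (ι → ℝ) × N), ∃ Γ : ℝ → N,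
    IsSolutionOn (controlled X (control β z.1)) Γ (Icc 0 1) ∧ Γ 0 = z.2 ∧ Γ 1 = e z ∧
      ∀ t ∈ Icc (0 : ℝ) 1, Γ t ∈ U
  /-- The equation of variations, expressed with brackets. -/
  variation : ∀ (a : ι → ℝ) (c : N), (a, c) ∈ D → ∀ (w : ι → ℝ) {κ : Type} [Fintype κ]
    {W : κ → VField n N} {m m' : κ → ℝ → ℝ} {Γ : ℝ → N},
    (∀ l, IsSmoothField (W l)) → (∀ l, m l 0 = 0) →
    (∀ l, ∀ t ∈ Icc (0 : ℝ) 1, HasDerivAt (m l) (m' l t) t) →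
    IsSolutionOn (controlled X (control β a)) Γ (Icc 0 1) → Γ 0 = c →
    (∀ t ∈ Icc (0 : ℝ) 1, ∑ l, (m' l t • W l (Γ t) + m l t • ∑ i,
      control β a i t • VectorField.mlieBracket (𝓡 n) (X i) (W l) (Γ t)) =
      ∑ i, control β w i t • X i (Γ t)) →
    mfderiv 𝓘(ℝ, ι → ℝ) (𝓡 n) (fun a => e (a, c)) a w = ∑ l, m l 1 • W l (e (a, c))

lemma isSolutionOn_control_unique [T2Space N] {X : ι → VField n N} (hX : ∀ i, IsSmoothField (X i))
    {β : ι → C(ℝ, ℝ)} {a : ι → ℝ} {Γ₁ Γ₂ : ℝ → N}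
    (h₁ : IsSolutionOn (controlled X (control β a)) Γ₁ (Icc 0 1))
    (h₂ : IsSolutionOn (controlled X (control β a)) Γ₂ (Icc 0 1)) {t₀ : ℝ}
    (ht₀ : t₀ ∈ Icc (0 : ℝ) 1) (h : Γ₁ t₀ = Γ₂ t₀) : ∀ t ∈ Icc (0 : ℝ) 1, Γ₁ t = Γ₂ t :=
  h₁.eq_of_eq_at hX isPreconnected_Icc (fun i => continuousOn_control β a i _) h₂ ht₀ h

lemma Flow.nonempty [T2Space N] {X : ι → VField n N} (hX : ∀ i, IsSmoothField (X i))
    (β : ι → C(ℝ, ℝ)) :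
    Nonempty (Flow X β) := by
  classical
  let L : ∀ c, LocalFlow X β c := fun c => (LocalFlow.nonempty hX β c).some
  let e : (ι → ℝ) × N → N := fun z =>
    if h : ∃ c, z ∈ (L c).box then (L h.choose).lift z 1 else z.2
  have h0 : (0 : ℝ) ∈ Icc (0 : ℝ) 1 := by simp
  have h1 : (1 : ℝ) ∈ Icc (0 : ℝ) 1 := by simp
  -- local flows agree on the intersection of their domains, by uniqueness
  have he : ∀ c, ∀ z ∈ (L c).box, e z = (L c).lift z 1 := fun c z hz => by
    have h : ∃ c, z ∈ (L c).box := ⟨c, hz⟩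
    simp only [e, dif_pos h]
    refine isSolutionOn_control_unique hX ((L _).isSolutionOn_lift h.choose_spec)
      ((L c).isSolutionOn_lift hz) h0 ?_ 1 h1
    rw [(L _).lift_zero h.choose_spec, (L c).lift_zero hz]
  have hev : ∀ c, ∀ z ∈ (L c).box, e =ᶠ[𝓝 z] fun z => (L c).lift z 1 := fun c z hz => by
    filter_upwards [(L c).isOpen_box.mem_nhds hz] with z' hz'
    exact he c z' hz'
  refine ⟨{
    D := ⋃ c, (L c).box
    e := e
    isOpen_D := isOpen_iUnion fun c => (L c).isOpen_box
    zero_mem := fun c => mem_iUnion.2 ⟨c, (L c).zero_mem_box⟩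
    contMDiffAt := fun z hz => by
      obtain ⟨c, hc⟩ := mem_iUnion.1 hz
      exact ((L c).contMDiffAt_lift hc).congr_of_eventuallyEq (hev c z hc)
    map_nhds := fun z hz => by
      obtain ⟨c, hc⟩ := mem_iUnion.1 hz
      rw [he c z hc, ← (L c).map_nhds_lift hc]
      refine Filter.map_congr ?_
      filter_upwards [hev c z hc] with z' hz'
      rw [hz']
    exists_curve := fun z hz => by
      obtain ⟨c, hc⟩ := mem_iUnion.1 hz
      exact ⟨(L c).lift z, (L c).isSolutionOn_lift hc, (L c).lift_zero hc, (he c z hc).symm⟩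
    small := fun c U hU => ?_
    variation := ?_ }⟩
  · have hs := (L c).mem_source
    have hV : (L c).φ.symm ⁻¹' U ∈ 𝓝 ((L c).φ c) :=
      ((L c).φ.symm.continuousAt ((L c).φ.map_source hs)).preimage_mem_nhds
        (by rwa [(L c).φ.left_inv hs])
    have hca := (L c).continuousAt_chart (z := (0, c)) hs
    filter_upwards [hca.eventually ((L c).small _ hV),
      (L c).isOpen_box.mem_nhds (L c).zero_mem_box] with z hz hzb
    exact ⟨(L c).lift z, (L c).isSolutionOn_lift hzb, (L c).lift_zero hzb, (he c z hzb).symm, hz⟩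
  · intro a c hz w κ _ W m m' Γ hW hm₀ hm hΓ hΓ₀ hid
    obtain ⟨c', hc⟩ := mem_iUnion.1 hz
    have hΓe : ∀ t ∈ Icc (0 : ℝ) 1, Γ t = (L c').lift (a, c) t :=
      isSolutionOn_control_unique hX hΓ ((L c').isSolutionOn_lift hc) h0
        (by rw [hΓ₀, (L c').lift_zero hc])
    have hca : ContinuousAt (fun a : ι → ℝ => (a, c)) a := by fun_prop
    have hev' : (fun a => e (a, c)) =ᶠ[𝓝 a] fun a => (L c').lift (a, c) 1 :=
      hca.eventually (p := fun z => e z = (L c').lift z 1) (hev c' _ hc)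
    rw [hev'.mfderiv_eq, he c' _ hc]
    exact (L c').mfderiv_lift hX hc w hW hm₀ hm fun t ht => by
      rw [← hΓe t ht]; exact hid t ht

namespace Flow

variable {X : ι → VField n N} {β : ι → C(ℝ, ℝ)} (Φ : Flow X β)

lemma continuousAt_e {z : (ι → ℝ) × N} (hz : z ∈ Φ.D) : ContinuousAt Φ.e z :=
  (Φ.contMDiffAt z hz).continuousAt

lemma e_zero [T2Space N] (hX : ∀ i, IsSmoothField (X i)) (c : N) : Φ.e (0, c) = c := by
  obtain ⟨Γ, hΓ, hΓ₀, hΓ₁⟩ := Φ.exists_curve _ (Φ.zero_mem c)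
  rw [← hΓ₁]
  refine isSolutionOn_control_unique hX hΓ (Γ₂ := fun _ => c) (fun t _ => ?_) (t₀ := 0)
    (by simp) hΓ₀ 1 (by simp)
  have h0 : controlled X (control β (0 : ι → ℝ)) t c = 0 := by simp [controlled, control]
  have h1 := hasMFDerivAt_const (I := 𝓘(ℝ, ℝ)) (I' := 𝓡 n) (M := ℝ) c t
  refine h1.congr_mfderiv ?_
  rw [h0]
  ext
  simp
  rfl

lemma injective [T2Space N] (hX : ∀ i, IsSmoothField (X i)) {a : ι → ℝ} {c c' : N} (hc : (a, c) ∈ Φ.D)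
    (hc' : (a, c') ∈ Φ.D) (h : Φ.e (a, c) = Φ.e (a, c')) : c = c' := by
  obtain ⟨Γ, hΓ, hΓ₀, hΓ₁⟩ := Φ.exists_curve _ hc
  obtain ⟨Γ', hΓ', hΓ₀', hΓ₁'⟩ := Φ.exists_curve _ hc'
  have := isSolutionOn_control_unique hX hΓ hΓ' (t₀ := 1) (by simp) (by rw [hΓ₁, hΓ₁', h]) 0
    (by simp)
  rw [hΓ₀, hΓ₀'] at this
  exact this

end Flow

end GlobalFlow

/-! ### Derivative of the time-one map with respect to the parameters -/

section Variation

variable {n : ℕ} {N : Type*} [TopologicalSpace N] [ChartedSpace (EuclideanSpace ℝ (Fin n)) N]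
  [IsManifold (𝓡 n) ∞ N] {ι : Type} [Fintype ι]

namespace Flow

variable {X : ι → VField n N} {β : ι → C(ℝ, ℝ)} (Φ : Flow X β)

/-- The derivative of `a ↦ e(a, c)` in the direction `w`. -/
def paramDeriv (a : ι → ℝ) (c : N) : (ι → ℝ) →L[ℝ] TangentSpace (𝓡 n) (Φ.e (a, c)) :=
  mfderiv 𝓘(ℝ, ι → ℝ) (𝓡 n) (fun a => Φ.e (a, c)) a

lemma hasDerivAt_integral (f : C(ℝ, ℝ)) (t : ℝ) :
    HasDerivAt (fun t => ∫ u in (0 : ℝ)..t, f u) (f t) t :=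
  intervalIntegral.integral_hasDerivAt_right (f.continuous.intervalIntegrable _ _)
    (f.continuous.stronglyMeasurableAtFilter _ _) f.continuous.continuousAt

/-- At `a = 0` the parameters move the point along the fields themselves. -/
lemma paramDeriv_zero (hX : ∀ i, IsSmoothField (X i)) (hβ : ∀ i, ∫ u in (0 : ℝ)..1, β i u = 1)
    (c : N) (w : ι → ℝ) : Φ.paramDeriv 0 c w = ∑ i, w i • X i (Φ.e (0, c)) := by
  obtain ⟨Γ, hΓ, hΓ₀, -⟩ := Φ.exists_curve _ (Φ.zero_mem c)
  have h := Φ.variation 0 c (Φ.zero_mem c) w (W := X)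
    (m := fun l t => w l * ∫ u in (0 : ℝ)..t, β l u)
    (m' := fun l t => w l * β l t) hX (fun l => by simp)
    (fun l t _ => (hasDerivAt_integral (β l) t).const_mul _) hΓ hΓ₀
    (fun t _ => by simp [control])
  exact h.trans (Finset.sum_congr rfl fun i _ => by rw [hβ i, mul_one])

/-- If `β i₀` is concentrated after all the other controls, then the parameter `a i₀` moves the
endpoint along the field `X i₀`. -/
lemma paramDeriv_single [DecidableEq ι] (hX : ∀ i, IsSmoothField (X i)) {i₀ : ι}
    (hβ : ∫ u in (0 : ℝ)..1, β i₀ u = 1)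
    (hβ' : ∀ i ≠ i₀, ∀ t ∈ Icc (0 : ℝ) 1, β i t = 0 ∨ ∫ u in (0 : ℝ)..t, β i₀ u = 0)
    {a : ι → ℝ} {c : N} (hz : (a, c) ∈ Φ.D) :
    Φ.paramDeriv a c (Pi.single i₀ 1) = X i₀ (Φ.e (a, c)) := by
  obtain ⟨Γ, hΓ, hΓ₀, -⟩ := Φ.exists_curve _ hz
  have h := Φ.variation a c hz (Pi.single i₀ 1) (κ := Unit) (W := fun _ => X i₀)
    (m := fun _ t => ∫ u in (0 : ℝ)..t, β i₀ u)
    (m' := fun _ t => β i₀ t) (fun _ => hX i₀) (fun l => by simp)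
    (fun l t _ => hasDerivAt_integral (β i₀) t) hΓ hΓ₀
    (fun t ht => ?_)
  · refine h.trans ?_
    simp [hβ]
  · have h2 : ∀ i, (∫ u in (0 : ℝ)..t, β i₀ u) • control β a i t •
        VectorField.mlieBracket (𝓡 n) (X i) (X i₀) (Γ t) = 0 := fun i => by
      by_cases hi : i = i₀
      · subst hi
        rw [VectorField.mlieBracket_self]
        simp
      · rcases hβ' i hi t ht with h | h <;> simp [control, h]
    have h3 : ∀ i, control β (Pi.single i₀ 1) i t • X i (Γ t) =
        if i = i₀ then β i₀ t • X i₀ (Γ t) else 0 := fun i => by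
      by_cases hi : i = i₀
      · subst hi; simp [control]
      · simp [control, hi]
    simp only [Finset.univ_unique, Finset.sum_const, Finset.card_singleton, one_smul]
    rw [Finset.smul_sum, Finset.sum_eq_zero fun i _ => h2 i, add_zero,
      Finset.sum_congr rfl fun i _ => h3 i]
    simp

/-- On a set where the brackets `[X i, X j]` are combinations of the fields `X k` with constant
coefficients, the derivative with respect to the parameters is a combination of the fields, with
coefficients that depend on the parameters only. -/
lemma exists_paramDeriv_eq {S : Set N} {cst : ι → ι → ι → ℝ} (hX : ∀ i, IsSmoothField (X i))
    (hcst : ∀ x ∈ S, ∀ i j,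
      VectorField.mlieBracket (𝓡 n) (X i) (X j) x = ∑ k, cst i j k • X k x)
    (hS : ∀ (a : ι → ℝ) (Γ : ℝ → N), IsSolutionOn (controlled X (control β a)) Γ (Icc 0 1) →
      Γ 0 ∈ S → ∀ t ∈ Icc (0 : ℝ) 1, Γ t ∈ S) (a : ι → ℝ) :
    ∃ M : (ι → ℝ) →ₗ[ℝ] (ι → ℝ), ∀ c ∈ S, (a, c) ∈ Φ.D → ∀ w,
      Φ.paramDeriv a c w = ∑ l, M w l • X l (Φ.e (a, c)) := by
  classical
  -- the coefficients solve a linear equation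
  let T : ι → ι → (ι → ℝ) →L[ℝ] (ι → ℝ) := fun j l =>
    (ContinuousLinearMap.proj j : (ι → ℝ) →L[ℝ] ℝ).smulRight (Pi.single l 1)
  let A : C(unitInterval, (ι → ℝ) →L[ℝ] (ι → ℝ)) :=
    ⟨fun t => ∑ j, ∑ l, (-∑ i, a i * β i t * cst i j l) • T j l, by fun_prop⟩
  have hA : ∀ t v l, A t v l = -∑ j, v j * ∑ i, a i * β i t * cst i j l := fun t v l => by
    simp [A, T, Finset.sum_apply, Pi.single_apply, mul_comm]
  let f : (ι → ℝ) → C(unitInterval, ι → ℝ) := fun w => ⟨fun t l => w l * β l t, by fun_prop⟩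
  have hsol : ∀ w : ι → ℝ, ∃ m : ℝ → ι → ℝ, m 0 = 0 ∧ ∀ t ∈ Icc (0 : ℝ) 1,
      HasDerivAt m (fun l => w l * β l t - ∑ j, m t j * ∑ i, a i * β i t * cst i j l) t :=
    fun w => by
    obtain ⟨m, hm⟩ := exists_volterra_eq A (volterra _ (f w))
    rw [← map_add] at hm
    refine ⟨primitive (pointwiseApply unitInterval _ _ A m + f w), by simp [primitive], fun t ht => ?_⟩
    refine (hasDerivAt_primitive (pointwiseApply unitInterval _ _ A m + f w) t).congr_deriv ?_
    rw [projIcc_of_mem zero_le_one ht]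
    have h1 : primitive (pointwiseApply unitInterval _ _ A m + f w) t = m ⟨t, ht⟩ := by
      rw [hm, volterra_apply, ← hm]
    rw [h1]
    ext l
    have h2 : (pointwiseApply unitInterval _ _ A m + f w) ⟨t, ht⟩ l =
      A ⟨t, ht⟩ (m ⟨t, ht⟩) l + w l * β l t := rfl
    rw [h2, hA]
    ring
  choose m hm₀ hm using hsol
  refine ⟨∑ j, (LinearMap.proj j : (ι → ℝ) →ₗ[ℝ] ℝ).smulRight (m (Pi.single j 1) 1),
    fun c hc hz w => ?_⟩
  obtain ⟨Γ, hΓ, hΓ₀, -⟩ := Φ.exists_curve _ hz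
  have hvar : ∀ w, Φ.paramDeriv a c w = ∑ l, m w 1 l • X l (Φ.e (a, c)) := fun w => by
    refine Φ.variation a c hz w (W := X) (m := fun l t => m w t l) hX
      (fun l => by simp [hm₀]) (fun l t ht => hasDerivAt_pi.1 (hm w t ht) l) hΓ hΓ₀ fun t ht => ?_
    have hΓS := hS a Γ hΓ (hΓ₀ ▸ hc) t ht
    simp only [hcst _ hΓS]
    rw [Finset.sum_add_distrib]
    simp only [sub_smul, Finset.sum_sub_distrib]
    have h3 : ∑ l, m w t l • ∑ i, control β a i t • ∑ k, cst i l k • X k (Γ t) =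
        ∑ k, (∑ j, m w t j * ∑ i, a i * β i t * cst i j k) • X k (Γ t) := by
      simp only [Finset.smul_sum, Finset.sum_smul, Finset.mul_sum, smul_smul, control]
      rw [Finset.sum_congr rfl fun l _ => Finset.sum_comm, Finset.sum_comm]
    rw [h3]
    simp [control]
  have hw : Φ.paramDeriv a c w = ∑ j, w j • Φ.paramDeriv a c (Pi.single j 1) := by
    conv_lhs => rw [pi_eq_sum_univ' w]
    rw [map_sum]
    exact Finset.sum_congr rfl fun j _ => map_smul _ _ _
  rw [hw]
  simp only [hvar, Finset.smul_sum]
  rw [Finset.sum_comm]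
  refine Finset.sum_congr rfl fun l _ => ?_
  simp [Finset.sum_apply, Finset.sum_smul, smul_smul]

end Flow

end Variation

section Controls

/-- Controls with integral `1`, one of which, if there is a prescribed one, acts after all the
others. -/
lemma exists_controls {ι : Type} (i₀ : Option ι) : ∃ β : ι → C(ℝ, ℝ),
    (∀ i, ∫ u in (0 : ℝ)..1, β i u = 1) ∧
    ∀ i j, i₀ = some j → i ≠ j → ∀ t ∈ Icc (0 : ℝ) 1,
      β i t = 0 ∨ ∫ u in (0 : ℝ)..t, β j u = 0 := by
  classical
  let late : C(ℝ, ℝ) := ⟨fun u => 8 * max 0 (u - 1 / 2), by fun_prop⟩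
  let early : C(ℝ, ℝ) := ⟨fun u => 8 * max 0 (1 / 2 - u), by fun_prop⟩
  have hl : ∀ t ∈ Icc (0 : ℝ) (1 / 2), ∫ u in (0 : ℝ)..t, late u = 0 := fun t ht => by
    rw [intervalIntegral.integral_congr (g := fun _ => (0 : ℝ))]
    · simp
    · intro u hu
      rw [uIcc_of_le ht.1] at hu
      have : u - 1 / 2 ≤ 0 := by linarith [hu.2, ht.2]
      simp only [late, ContinuousMap.coe_mk, max_eq_left this, mul_zero]
  have hl1 : ∫ u in (0 : ℝ)..1, late u = 1 := by
    rw [← intervalIntegral.integral_add_adjacent_intervals (b := 1 / 2)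
      (late.continuous.intervalIntegrable _ _) (late.continuous.intervalIntegrable _ _),
      hl _ (by norm_num), intervalIntegral.integral_congr (g := fun u : ℝ => 8 * (u - 1 / 2))]
    · rw [intervalIntegral.integral_const_mul, intervalIntegral.integral_sub
        (by simp) (by simp), integral_id]
      simp
      norm_num
    · intro u hu
      rw [uIcc_of_le (by norm_num)] at hu
      have : 0 ≤ u - 1 / 2 := by linarith [hu.1]
      simp only [late, ContinuousMap.coe_mk, max_eq_right this]
  have he1 : ∫ u in (0 : ℝ)..1, early u = 1 := by
    have := intervalIntegral.integral_comp_sub_left (a := 0) (b := 1) (fun u => late u) 1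
    simp only [sub_self, sub_zero, hl1] at this
    refine Eq.trans ?_ this
    refine intervalIntegral.integral_congr fun u _ => ?_
    simp only [early, late, ContinuousMap.coe_mk]
    congr 2
    ring
  refine ⟨fun i => if i₀ = some i then late else early, fun i => ?_, ?_⟩
  · dsimp only
    split_ifs <;> assumption
  · rintro i j rfl hij t ht
    simp only [Option.some.injEq, Ne.symm hij, if_false, if_true]
    rcases le_total t (1 / 2) with h | h
    · exact Or.inr (hl t ⟨ht.1, h⟩)
    · left
      have : 1 / 2 - t ≤ 0 := by linarith
      simp only [early, ContinuousMap.coe_mk, max_eq_left this, mul_zero]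

end Controls

/-! ### The flow acts locally transitively on the leaves -/

section Transitivity

variable {n s : ℕ} {N : Type*} [TopologicalSpace N] [ChartedSpace (EuclideanSpace ℝ (Fin n)) N]
  [IsManifold (𝓡 n) ∞ N] {ι : Type} [Fintype ι]

namespace Flow

variable {X : ι → VField n N} {β : ι → C(ℝ, ℝ)} (Φ : Flow X β)
  {φ : OpenPartialHomeomorph N (EuclideanSpace ℝ (Fin n))}

lemma contMDiffAt_param {a : ι → ℝ} {c : N} (hz : (a, c) ∈ Φ.D) :
    ContMDiffAt 𝓘(ℝ, ι → ℝ) (𝓡 n) ∞ (fun a => Φ.e (a, c)) a :=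
  (Φ.contMDiffAt _ hz).comp a (contMDiffAt_id.prodMk contMDiffAt_const)

lemma hasMFDerivAt_param {a : ι → ℝ} {c : N} (hz : (a, c) ∈ Φ.D) :
    HasMFDerivAt 𝓘(ℝ, ι → ℝ) (𝓡 n) (fun a => Φ.e (a, c)) a (Φ.paramDeriv a c) :=
  ((Φ.contMDiffAt_param hz).mdifferentiableAt (by simp)).hasMFDerivAt

lemma contDiffAt_chart_param (hφ : φ ∈ IsManifold.maximalAtlas (𝓡 n) ∞ N) {a : ι → ℝ} {c : N}
    (hz : (a, c) ∈ Φ.D) (hs : Φ.e (a, c) ∈ φ.source) :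
    ContDiffAt ℝ ∞ (fun a => φ (Φ.e (a, c))) a :=
  ((contMDiffAt_of_mem_maximalAtlas hφ hs).comp a (Φ.contMDiffAt_param hz)).contDiffAt

lemma hasFDerivAt_chart_param (hφ : φ ∈ IsManifold.maximalAtlas (𝓡 n) ∞ N) {a : ι → ℝ} {c : N}
    (hz : (a, c) ∈ Φ.D) (hs : Φ.e (a, c) ∈ φ.source) :
    HasFDerivAt (fun a => φ (Φ.e (a, c)))
      ((chartDeriv φ (Φ.e (a, c))).comp (Φ.paramDeriv a c)) a :=
  ((((mdifferentiable_of_mem_maximalAtlas hφ).mdifferentiableAt hs).hasMFDerivAt).comp a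
    (Φ.hasMFDerivAt_param hz)).hasFDerivAt

lemma e_mem_leaf_iff {F : Foliation n N s} {D : (x : N) → Submodule ℝ (TangentSpace (𝓡 n) x)}
    (hF : F.Integrates D) (hX : ∀ i, IsSmoothField (X i)) (hXD : ∀ i x, X i x ∈ D x)
    {z : (ι → ℝ) × N} (hz : z ∈ Φ.D) {k : F.ι} : Φ.e z ∈ F.leaf k ↔ z.2 ∈ F.leaf k := by
  obtain ⟨Γ, hΓ, hΓ₀, hΓ₁⟩ := Φ.exists_curve z hz
  rw [← hΓ₀, ← hΓ₁]
  exact ⟨fun h => hΓ.mem_leaf hF hX hXD isPreconnected_Icc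
      (fun i => continuousOn_control β _ i _) (t₀ := 1) (by simp) h 0 (by simp),
    fun h => hΓ.mem_leaf hF hX hXD isPreconnected_Icc
      (fun i => continuousOn_control β _ i _) (t₀ := 0) (by simp) h 1 (by simp)⟩

/-- The points of a leaf near a given point are reached from it by the flow of fields that span the
tangent spaces to the leaves. -/
lemma eventually_exists_eq_incl [T2Space N] {F : Foliation n N s}
    {D : (x : N) → Submodule ℝ (TangentSpace (𝓡 n) x)} (hF : F.Integrates D)
    (hX : ∀ i, IsSmoothField (X i)) (hXD : ∀ i x, X i x ∈ D x)
    (hspan : ∀ x, ∀ v ∈ D x, ∃ w : ι → ℝ, v = ∑ i, w i • X i x)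
    (hβ : ∀ i, ∫ u in (0 : ℝ)..1, β i u = 1) {k : F.ι} (y : F.Leaf k) :
    ∀ᶠ y' in 𝓝 y, ∃ a, (a, F.incl k y) ∈ Φ.D ∧ Φ.e (a, F.incl k y) = F.incl k y' := by
  obtain ⟨C, _, _, ⟨P⟩⟩ := F.exists_plaqueChart k y
  obtain ⟨U, hU, hUs, K, hK, hUK⟩ := P.exists_nhds_height_le hF hX hXD (Q := univ) univ_mem
  have h0 := Φ.zero_mem (F.incl k y)
  have he0 : Φ.e (0, F.incl k y) = F.incl k y := Φ.e_zero hX _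
  have hs0 : Φ.e (0, F.incl k y) ∈ P.φ.source := by rw [he0]; exact P.maps y P.mem_ψ
  let L : EuclideanSpace ℝ (Fin n) →L[ℝ] EuclideanSpace ℝ (Fin s) :=
    (ContinuousLinearMap.fst ℝ (EuclideanSpace ℝ (Fin s)) C).comp (P.A.symm : _ →L[ℝ] _)
  let f : (ι → ℝ) → EuclideanSpace ℝ (Fin s) := fun a => P.base (Φ.e (a, F.incl k y))
  -- small values of the parameters lead to points of the plaque
  have hgood : ∀ᶠ a in 𝓝 (0 : ι → ℝ), (a, F.incl k y) ∈ Φ.D ∧ ∃ y' ∈ P.ψ.source,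
      P.ψ y' = f a ∧ F.incl k y' = Φ.e (a, F.incl k y) := by
    have hca : ContinuousAt (fun a : ι → ℝ => (a, F.incl k y)) 0 := by fun_prop
    filter_upwards [hca.eventually (Φ.small (F.incl k y) U hU),
      hca.eventually (Φ.isOpen_D.mem_nhds h0)] with a ⟨Γ, hΓ, hΓ₀, hΓ₁, hΓU⟩ ha
    refine ⟨ha, ?_⟩
    obtain ⟨M, hM⟩ : ∃ M : ℝ, ∀ i, ∀ t ∈ Icc (0 : ℝ) 1, |control β a i t| ≤ M := by
      have h1 : ∀ i, ∃ M : ℝ, ∀ t ∈ Icc (0 : ℝ) 1, |control β a i t| ≤ M := fun i =>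
        isCompact_Icc.exists_bound_of_continuousOn (continuousOn_control β a i _)
      choose M hM using h1
      refine ⟨∑ i, |M i|, fun i t ht => (hM i t ht).trans ((le_abs_self _).trans ?_)⟩
      exact Finset.single_le_sum (f := fun i => |M i|) (fun i _ => abs_nonneg _) (Finset.mem_univ i)
    have hz := P.height_eq_zero ordConnected_Icc hΓ (M := max M 0) (le_max_right _ _)
      (fun t ht i => (hM i t ht).trans (le_max_left _ _)) hUs
      (fun x hx => (hUK x hx).1) hΓU (t₀ := 0) (by simp) (by rw [hΓ₀]; exact P.height_incl P.mem_ψ)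
    obtain ⟨y', hy', h1, h2⟩ := (hUK _ (hΓU 1 (by simp))).2 (hz 1 (by simp))
    rw [hΓ₁] at h1 h2
    exact ⟨y', hy'.2, h1, h2⟩
  have hd : HasFDerivAt f (L.comp ((chartDeriv P.φ (Φ.e (0, F.incl k y))).comp
      (Φ.paramDeriv 0 (F.incl k y)))) 0 :=
    L.hasFDerivAt.comp 0 (Φ.hasFDerivAt_chart_param P.φ_mem h0 hs0)
  have hstrict := (L.contDiff.contDiffAt.comp (0 : ι → ℝ)
    (Φ.contDiffAt_chart_param P.φ_mem h0 hs0)).hasStrictFDerivAt' hd (by simp)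
  have hsurj : (L.comp ((chartDeriv P.φ (Φ.e (0, F.incl k y))).comp
      (Φ.paramDeriv 0 (F.incl k y)))).range = ⊤ := by
    refine LinearMap.range_eq_top.2 fun ζ => ?_
    obtain ⟨v, hv, hvζ⟩ : ∃ v ∈ D (Φ.e (0, F.incl k y)),
        chartDeriv P.φ (Φ.e (0, F.incl k y)) v = P.A (ζ, 0) := by
      rw [he0]
      exact P.exists_mem_of_base hF P.mem_ψ ζ
    obtain ⟨w, hw⟩ := hspan _ v hv
    refine ⟨w, ?_⟩
    have h1 : L (chartDeriv P.φ (Φ.e (0, F.incl k y)) (Φ.paramDeriv 0 (F.incl k y) w)) = ζ := by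
      rw [Φ.paramDeriv_zero hX hβ, ← hw, hvζ]
      simp [L]
    exact h1
  have hmap := hstrict.map_nhds_eq_of_surj hsurj
  have hf0 : f 0 = P.ψ y := by
    simp only [f, he0, PlaqueChart.base, P.eq y P.mem_ψ]
    simp
  have himg : f '' {a | (a, F.incl k y) ∈ Φ.D ∧ ∃ y' ∈ P.ψ.source,
      P.ψ y' = f a ∧ F.incl k y' = Φ.e (a, F.incl k y)} ∈ 𝓝 (P.ψ y) := by
    rw [← hf0]
    exact hmap ▸ image_mem_map hgood
  filter_upwards [P.ψ.open_source.mem_nhds P.mem_ψ,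
    (P.ψ.continuousAt P.mem_ψ).preimage_mem_nhds himg] with y' hy' ⟨a, ⟨ha, y'', hy'', h1, h2⟩, h3⟩
  refine ⟨a, ha, ?_⟩
  rw [← h2, P.ψ.injOn hy'' hy' (h1.trans h3)]

end Flow

end Transitivity

/-! ### Propagation along the leaves -/

section Propagation

variable {n s : ℕ} {N : Type*} [TopologicalSpace N] [ChartedSpace (EuclideanSpace ℝ (Fin n)) N]
  [IsManifold (𝓡 n) ∞ N] {ι : Type} [Fintype ι]

/-- The smooth fields `X i` span the tangent spaces to the leaves of `F`. -/
structure Generates (X : ι → VField n N) (F : Foliation n N s) : Prop where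
  smooth : ∀ i, IsSmoothField (X i)
  integrates : F.Integrates fun x => Submodule.span ℝ (range fun i => X i x)

namespace Generates

variable {X : ι → VField n N} {F : Foliation n N s}

lemma mem_leaf (hX : Generates X F) {u : ι → ℝ → ℝ} {J : Set ℝ} (hJ : IsPreconnected J)
    (hu : ∀ i, ContinuousOn (u i) J) {γ : ℝ → N} (h : IsSolutionOn (controlled X u) γ J)
    {k : F.ι} {t₀ : ℝ} (ht₀ : t₀ ∈ J) (h₀ : γ t₀ ∈ F.leaf k) : ∀ t ∈ J, γ t ∈ F.leaf k :=
  h.mem_leaf hX.integrates hX.smooth (fun i _ => Submodule.subset_span ⟨i, rfl⟩) hJ hu ht₀ h₀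

lemma e_mem_leaf_iff (hX : Generates X F) {β : ι → C(ℝ, ℝ)} (Φ : Flow X β) {z : (ι → ℝ) × N}
    (hz : z ∈ Φ.D) {k : F.ι} : Φ.e z ∈ F.leaf k ↔ z.2 ∈ F.leaf k :=
  Φ.e_mem_leaf_iff hX.integrates hX.smooth (fun i _ => Submodule.subset_span ⟨i, rfl⟩) hz

lemma eventually_exists_eq [T2Space N] (hX : Generates X F) {β : ι → C(ℝ, ℝ)} (Φ : Flow X β)
    (hβ : ∀ i, ∫ u in (0 : ℝ)..1, β i u = 1) {k : F.ι} (y : F.Leaf k) :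
    ∀ᶠ y' in 𝓝 y, ∃ a, (a, F.incl k y) ∈ Φ.D ∧ Φ.e (a, F.incl k y) = F.incl k y' :=
  Φ.eventually_exists_eq_incl hX.integrates hX.smooth (fun i _ => Submodule.subset_span ⟨i, rfl⟩)
    (fun x v hv => by
      obtain ⟨w, hw⟩ := (Submodule.mem_span_range_iff_exists_fun ℝ).1 hv
      exact ⟨w, hw.symm⟩) hβ y

/-- A property invariant under a flow of fields that span the tangent spaces to the leaves holds at
all points of a leaf as soon as it holds at one point: the leaves are connected. -/
lemma leaf_induction_flow [T2Space N] (hX : Generates X F) {β : ι → C(ℝ, ℝ)} (Φ : Flow X β)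
    (hβ : ∀ i, ∫ u in (0 : ℝ)..1, β i u = 1) {P : N → Prop}
    (hP : ∀ z ∈ Φ.D, P z.2 ↔ P (Φ.e z)) {k : F.ι} {x x' : N} (hx : x ∈ F.leaf k)
    (hx' : x' ∈ F.leaf k) (h : P x) : P x' := by
  obtain ⟨y, rfl⟩ := hx
  obtain ⟨y', rfl⟩ := hx'
  refine forall_mem_of_locally (isPreconnected_univ (α := F.Leaf k))
    (P := fun y => P (F.incl k y)) (fun y₀ _ => ?_) (mem_univ y) h y' (mem_univ _)
  have hev : ∀ᶠ y₁ in 𝓝 y₀, P (F.incl k y₀) ↔ P (F.incl k y₁) := by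
    filter_upwards [hX.eventually_exists_eq Φ hβ y₀] with y₁ ⟨a, ha, hay⟩
    rw [← hay]
    exact hP _ ha
  exact ⟨_, hev, fun y₁ h₁ _ y₂ h₂ _ h => h₂.1 (h₁.2 h)⟩

/-- A property invariant along the curves driven by fields that span the tangent spaces to the
leaves holds at all points of a leaf as soon as it holds at one point. -/
lemma leaf_induction [T2Space N] (hX : Generates X F) {P : N → Prop}
    (hP : ∀ (u : ι → ℝ → ℝ) (Γ : ℝ → N), (∀ i, ContinuousOn (u i) (Icc 0 1)) →
      IsSolutionOn (controlled X u) Γ (Icc 0 1) → (P (Γ 0) ↔ P (Γ 1)))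
    {k : F.ι} {x x' : N} (hx : x ∈ F.leaf k) (hx' : x' ∈ F.leaf k) (h : P x) : P x' := by
  obtain ⟨β, hβ, -⟩ := exists_controls (ι := ι) none
  obtain ⟨Φ⟩ := Flow.nonempty hX.smooth β
  refine hX.leaf_induction_flow Φ hβ (fun z hz => ?_) hx hx' h
  obtain ⟨Γ, hΓ, hΓ₀, hΓ₁⟩ := Φ.exists_curve z hz
  rw [← hΓ₀, ← hΓ₁]
  exact hP _ Γ (fun i => continuousOn_control β z.1 i _) hΓ

/-- A finite-dimensional space of fields that is stable under the brackets with the fields `X i` and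
that vanishes at one point of a leaf vanishes on the leaf. -/
lemma eq_zero_on_leaf [T2Space N] (hX : Generates X F) {I : Submodule ℝ (VField n N)}
    [FiniteDimensional ℝ I]
    (hI : ∀ W ∈ I, IsSmoothField W)
    (hIX : ∀ i, ∀ W ∈ I, VectorField.mlieBracket (𝓡 n) (X i) W ∈ I) {k : F.ι} {x x' : N}
    (hx : x ∈ F.leaf k) (hx' : x' ∈ F.leaf k) (h : ∀ W ∈ I, W x = 0) : ∀ W ∈ I, W x' = 0 := by
  let b := Module.finBasis ℝ I
  have hb : ∀ W (hW : W ∈ I) x, W x = ∑ l, b.repr ⟨W, hW⟩ l • (b l : VField n N) x :=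
    fun W hW x => by
    have h1 := congrFun (congrArg Subtype.val (b.sum_repr ⟨W, hW⟩)) x
    rw [← show _ = W x from h1]
    simp only [AddSubmonoidClass.coe_finsetSum, SetLike.val_smul]
    rw [Finset.sum_apply]
    rfl
  have hiff : ∀ x, (∀ W ∈ I, W x = 0) ↔ ∀ j, (b j : VField n N) x = 0 := fun x => by
    refine ⟨fun h j => h _ (b j).2, fun h W hW => ?_⟩
    rw [hb W hW]
    simp [h]
  have hc : ∀ i j x, VectorField.mlieBracket (𝓡 n) (X i) (b j : VField n N) x =
      ∑ l, b.repr ⟨_, hIX i _ (b j).2⟩ l • (b l : VField n N) x := fun i j x =>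
    hb _ (hIX i _ (b j).2) x
  refine hX.leaf_induction (P := fun x => ∀ W ∈ I, W x = 0) (fun u Γ hu hΓ => ?_) hx hx' h
  simp only [hiff]
  have key : ∀ t₀ ∈ Icc (0 : ℝ) 1, (∀ j, (b j : VField n N) (Γ t₀) = 0) →
      ∀ t ∈ Icc (0 : ℝ) 1, ∀ j, (b j : VField n N) (Γ t) = 0 := fun t₀ ht₀ h₀ =>
    hΓ.eq_zero_of_bracket hX.smooth (W := fun j => (b j : VField n N)) (fun j => hI _ (b j).2) hc
      isPreconnected_Icc hu ht₀ h₀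
  exact ⟨fun h => key 0 (by simp) h 1 (by simp), fun h => key 1 (by simp) h 0 (by simp)⟩

/-- A first integral of the fields `X i` is constant on the leaves. -/
lemma eq_on_leaf [T2Space N] (hX : Generates X F) {g : N → ℝ} (hg : MDifferentiable (𝓡 n) 𝓘(ℝ, ℝ) g)
    (hgX : ∀ i x, mfderiv (𝓡 n) 𝓘(ℝ, ℝ) g x (X i x) = 0) {k : F.ι} {x x' : N}
    (hx : x ∈ F.leaf k) (hx' : x' ∈ F.leaf k) : g x' = g x := by
  refine hX.leaf_induction (P := fun x' => g x' = g x) (fun u Γ hu hΓ => ?_) hx hx' rfl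
  have hd : ∀ t ∈ Icc (0 : ℝ) 1, HasDerivAt (fun t => g (Γ t)) 0 t := fun t ht => by
    have h1 := (hg (Γ t)).hasMFDerivAt.comp t (hΓ t ht)
    have h2 : HasFDerivAt (fun t => g (Γ t)) ((mfderiv (𝓡 n) 𝓘(ℝ, ℝ) g (Γ t)).comp
      ((1 : ℝ →L[ℝ] ℝ).smulRight (controlled X u t (Γ t)))) t := h1.hasFDerivAt
    have h3 : mfderiv (𝓡 n) 𝓘(ℝ, ℝ) g (Γ t) (controlled X u t (Γ t)) = 0 := by
      simp only [controlled]
      rw [map_sum]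
      refine Finset.sum_eq_zero fun i _ => ?_
      rw [map_smul, hgX, smul_zero]
    refine (hasDerivAt_iff_hasFDerivAt.2 (h2.congr_fderiv ?_))
    refine ContinuousLinearMap.ext fun r => ?_
    have h4 : mfderiv (𝓡 n) 𝓘(ℝ, ℝ) g (Γ t) (r • controlled X u t (Γ t)) = 0 := by
      rw [map_smul, h3, smul_zero]
    exact h4.trans (smul_zero r).symm
  have h01 := constant_of_has_deriv_right_zero (f := fun t => g (Γ t)) (a := 0) (b := 1)
    (fun t ht => (hd t ht).continuousAt.continuousWithinAt)
    (fun t ht => (hd t (Ico_subset_Icc_self ht)).hasDerivWithinAt) 1 (by simp)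
  rw [show g (Γ 1) = g (Γ 0) from h01]

end Generates

end Propagation

/-! ### Complements of subspaces -/

section LinearAlgebra

variable {E : Type*} [AddCommGroup E] [Module ℝ E]

/-- If the subspaces `P y`, for `y` in any of the sets `U i`, have an intersection contained in
`V₀`, then already the intersection of one of them for each `i` is contained in `V₀`, provided that
there are as many sets as dimensions. -/
lemma exists_forall_mem_imp {α : Type*} (P : α → Submodule ℝ E) (V₀ : Submodule ℝ E) :
    ∀ (m : ℕ) (K : Submodule ℝ E) [FiniteDimensional ℝ K], Module.finrank ℝ K ≤ m →
    ∀ U : Fin m → Set α, (∀ i, (U i).Nonempty) →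
    (∀ i, ∀ Z ∈ K, (∀ y ∈ U i, Z ∈ P y) → Z ∈ V₀) →
    ∃ q : Fin m → α, (∀ i, q i ∈ U i) ∧ ∀ Z ∈ K, (∀ i, Z ∈ P (q i)) → Z ∈ V₀
  | 0, K, _, hK, U, _, _ => by
    refine ⟨fun i => i.elim0, fun i => i.elim0, fun Z hZ _ => ?_⟩
    rw [Submodule.finrank_eq_zero.1 (Nat.le_zero.1 hK)] at hZ
    rw [(Submodule.mem_bot ℝ).1 hZ]
    exact V₀.zero_mem
  | m + 1, K, _, hK, U, hne, hU => by
    by_cases hKV : K ≤ V₀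
    · exact ⟨fun i => (hne i).some, fun i => (hne i).some_mem, fun Z hZ _ => hKV hZ⟩
    obtain ⟨Z, hZK, hZ⟩ := SetLike.not_le_iff_exists.1 hKV
    obtain ⟨y, hy, hZy⟩ : ∃ y ∈ U 0, Z ∉ P y := by
      by_contra! h
      exact hZ (hU 0 Z hZK h)
    have hlt : K ⊓ P y < K := lt_of_le_of_ne inf_le_left fun h => hZy (by
      rw [← h] at hZK
      exact hZK.2)
    have := Submodule.finrank_lt_finrank_of_lt hlt
    obtain ⟨q, hqU, hq⟩ := exists_forall_mem_imp P V₀ m (K ⊓ P y) (by omega) (fun i => U i.succ)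
      (fun i => hne _) (fun i Z hZ => hU _ Z hZ.1)
    refine ⟨Fin.cons y q, fun i => ?_, fun Z hZ h => hq Z ⟨hZ, by simpa using h 0⟩ fun i => ?_⟩
    · refine Fin.cases ?_ (fun i => ?_) i
      · simpa using hy
      · simpa using hqU i
    · simpa using h i.succ

variable {V V₀ : Submodule ℝ E}

lemma exists_complement_basis [FiniteDimensional ℝ V] (h : V₀ ≤ V) :
    ∃ (K : ℕ) (X : Fin K → E), (∀ j, X j ∈ V) ∧ K + Module.finrank ℝ V₀ = Module.finrank ℝ V ∧
      (∀ w : Fin K → ℝ, ∑ j, w j • X j ∈ V₀ → w = 0) ∧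
      ∀ Z ∈ V, ∃ w : Fin K → ℝ, Z - ∑ j, w j • X j ∈ V₀ := by
  set V' := V₀.comap V.subtype
  let b := Module.finBasis ℝ (V ⧸ V')
  choose X hX using fun j => V'.mkQ_surjective (b j)
  have hsum : ∀ w : Fin (Module.finrank ℝ (V ⧸ V')) → ℝ,
      V'.mkQ (∑ j, w j • X j) = ∑ j, w j • b j := fun w => by simp [map_sum, ← hX]
  refine ⟨_, fun j => X j, fun j => (X j).2, ?_, fun w hw => ?_, fun Z hZ => ?_⟩
  · rw [← V'.finrank_quotient_add_finrank]
    congr 1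
    exact (Submodule.comapSubtypeEquivOfLe h).finrank_eq.symm
  · have h0 : ∑ j, w j • X j ∈ V' := by simpa [V'] using hw
    rw [← Submodule.Quotient.mk_eq_zero] at h0
    have h1 : ∑ j, w j • b j = 0 := (hsum w).symm.trans h0
    exact funext (Fintype.linearIndependent_iff.1 b.linearIndependent w h1)
  · refine ⟨b.repr (V'.mkQ ⟨Z, hZ⟩), ?_⟩
    have h1 : (⟨Z, hZ⟩ : V) - ∑ j, b.repr (V'.mkQ ⟨Z, hZ⟩) j • X j ∈ V' := by
      rw [← Submodule.Quotient.mk_eq_zero]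
      have h2 : V'.mkQ ((⟨Z, hZ⟩ : V) - ∑ j, b.repr (V'.mkQ ⟨Z, hZ⟩) j • X j) = 0 := by
        rw [map_sub, hsum, b.sum_repr, sub_self]
      exact h2
    simpa [V'] using h1

lemma linearIndependent_mkQ {K : ℕ} {X : Fin K → V}
    (hX : ∀ w : Fin K → ℝ, ∑ j, w j • (X j : E) ∈ V₀ → w = 0) :
    LinearIndependent ℝ fun j => (V₀.comap V.subtype).mkQ (X j) := by
  refine Fintype.linearIndependent_iff.2 fun w hw j => congrFun (hX w ?_) j
  have h1 : (V₀.comap V.subtype).mkQ (∑ j, w j • X j) = 0 := by simpa [map_sum] using hw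
  have h2 := (Submodule.Quotient.mk_eq_zero _).1 h1
  simpa using h2

lemma add_finrank_le_of_independent [FiniteDimensional ℝ V] (h : V₀ ≤ V) {K : ℕ} {X : Fin K → E}
    (hXV : ∀ j, X j ∈ V) (hX : ∀ w : Fin K → ℝ, ∑ j, w j • X j ∈ V₀ → w = 0) :
    K + Module.finrank ℝ V₀ ≤ Module.finrank ℝ V := by
  have h1 := (linearIndependent_mkQ (X := fun j => (⟨X j, hXV j⟩ : V)) hX).fintype_card_le_finrank
  rw [← (V₀.comap V.subtype).finrank_quotient_add_finrank,
    (Submodule.comapSubtypeEquivOfLe h).finrank_eq]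
  simpa using h1

lemma exists_sub_mem_of_independent [FiniteDimensional ℝ V] (h : V₀ ≤ V) {K : ℕ} {X : Fin K → E}
    (hXV : ∀ j, X j ∈ V) (hX : ∀ w : Fin K → ℝ, ∑ j, w j • X j ∈ V₀ → w = 0)
    (hK : K + Module.finrank ℝ V₀ = Module.finrank ℝ V) {Z : E} (hZ : Z ∈ V) :
    ∃ w : Fin K → ℝ, Z - ∑ j, w j • X j ∈ V₀ := by
  set V' := V₀.comap V.subtype
  have h1 := linearIndependent_mkQ (X := fun j => (⟨X j, hXV j⟩ : V)) hX
  have h2 := h1.span_eq_top_of_card_eq_finrank' (by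
    have := (V₀.comap V.subtype).finrank_quotient_add_finrank
    rw [(Submodule.comapSubtypeEquivOfLe h).finrank_eq] at this
    rw [Fintype.card_fin]
    omega)
  have h3 : V'.mkQ ⟨Z, hZ⟩ ∈ Submodule.span ℝ (range fun j => V'.mkQ (⟨X j, hXV j⟩ : V)) := by
    rw [h2]; trivial
  obtain ⟨w, hw⟩ := (Submodule.mem_span_range_iff_exists_fun ℝ).1 h3
  refine ⟨w, ?_⟩
  have h4 : (⟨Z, hZ⟩ : V) - ∑ j, w j • (⟨X j, hXV j⟩ : V) ∈ V' := by
    rw [← Submodule.Quotient.mk_eq_zero]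
    have h5 : V'.mkQ ((⟨Z, hZ⟩ : V) - ∑ j, w j • (⟨X j, hXV j⟩ : V)) = 0 := by
      rw [map_sub, map_sum, ← hw, sub_eq_zero]
      exact Finset.sum_congr rfl fun j _ => (map_smul _ _ _).symm
    exact h5
  simpa [V'] using h4

end LinearAlgebra

/-! ### Fields that vanish on a leaf -/

section Vanishing

variable {n s : ℕ} {N : Type*} [TopologicalSpace N] [ChartedSpace (EuclideanSpace ℝ (Fin n)) N]

/-- The fields of `V` that vanish on `S`. -/
def vanishingOn (V : Submodule ℝ (VField n N)) (S : Set N) : Submodule ℝ (VField n N) where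
  carrier := {Z | Z ∈ V ∧ ∀ x ∈ S, Z x = 0}
  add_mem' := fun {Z W} hZ hW => ⟨V.add_mem hZ.1 hW.1, fun x hx => by
    rw [Pi.add_apply, hZ.2 x hx, hW.2 x hx, add_zero]⟩
  zero_mem' := ⟨V.zero_mem, fun _ _ => rfl⟩
  smul_mem' := fun c {Z} hZ => ⟨V.smul_mem c hZ.1, fun x hx => by
    rw [Pi.smul_apply, hZ.2 x hx, smul_zero]⟩

lemma vanishingOn_le (V : Submodule ℝ (VField n N)) (S : Set N) : vanishingOn V S ≤ V :=
  fun _ h => h.1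

variable [IsManifold (𝓡 n) ∞ N] {F : Foliation n N s}
  {D : (x : N) → Submodule ℝ (TangentSpace (𝓡 n) x)}

/-- The bracket at `x` of a field tangent to the leaf through `x` with a field that vanishes on the
leaf near `x` is zero. -/
lemma mlieBracket_eq_zero_of_eventually (hF : F.Integrates D) {Z W : VField n N}
    (hZ : IsSmoothField Z) (hW : IsSmoothField W) {k : F.ι} {y : F.Leaf k}
    (hWD : W (F.incl k y) ∈ D (F.incl k y)) (hZ0 : ∀ᶠ y' in 𝓝 y, Z (F.incl k y') = 0) :
    VectorField.mlieBracket (𝓡 n) W Z (F.incl k y) = 0 := by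
  obtain ⟨C, _, _, ⟨P⟩⟩ := F.exists_plaqueChart k y
  have hs := P.maps y P.mem_ψ
  refine chartDeriv_injective P.φ_mem hs ?_
  rw [map_zero, ← chartRep_apply hs, chartRep_mlieBracket P.φ_mem hW hZ (P.φ.map_source hs),
    VectorField.lieBracket, chartRep_apply hs, chartRep_apply hs, hZ0.self_of_nhds, map_zero,
    map_zero, sub_zero]
  obtain ⟨ζ, hζ⟩ := P.exists_chartDeriv_eq hF P.mem_ψ hWD
  rw [hζ]
  -- `Z` vanishes along a curve in the leaf with the velocity of `W`
  let c : ℝ → EuclideanSpace ℝ (Fin n) := fun t => P.A (P.ψ y + t • ζ, 0)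
  have hc0 : c 0 = P.φ (F.incl k y) := by simp [c, P.eq y P.mem_ψ]
  have hc : HasDerivAt c (P.A (ζ, 0)) 0 := by
    let L : EuclideanSpace ℝ (Fin s) →L[ℝ] EuclideanSpace ℝ (Fin n) :=
      (P.A : _ →L[ℝ] _).comp (ContinuousLinearMap.inl ℝ _ C)
    have h1 : HasDerivAt (fun t : ℝ => P.ψ y + t • ζ) ζ 0 := by
      simpa using ((hasDerivAt_id (0 : ℝ)).smul_const ζ).const_add (P.ψ y)
    exact L.hasFDerivAt.comp_hasDerivAt 0 h1
  have hd : HasFDerivAt (chartRep P.φ Z) (fderiv ℝ (chartRep P.φ Z) (P.φ (F.incl k y))) (c 0) := by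
    rw [hc0]
    exact (((contDiffOn_chartRep P.φ_mem hZ).contDiffAt (P.φ.open_target.mem_nhds
      (P.φ.map_source hs))).differentiableAt (by simp)).hasFDerivAt
  have h2 := hd.comp_hasDerivAt 0 hc
  have hcont : ContinuousAt (fun t : ℝ => P.ψ y + t • ζ) 0 := by fun_prop
  have hev : ∀ᶠ t in 𝓝 (0 : ℝ), (chartRep P.φ Z ∘ c) t = 0 := by
    have e1 : ∀ᶠ z in 𝓝 (P.ψ y), Z (F.incl k (P.ψ.symm z)) = 0 :=
      (P.ψ.symm.continuousAt (P.ψ.map_source P.mem_ψ)).eventually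
        (by simpa [P.ψ.left_inv P.mem_ψ] using hZ0)
    have e2 := e1.and (P.ψ.open_target.mem_nhds (P.ψ.map_source P.mem_ψ))
    have e3 : ∀ᶠ t in 𝓝 (0 : ℝ), Z (F.incl k (P.ψ.symm (P.ψ y + t • ζ))) = 0 ∧
        P.ψ y + t • ζ ∈ P.ψ.target := hcont.eventually (by simpa using e2)
    filter_upwards [e3] with t ⟨h3, h4⟩
    have h5 := P.ψ.map_target h4
    have h6 : c t = P.φ (F.incl k (P.ψ.symm (P.ψ y + t • ζ))) := by
      rw [P.eq _ h5, P.ψ.right_inv h4]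
    rw [Function.comp_apply, h6, chartRep_apply (P.maps _ h5), h3, map_zero]
  have h3 : HasDerivAt (chartRep P.φ Z ∘ c) 0 0 :=
    (hasDerivAt_const (0 : ℝ) (0 : EuclideanSpace ℝ (Fin n))).congr_of_eventuallyEq hev
  exact h2.unique h3

variable {ι : Type} [Fintype ι] {X : ι → VField n N} {V : Submodule ℝ (VField n N)}

/-- A field of `V` that vanishes on a nonempty open part of a leaf vanishes on the leaf: the fields
of `V` that vanish on the open part form a space stable under brackets with `V`. -/
lemma Generates.mem_vanishingOn [T2Space N] (hX : Generates X F) (hV : IsLieAlgebraOfFields V)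
    (hXV : ∀ i, X i ∈ V) {k : F.ι} {U : Set (F.Leaf k)} (hU : IsOpen U) (hne : U.Nonempty)
    {Z : VField n N} (hZ : Z ∈ V) (h : ∀ y ∈ U, Z (F.incl k y) = 0) :
    Z ∈ vanishingOn V (F.leaf k) := by
  have := hV.finite
  have : FiniteDimensional ℝ (vanishingOn V (F.incl k '' U)) :=
    Submodule.finiteDimensional_of_le (vanishingOn_le _ _)
  obtain ⟨y, hy⟩ := hne
  refine ⟨hZ, fun x hx => ?_⟩
  refine hX.eq_zero_on_leaf (I := vanishingOn V (F.incl k '' U)) (fun W hW => hV.smooth W hW.1)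
    (fun i W hW => ⟨hV.bracket_mem _ (hXV i) _ hW.1, ?_⟩) (x := F.incl k y) ⟨y, rfl⟩ hx
    (fun W hW => hW.2 _ ⟨y, hy, rfl⟩) Z ⟨hZ, ?_⟩
  · rintro _ ⟨y', hy', rfl⟩
    refine mlieBracket_eq_zero_of_eventually hX.integrates (hV.smooth W hW.1) (hX.smooth i)
      (Submodule.subset_span ⟨i, rfl⟩) ?_
    filter_upwards [hU.mem_nhds hy'] with y'' hy''
    exact hW.2 _ ⟨y'', hy'', rfl⟩
  · rintro _ ⟨y', hy', rfl⟩
    exact h y' hy'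

end Vanishing

/-! ### Generic tuples and generic leaves -/

section Generic

variable {n s : ℕ} {N : Type*} [TopologicalSpace N] [ChartedSpace (EuclideanSpace ℝ (Fin n)) N]

/-- The tuple `q` separates the combinations of the fields `X j`: only the zero combination vanishes
at all the points of the tuple. -/
def Separates {κ : Type} [Fintype κ] (X : κ → VField n N) {m : ℕ} (q : Fin m → N) : Prop :=
  ∀ w : κ → ℝ, (∀ i, ∑ j, w j • X j (q i) = 0) → w = 0

lemma isOpen_separates [IsManifold (𝓡 n) ∞ N] {κ : Type} [Fintype κ] {X : κ → VField n N}
    (hX : ∀ j, IsSmoothField (X j)) (m : ℕ) : IsOpen {q : Fin m → N | Separates X q} := by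
  refine isOpen_iff_mem_nhds.2 fun p hp => ?_
  let φ : Fin m → OpenPartialHomeomorph N (EuclideanSpace ℝ (Fin n)) := fun i =>
    chartAt (EuclideanSpace ℝ (Fin n)) (p i)
  have hφ : ∀ i, φ i ∈ IsManifold.maximalAtlas (𝓡 n) ∞ N := fun i =>
    IsManifold.chart_mem_maximalAtlas _
  have hs : ∀ i, p i ∈ (φ i).source := fun i => mem_chart_source _ _
  let f : (Fin m → N) → κ → Fin m → EuclideanSpace ℝ (Fin n) := fun q j i =>
    chartRep (φ i) (X j) (φ i (q i))
  have hf : ∀ q : Fin m → N, (∀ i, q i ∈ (φ i).source) →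
      (LinearIndependent ℝ (f q) ↔ Separates X q) := fun q hq => by
    have h1 : ∀ (w : κ → ℝ) (i : Fin m), (∑ j, w j • f q j) i =
        chartDeriv (φ i) (q i) (∑ j, w j • X j (q i)) := fun w i => by
      rw [Finset.sum_apply, map_sum]
      refine Finset.sum_congr rfl fun j _ => ?_
      rw [map_smul, ← chartRep_apply (hq i)]
      rfl
    rw [Fintype.linearIndependent_iff]
    have h2 : ∀ w : κ → ℝ, ∑ j, w j • f q j = 0 ↔ ∀ i, ∑ j, w j • X j (q i) = 0 := fun w => by
      rw [funext_iff]
      refine forall_congr' fun i => ?_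
      rw [h1 w i]
      exact map_eq_zero_iff _ (chartDeriv_injective (hφ i) (hq i))
    simp only [h2, Separates, funext_iff, Pi.zero_apply]
  have hcont : ContinuousAt f p := by
    refine continuousAt_pi.2 fun j => continuousAt_pi.2 fun i => ?_
    have h1 : ContinuousAt (chartRep (φ i) (X j)) (φ i (p i)) :=
      ((contDiffOn_chartRep (hφ i) (hX j)).continuousOn.continuousAt
        ((φ i).open_target.mem_nhds ((φ i).map_source (hs i))))
    have h2 : ContinuousAt (φ i) (p i) := (φ i).continuousAt (hs i)
    exact (h1.comp h2).comp (f := fun q : Fin m → N => q i) (continuous_apply i).continuousAt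
  have hopen : IsOpen {g : κ → Fin m → EuclideanSpace ℝ (Fin n) | LinearIndependent ℝ g} :=
    isOpen_setOfPred_linearIndependent
  have hsrc : ∀ᶠ q in 𝓝 p, ∀ i, q i ∈ (φ i).source := eventually_all.2 fun i =>
    (continuous_apply i).continuousAt.preimage_mem_nhds ((φ i).open_source.mem_nhds (hs i))
  filter_upwards [hsrc, hcont.preimage_mem_nhds (hopen.mem_nhds ((hf p hs).2 hp))] with q hq hq'
  exact (hf q hq).1 hq'

/-- The index of the leaf through `x`. -/
def Foliation.leafOf (F : Foliation n N s) (x : N) : F.ι := (F.partition x).choose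

lemma Foliation.mem_leafOf (F : Foliation n N s) (x : N) : x ∈ F.leaf (F.leafOf x) :=
  (F.partition x).choose_spec.1

lemma Foliation.leafOf_eq (F : Foliation n N s) {x : N} {k : F.ι} (h : x ∈ F.leaf k) :
    F.leafOf x = k := F.leaf_unique (F.mem_leafOf x) h

lemma Foliation.leaf_nonempty (F : Foliation n N s) (k : F.ι) : (F.leaf k).Nonempty :=
  range_nonempty _

/-- The dimension of the space of fields of `V` that vanish on the leaf through `x`. -/
def vanishingDim (V : Submodule ℝ (VField n N)) (F : Foliation n N s) (x : N) : ℕ :=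
  Module.finrank ℝ (vanishingOn V (F.leaf (F.leafOf x)))

/-- The points near which the space of fields of `V` that vanish on a leaf has the same dimension
for all the leaves. -/
def genericPoints (V : Submodule ℝ (VField n N)) (F : Foliation n N s) : Set N :=
  {x | ∀ᶠ x' in 𝓝 x, vanishingDim V F x' = vanishingDim V F x}

/-- The tuples of points of a leaf such that the fields of `V` that vanish at these points vanish on
the leaf. -/
def genericTuples (V : Submodule ℝ (VField n N)) (F : Foliation n N s) (k : F.ι) (m : ℕ) :
    Set (Fin m → F.Leaf k) :=
  {q | ∀ Z ∈ V, (∀ i, Z (F.incl k (q i)) = 0) → Z ∈ vanishingOn V (F.leaf k)}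

lemma isOpen_genericPoints (V : Submodule ℝ (VField n N)) (F : Foliation n N s) :
    IsOpen (genericPoints V F) := by
  refine isOpen_iff_mem_nhds.2 fun x hx => ?_
  filter_upwards [eventually_eventually_nhds.2 hx, hx] with x' h1 h2
  filter_upwards [h1] with x'' h3
  rw [h3, h2]

variable {F : Foliation n N s} {V : Submodule ℝ (VField n N)}

lemma sum_smul_mem {K : ℕ} {X : Fin K → VField n N} (hXV : ∀ j, X j ∈ V) (w : Fin K → ℝ) :
    ∑ j, w j • X j ∈ V := V.sum_mem fun j _ => V.smul_mem _ (hXV j)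

lemma sum_smul_apply {K : ℕ} (X : Fin K → VField n N) (w : Fin K → ℝ) (x : N) :
    (∑ j, w j • X j) x = ∑ j, w j • X j x := by
  rw [Finset.sum_apply]
  rfl

lemma apply_mem_span {r : ℕ} {Z : Fin r → VField n N} {W : VField n N}
    (hW : W ∈ Submodule.span ℝ (range Z)) (x : N) :
    W x ∈ Submodule.span ℝ (range fun i => Z i x) := by
  obtain ⟨w, rfl⟩ := (Submodule.mem_span_range_iff_exists_fun ℝ).1 hW
  rw [sum_smul_apply]
  exact Submodule.sum_mem _ fun i _ => Submodule.smul_mem _ _ (Submodule.subset_span ⟨i, rfl⟩)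

/-- A tuple of points of a leaf that separates the fields `X j` shows that no combination of these
fields vanishes on the leaf. -/
lemma Separates.eq_zero {K m : ℕ} {X : Fin K → VField n N} {q : Fin m → N} (h : Separates X q)
    {k : F.ι} (hq : ∀ i, q i ∈ F.leaf k) (w : Fin K → ℝ)
    (hw : ∑ j, w j • X j ∈ vanishingOn V (F.leaf k)) : w = 0 :=
  h w fun i => by rw [← sum_smul_apply]; exact hw.2 _ (hq i)

lemma mem_genericTuples_iff {K m : ℕ} {X : Fin K → VField n N} (hXV : ∀ j, X j ∈ V) {k : F.ι}
    (h0 : ∀ w : Fin K → ℝ, ∑ j, w j • X j ∈ vanishingOn V (F.leaf k) → w = 0)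
    (hsub : ∀ Z ∈ V, ∃ w : Fin K → ℝ, Z - ∑ j, w j • X j ∈ vanishingOn V (F.leaf k))
    (q : Fin m → F.Leaf k) :
    q ∈ genericTuples V F k m ↔ Separates X fun i => F.incl k (q i) := by
  refine ⟨fun hq w hw => h0 w (hq _ (sum_smul_mem hXV w) fun i => ?_), fun hq Z hZ hZq => ?_⟩
  · rw [sum_smul_apply, hw i]
  · obtain ⟨w, hw⟩ := hsub Z hZ
    have hw0 : w = 0 := hq w fun i => by
      have := hw.2 _ (mem_range_self (q i))
      rw [Pi.sub_apply, hZq i, zero_sub, neg_eq_zero, sum_smul_apply] at this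
      exact this
    simpa [hw0] using hw

variable [IsManifold (𝓡 n) ∞ N] {ι : Type} [Fintype ι] {Y : ι → VField n N}

lemma isOpen_genericTuples (hV : IsLieAlgebraOfFields V) (k : F.ι) (m : ℕ) :
    IsOpen (genericTuples V F k m) := by
  have := hV.finite
  obtain ⟨K, X, hXV, -, h0, hsub⟩ := exists_complement_basis (vanishingOn_le V (F.leaf k))
  have h1 : genericTuples V F k m =
      (fun q i => F.incl k (q i)) ⁻¹' {q : Fin m → N | Separates X q} :=
    Set.ext fun q => mem_genericTuples_iff hXV h0 hsub q
  rw [h1]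
  refine (isOpen_separates (fun j => hV.smooth _ (hXV j)) m).preimage ?_
  exact continuous_pi fun i => (F.immersion k).contMDiff.continuous.comp (continuous_apply i)

namespace Generates

lemma exists_mem_genericTuples [T2Space N] (hY : Generates Y F) (hV : IsLieAlgebraOfFields V)
    (hYV : ∀ i, Y i ∈ V) (k : F.ι) {m : ℕ} (hm : Module.finrank ℝ V ≤ m)
    {U : Fin m → Set (F.Leaf k)} (hU : ∀ i, IsOpen (U i)) (hne : ∀ i, (U i).Nonempty) :
    ∃ q ∈ genericTuples V F k m, ∀ i, q i ∈ U i := by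
  have := hV.finite
  let P : F.Leaf k → Submodule ℝ (VField n N) := fun y =>
    LinearMap.ker (LinearMap.proj (F.incl k y))
  obtain ⟨q, hqU, hq⟩ := exists_forall_mem_imp P (vanishingOn V (F.leaf k)) m V hm U hne
    fun i Z hZ h => hY.mem_vanishingOn hV hYV (hU i) (hne i) hZ h
  exact ⟨q, hq, hqU⟩

lemma dense_genericTuples [T2Space N] (hY : Generates Y F) (hV : IsLieAlgebraOfFields V)
    (hYV : ∀ i, Y i ∈ V) (k : F.ι) {m : ℕ} (hm : Module.finrank ℝ V ≤ m) :
    Dense (genericTuples V F k m) := by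
  refine dense_iff_inter_open.2 fun O hO ⟨p, hp⟩ => ?_
  obtain ⟨U, hU, hUO⟩ := isOpen_pi_iff'.1 hO p hp
  obtain ⟨q, hq, hqU⟩ := hY.exists_mem_genericTuples hV hYV k hm (fun i => (hU i).1)
    fun i => ⟨_, (hU i).2⟩
  exact ⟨q, hUO fun i _ => hqU i, hq⟩

/-- A tuple in the leaf through `x`, made of points close to `x`, can be carried to the leaves near
`x` by the flow. -/
lemma eventually_vanishingDim_le [T2Space N] (hY : Generates Y F) (hV : IsLieAlgebraOfFields V)
    (hYV : ∀ i, Y i ∈ V) (x : N) : ∀ᶠ x' in 𝓝 x, vanishingDim V F x' ≤ vanishingDim V F x := by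
  have := hV.finite
  obtain ⟨β, hβ, -⟩ := exists_controls (ι := ι) none
  obtain ⟨Φ⟩ := Flow.nonempty hY.smooth β
  obtain ⟨k, ⟨y, rfl⟩, -⟩ := F.partition x
  obtain ⟨U, hU, hUo, hyU⟩ := eventually_nhds_iff.1 (hY.eventually_exists_eq Φ hβ y)
  obtain ⟨q, hq, hqU⟩ := hY.exists_mem_genericTuples hV hYV k (le_refl (Module.finrank ℝ V))
    (U := fun _ => U) (fun _ => hUo) (fun _ => ⟨y, hyU⟩)
  choose a ha haq using fun i => hU (q i) (hqU i)
  obtain ⟨K, X, hXV, hK, h0, hsub⟩ := exists_complement_basis (vanishingOn_le V (F.leaf k))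
  have hsep := (mem_genericTuples_iff hXV h0 hsub q).1 hq
  have hev : ∀ᶠ x' in 𝓝 (F.incl k y), Separates X fun i => Φ.e (a i, x') := by
    have hc : ContinuousAt (fun x' i => Φ.e (a i, x')) (F.incl k y) :=
      continuousAt_pi.2 fun i => (Φ.continuousAt_e (ha i)).comp
        (f := fun x' => (a i, x')) (by fun_prop)
    refine hc.preimage_mem_nhds ((isOpen_separates (fun j => hV.smooth _ (hXV j)) _).mem_nhds ?_)
    have : (fun i => Φ.e (a i, F.incl k y)) = fun i => F.incl k (q i) := funext haq
    rw [this]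
    exact hsep
  have hD : ∀ᶠ x' in 𝓝 (F.incl k y), ∀ i, (a i, x') ∈ Φ.D := eventually_all.2 fun i =>
    (Continuous.prodMk_right (a i)).continuousAt.preimage_mem_nhds (Φ.isOpen_D.mem_nhds (ha i))
  filter_upwards [hev, hD] with x' h1 h2
  have h3 := add_finrank_le_of_independent (vanishingOn_le V (F.leaf (F.leafOf x'))) hXV
    (h1.eq_zero fun i => (hY.e_mem_leaf_iff Φ (h2 i)).2 (F.mem_leafOf x'))
  rw [vanishingDim, vanishingDim, F.leafOf_eq (mem_range_self y)]
  omega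

lemma dense_genericPoints [T2Space N] (hY : Generates Y F) (hV : IsLieAlgebraOfFields V)
    (hYV : ∀ i, Y i ∈ V) : Dense (genericPoints V F) := by
  refine dense_iff_inter_open.2 fun O hO hne => ?_
  obtain ⟨x, hx, hmin⟩ := exists_minimalFor_of_wellFoundedLT (· ∈ O) (vanishingDim V F) hne
  refine ⟨x, hx, ?_⟩
  filter_upwards [hY.eventually_vanishingDim_le hV hYV x, hO.mem_nhds hx] with x' h1 h2
  exact le_antisymm h1 (hmin h2 h1)

lemma leaf_subset_genericPoints [T2Space N] (hY : Generates Y F) {k : F.ι}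
    (hk : (F.leaf k ∩ genericPoints V F).Nonempty) : F.leaf k ⊆ genericPoints V F := by
  obtain ⟨x, hxk, hx⟩ := hk
  intro x' hx'
  obtain ⟨β, hβ, -⟩ := exists_controls (ι := ι) none
  obtain ⟨Φ⟩ := Flow.nonempty hY.smooth β
  refine hY.leaf_induction_flow Φ hβ (P := fun x => x ∈ genericPoints V F) (fun z hz => ?_) hxk
    hx' hx
  have hdim : ∀ z ∈ Φ.D, vanishingDim V F (Φ.e z) = vanishingDim V F z.2 := fun z hz => by
    rw [vanishingDim, vanishingDim,
      F.leafOf_eq ((hY.e_mem_leaf_iff Φ hz).2 (F.mem_leafOf z.2))]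
  obtain ⟨a, c⟩ := z
  have hD : ∀ᶠ c' in 𝓝 c, (a, c') ∈ Φ.D :=
    (Continuous.prodMk_right a).continuousAt.preimage_mem_nhds (Φ.isOpen_D.mem_nhds hz)
  refine ⟨fun h => ?_, fun h => ?_⟩
  · have h1 : {z : (ι → ℝ) × N | vanishingDim V F z.2 = vanishingDim V F (Φ.e (a, c))} ∈
        map (fun z : (ι → ℝ) × N => (z.1, Φ.e z)) (𝓝 (a, c)) := by
      have h2 : ∀ᶠ z : (ι → ℝ) × N in 𝓝 (a, c), vanishingDim V F z.2 = vanishingDim V F c :=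
        (continuous_snd.continuousAt (x := ((a, c) : (ι → ℝ) × N))).eventually h
      rw [mem_map]
      filter_upwards [h2, Φ.isOpen_D.mem_nhds hz] with z' h3 h4
      change vanishingDim V F (Φ.e z') = _
      rw [hdim _ h4, hdim _ hz, h3]
    rw [Φ.map_nhds _ hz] at h1
    exact (Continuous.prodMk_right a).continuousAt.preimage_mem_nhds h1
  · have h1 : ContinuousAt (fun c' => Φ.e (a, c')) c :=
      (Φ.continuousAt_e hz).comp (f := fun c' => (a, c')) (by fun_prop)
    filter_upwards [h1.eventually h, hD] with c' h2 h3
    rw [hdim _ h3, hdim _ hz] at h2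
    exact h2

end Generates

end Generic

/-! ### The diagonal action in charts -/

section LocalInverse

variable {E F : Type*} [NormedAddCommGroup E] [NormedSpace ℝ E] [CompleteSpace E]
  [NormedAddCommGroup F] [NormedSpace ℝ F]

/-- The inverse function theorem, with the smoothness of the inverse at all the points of a
neighbourhood. -/
lemma exists_smooth_local_inverse {f : E → F} {B : Set E} (hB : IsOpen B)
    (hf : ∀ z ∈ B, ContDiffAt ℝ ∞ f z) {z₀ : E} (hz₀ : z₀ ∈ B) {f' : E ≃L[ℝ] F}
    (hf' : HasFDerivAt f (f' : E →L[ℝ] F) z₀) :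
    ∃ R : OpenPartialHomeomorph E F, ⇑R = f ∧ z₀ ∈ R.source ∧ R.source ⊆ B ∧
      ∀ w ∈ R.target, ContDiffAt ℝ ∞ R.symm w ∧
        ∃ e : E ≃L[ℝ] F, HasFDerivAt f (e : E →L[ℝ] F) (R.symm w) ∧
          HasFDerivAt R.symm (e.symm : F →L[ℝ] E) w := by
  let R₀ := (hf z₀ hz₀).toOpenPartialHomeomorph f hf' (by simp)
  have hR₀ : ⇑R₀ = f := rfl
  have hz₀' : z₀ ∈ R₀.source := (hf z₀ hz₀).mem_toOpenPartialHomeomorph_source hf' (by simp)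
  have hcont : ContinuousAt (fderiv ℝ f) z₀ :=
    ((hf z₀ hz₀).fderiv_right (m := 0) (by simp)).continuousAt
  have hev : ∀ᶠ z in 𝓝 z₀, ∃ e : E ≃L[ℝ] F, (e : E →L[ℝ] F) = fderiv ℝ f z := by
    refine hcont.eventually (p := fun L => ∃ e : E ≃L[ℝ] F, (e : E →L[ℝ] F) = L) ?_
    rw [hf'.fderiv]
    exact ContinuousLinearEquiv.nhds f'
  obtain ⟨O, hO, hOo, hz₀O⟩ := eventually_nhds_iff.1 hev
  let R := R₀.restrOpen (O ∩ B) (hOo.inter hB)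
  have hsrc : R.source = R₀.source ∩ (O ∩ B) := R₀.restrOpen_source _ _
  refine ⟨R, rfl, ?_, ?_, fun w hw => ?_⟩
  · rw [hsrc]; exact ⟨hz₀', hz₀O, hz₀⟩
  · rw [hsrc]; exact fun z hz => hz.2.2
  · have h1 : R.symm w ∈ R.source := R.map_target hw
    rw [hsrc] at h1
    obtain ⟨e, he⟩ := hO _ h1.2.1
    have h2 : HasFDerivAt f (e : E →L[ℝ] F) (R.symm w) := by
      rw [he]
      exact ((hf _ h1.2.2).differentiableAt (by simp)).hasFDerivAt
    exact ⟨R.contDiffAt_symm hw h2 (hf _ h1.2.2), e, h2, R.hasFDerivAt_symm hw h2⟩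

end LocalInverse

section FlowInCharts

variable {n m : ℕ} {N : Type*} [TopologicalSpace N] [ChartedSpace (EuclideanSpace ℝ (Fin n)) N]
  [IsManifold (𝓡 n) ∞ N] {ι : Type} [Fintype ι]

namespace Flow

variable {X : ι → VField n N} {β : ι → C(ℝ, ℝ)} (Φ : Flow X β)
  (φ : Fin m → OpenPartialHomeomorph N (EuclideanSpace ℝ (Fin n)))

/-- The diagonal action of the time-one maps on tuples, in charts. -/
def inCharts (z : (ι → ℝ) × (Fin m → EuclideanSpace ℝ (Fin n))) :
    Fin m → EuclideanSpace ℝ (Fin n) :=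
  fun i => φ i (Φ.e (z.1, (φ i).symm (z.2 i)))

/-- The set where `Flow.inCharts` is meaningful. -/
def inChartsDomain : Set ((ι → ℝ) × (Fin m → EuclideanSpace ℝ (Fin n))) :=
  {z | ∀ i, z.2 i ∈ (φ i).target ∧ (z.1, (φ i).symm (z.2 i)) ∈ Φ.D ∧
    Φ.e (z.1, (φ i).symm (z.2 i)) ∈ (φ i).source}

variable {φ}

lemma isOpen_inChartsDomain : IsOpen (Φ.inChartsDomain φ) := by
  refine isOpen_iff_mem_nhds.2 fun z hz => ?_
  refine eventually_all.2 fun i => ?_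
  obtain ⟨h1, h2, h3⟩ := hz i
  have c1 : ContinuousAt (fun z : (ι → ℝ) × (Fin m → EuclideanSpace ℝ (Fin n)) => z.2 i) z := by
    fun_prop
  have c2 : ContinuousAt (fun z : (ι → ℝ) × (Fin m → EuclideanSpace ℝ (Fin n)) =>
      (z.1, (φ i).symm (z.2 i))) z :=
    continuousAt_fst.prodMk (((φ i).symm.continuousAt h1).comp (x := z) c1)
  have c3 := (Φ.continuousAt_e h2).comp (x := z) c2
  filter_upwards [c1.preimage_mem_nhds ((φ i).open_target.mem_nhds h1),
    c2.preimage_mem_nhds (Φ.isOpen_D.mem_nhds h2),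
    c3.preimage_mem_nhds ((φ i).open_source.mem_nhds h3)] with z' a b c
  exact ⟨a, b, c⟩

lemma contDiffAt_inCharts (hφ : ∀ i, φ i ∈ IsManifold.maximalAtlas (𝓡 n) ∞ N)
    {z : (ι → ℝ) × (Fin m → EuclideanSpace ℝ (Fin n))} (hz : z ∈ Φ.inChartsDomain φ) :
    ContDiffAt ℝ ∞ (Φ.inCharts φ) z := by
  refine contDiffAt_pi.2 fun i => ?_
  obtain ⟨h1, h2, h3⟩ := hz i
  have c1 : ContMDiffAt 𝓘(ℝ, (ι → ℝ) × (Fin m → EuclideanSpace ℝ (Fin n))) (𝓡 n) ∞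
      (fun z : (ι → ℝ) × (Fin m → EuclideanSpace ℝ (Fin n)) => z.2 i) z := by
    refine ContDiffAt.contMDiffAt ?_
    fun_prop
  have c0 : ContMDiffAt 𝓘(ℝ, (ι → ℝ) × (Fin m → EuclideanSpace ℝ (Fin n))) 𝓘(ℝ, ι → ℝ) ∞
      (fun z : (ι → ℝ) × (Fin m → EuclideanSpace ℝ (Fin n)) => z.1) z :=
    contDiffAt_fst.contMDiffAt
  have c2 := c0.prodMk ((contMDiffAt_symm_of_mem_maximalAtlas (hφ i) h1).comp z c1)
  have c3 := (Φ.contMDiffAt _ h2).comp z c2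
  exact ((contMDiffAt_of_mem_maximalAtlas (hφ i) h3).comp z c3).contDiffAt

lemma fderiv_inCharts_inl (hφ : ∀ i, φ i ∈ IsManifold.maximalAtlas (𝓡 n) ∞ N)
    {z : (ι → ℝ) × (Fin m → EuclideanSpace ℝ (Fin n))} (hz : z ∈ Φ.inChartsDomain φ) (w : ι → ℝ)
    (i : Fin m) :
    fderiv ℝ (Φ.inCharts φ) z (w, 0) i = chartDeriv (φ i) (Φ.e (z.1, (φ i).symm (z.2 i)))
      (Φ.paramDeriv z.1 ((φ i).symm (z.2 i)) w) := by
  obtain ⟨h1, h2, h3⟩ := hz i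
  have hd : HasFDerivAt (Φ.inCharts φ) (fderiv ℝ (Φ.inCharts φ) z) z :=
    ((Φ.contDiffAt_inCharts hφ hz).differentiableAt (by simp)).hasFDerivAt
  have h4 := (hasFDerivAt_pi'.1 hd i).comp (f := fun a => (a, z.2)) z.1
    ((hasFDerivAt_id z.1).prodMk (hasFDerivAt_const z.2 z.1))
  exact DFunLike.congr_fun (h4.unique (Φ.hasFDerivAt_chart_param (hφ i) h2 h3)) w

lemma fderiv_inCharts_zero_inr [T2Space N] (hX : ∀ i, IsSmoothField (X i))
    (hφ : ∀ i, φ i ∈ IsManifold.maximalAtlas (𝓡 n) ∞ N)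
    {h : Fin m → EuclideanSpace ℝ (Fin n)} (hz : (0, h) ∈ Φ.inChartsDomain φ)
    (v : Fin m → EuclideanSpace ℝ (Fin n)) : fderiv ℝ (Φ.inCharts φ) (0, h) (0, v) = v := by
  have hd : HasFDerivAt (Φ.inCharts φ) (fderiv ℝ (Φ.inCharts φ) (0, h)) (0, h) :=
    ((Φ.contDiffAt_inCharts hφ hz).differentiableAt (by simp)).hasFDerivAt
  have h1 := hd.comp (f := fun h => (0, h)) h
    ((hasFDerivAt_const 0 h).prodMk (hasFDerivAt_id h))
  have h2 : (Φ.inCharts φ ∘ fun h => (0, h)) =ᶠ[𝓝 h] id := by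
    have hev : ∀ᶠ h' in 𝓝 h, (0, h') ∈ Φ.inChartsDomain φ :=
      (Continuous.prodMk_right 0).continuousAt.preimage_mem_nhds
        (Φ.isOpen_inChartsDomain.mem_nhds hz)
    filter_upwards [hev] with h' hh'
    ext1 i
    simp only [Function.comp_apply, inCharts, id]
    rw [Φ.e_zero hX, (φ i).right_inv (hh' i).1]
  exact DFunLike.congr_fun (h1.unique ((hasFDerivAt_id h).congr_of_eventuallyEq h2)) v

end Flow

end FlowInCharts

/-! ### Smooth parameters of tuples -/

section PiManifold

variable {n m : ℕ} {N : Type*} [TopologicalSpace N] [ChartedSpace (EuclideanSpace ℝ (Fin n)) N]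

lemma contMDiff_pi_apply (i : Fin m) :
    ContMDiff (ModelWithCorners.pi fun _ : Fin m => 𝓡 n) (𝓡 n) ∞ (fun q : Fin m → N => q i) := by
  intro q
  refine contMDiffAt_iff.2 ⟨(continuous_apply i).continuousAt, ?_⟩
  have hp : ContDiffAt ℝ ∞ (fun w : Fin m → EuclideanSpace ℝ (Fin n) => w i)
      (fun i => chartAt (EuclideanSpace ℝ (Fin n)) (q i) (q i)) := by fun_prop
  refine (hp.congr_of_eventuallyEq ?_).contDiffWithinAt
  have ht : ∀ᶠ w in 𝓝 (fun i => chartAt (EuclideanSpace ℝ (Fin n)) (q i) (q i)),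
      w i ∈ (chartAt (EuclideanSpace ℝ (Fin n)) (q i)).target :=
    (continuous_apply i).continuousAt.preimage_mem_nhds
      ((chartAt (EuclideanSpace ℝ (Fin n)) (q i)).open_target.mem_nhds (mem_chart_target _ _))
  filter_upwards [ht] with w hw
  exact (chartAt (EuclideanSpace ℝ (Fin n)) (q i)).right_inv hw

end PiManifold

section ParamMap

variable {n m : ℕ} {N : Type*} [TopologicalSpace N] [ChartedSpace (EuclideanSpace ℝ (Fin n)) N]
  [IsManifold (𝓡 n) ∞ N] {ι : Type} [Fintype ι]

/-- Smooth parameters `α(q)` of the tuples `q` near `p`, with `q i = e(α(q), base(q) i)`, that are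
adapted to the flow: when `q` moves with the velocity obtained from a motion of the parameters, then
`α(q)` follows this motion. -/
structure ParamMap {X : ι → VField n N} {β : ι → C(ℝ, ℝ)} (Φ : Flow X β) (p : Fin m → N) where
  U : Set (Fin m → N)
  α : (Fin m → N) → ι → ℝ
  base : (Fin m → N) → Fin m → N
  isOpen_U : IsOpen U
  mem_U : p ∈ U
  α_p : α p = 0
  contMDiffAt_α : ∀ q ∈ U, ContMDiffAt (ModelWithCorners.pi fun _ : Fin m => 𝓡 n) 𝓘(ℝ, ι → ℝ) ∞ α q
  mem_D : ∀ q ∈ U, ∀ i, (α q, base q i) ∈ Φ.D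
  e_base : ∀ q ∈ U, ∀ i, Φ.e (α q, base q i) = q i
  eq_zero : ∀ q ∈ U, ∀ w, (∀ i, Φ.paramDeriv (α q) (base q i) w = 0) → w = 0
  hasDerivAt : ∀ (y : Fin m → ℝ → N) (t : ℝ) (v : VField n N) (w : ι → ℝ),
    (fun i => y i t) ∈ U →
    (∀ i, HasMFDerivAt 𝓘(ℝ, ℝ) (𝓡 n) (y i) t ((1 : ℝ →L[ℝ] ℝ).smulRight (v (y i t)))) →
    (∀ i, Φ.paramDeriv (α fun i => y i t) (base (fun i => y i t) i) w =
      v (Φ.e (α fun i => y i t, base (fun i => y i t) i))) →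
    HasDerivAt (fun t => α fun i => y i t) w t

/-- If the tuple `p` separates the fields `X j`, the action of the flow on the tuples near `p` has a
slice, and the parameters are the coordinates transverse to the slice. -/
lemma ParamMap.exists_subset [T2Space N] {X : ι → VField n N} (hX : ∀ i, IsSmoothField (X i))
    {β : ι → C(ℝ, ℝ)} (hβ : ∀ i, ∫ u in (0 : ℝ)..1, β i u = 1) (Φ : Flow X β) {p : Fin m → N}
    (hp : Separates X p) {O : Set (Fin m → N)} (hO : IsOpen O) (hpO : p ∈ O) :
    ∃ M : ParamMap Φ p, M.U ⊆ O := by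
  let φ : Fin m → OpenPartialHomeomorph N (EuclideanSpace ℝ (Fin n)) := fun i =>
    chartAt (EuclideanSpace ℝ (Fin n)) (p i)
  have hφ : ∀ i, φ i ∈ IsManifold.maximalAtlas (𝓡 n) ∞ N := fun i =>
    IsManifold.chart_mem_maximalAtlas _
  have hs : ∀ i, p i ∈ (φ i).source := fun i => mem_chart_source _ _
  let chart : (Fin m → N) → Fin m → EuclideanSpace ℝ (Fin n) := fun q i => φ i (q i)
  set h₀ := chart p with hh₀
  have hsymm : ∀ i, (φ i).symm (h₀ i) = p i := fun i => (φ i).left_inv (hs i)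
  have h0mem : (0, h₀) ∈ Φ.inChartsDomain φ := fun i => by
    refine ⟨(φ i).map_source (hs i), ?_, ?_⟩
    · rw [hsymm]; exact Φ.zero_mem _
    · rw [hsymm, Φ.e_zero hX]; exact hs i
  have hchart0 : Φ.inCharts φ (0, h₀) = h₀ := by
    ext1 i
    simp only [Flow.inCharts]
    rw [hsymm, Φ.e_zero hX]
  let T := fderiv ℝ (Φ.inCharts φ) (0, h₀)
  let ev : (ι → ℝ) →L[ℝ] (Fin m → EuclideanSpace ℝ (Fin n)) := T.comp (ContinuousLinearMap.inl ℝ _ _)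
  have hev : ∀ w, ev w = 0 → w = 0 := fun w hw => hp w fun i => by
    have h1 : T (w, 0) i = 0 := congrFun hw i
    rw [Φ.fderiv_inCharts_inl hφ h0mem w i] at h1
    have hx : Φ.e (0, (φ i).symm (h₀ i)) = p i := by rw [hsymm, Φ.e_zero hX]
    have h2 := (map_eq_zero_iff _ (chartDeriv_injective (hφ i) (by rw [hx]; exact hs i))).1 h1
    rw [Φ.paramDeriv_zero hX hβ, hx] at h2
    exact h2
  -- the slice
  obtain ⟨S, hS⟩ := Submodule.exists_isCompl (LinearMap.range ev.toLinearMap)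
  let g : (ι → ℝ) × S → (ι → ℝ) × (Fin m → EuclideanSpace ℝ (Fin n)) := fun z => (z.1, h₀ + z.2)
  let g' : (ι → ℝ) × S →L[ℝ] (ι → ℝ) × (Fin m → EuclideanSpace ℝ (Fin n)) :=
    (ContinuousLinearMap.fst ℝ _ _).prod (S.subtypeL ∘L ContinuousLinearMap.snd ℝ _ _)
  have hg : ∀ z, HasFDerivAt g g' z := fun z =>
    hasFDerivAt_fst.prodMk ((S.subtypeL.hasFDerivAt.comp z hasFDerivAt_snd).const_add h₀)
  have hgs : ContDiff ℝ ∞ g := by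
    refine contDiff_fst.prodMk (contDiff_const.add ?_)
    exact S.subtypeL.contDiff.comp contDiff_snd
  have hg0 : g 0 = (0, h₀) := by simp [g]
  let f : (ι → ℝ) × S → Fin m → EuclideanSpace ℝ (Fin n) := fun z => Φ.inCharts φ (g z)
  have hfd : ∀ z, g z ∈ Φ.inChartsDomain φ →
      HasFDerivAt f ((fderiv ℝ (Φ.inCharts φ) (g z)).comp g') z := fun z hz =>
    ((Φ.contDiffAt_inCharts hφ hz).differentiableAt (by simp)).hasFDerivAt.comp z (hg z)
  have hT : ∀ z, T.comp g' z = ev z.1 + z.2 := fun z => by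
    have h1 : g' z = (z.1, 0) + (0, (z.2 : Fin m → EuclideanSpace ℝ (Fin n))) := by
      simp [g']
    rw [ContinuousLinearMap.comp_apply, h1, map_add]
    congr 1
    exact Φ.fderiv_inCharts_zero_inr hX hφ h0mem _
  have hker : (T.comp g').ker = ⊥ := by
    refine LinearMap.ker_eq_bot'.2 fun z hz => ?_
    have h1 : ev z.1 + z.2 = 0 := (hT z).symm.trans hz
    have h2 : (z.2 : Fin m → EuclideanSpace ℝ (Fin n)) ∈ LinearMap.range ev.toLinearMap ⊓ S :=
      ⟨⟨-z.1, by simpa using neg_eq_of_add_eq_zero_right h1⟩, z.2.2⟩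
    rw [hS.inf_eq_bot, Submodule.mem_bot] at h2
    rw [h2, add_zero] at h1
    exact Prod.ext (hev _ h1) (Subtype.ext h2)
  have hrange : (T.comp g').range = ⊤ := by
    refine LinearMap.range_eq_top.2 fun v => ?_
    have hv : v ∈ LinearMap.range ev.toLinearMap ⊔ S := by rw [hS.sup_eq_top]; trivial
    obtain ⟨_, ⟨w, rfl⟩, σ, hσ, rfl⟩ := Submodule.mem_sup.1 hv
    exact ⟨(w, ⟨σ, hσ⟩), hT _⟩
  let e₀ := ContinuousLinearEquiv.ofBijective (T.comp g') hker hrange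
  have he₀ : HasFDerivAt f (e₀ : _ →L[ℝ] _) 0 := by
    rw [ContinuousLinearEquiv.coe_ofBijective]
    have := hfd 0 (by rw [hg0]; exact h0mem)
    rw [hg0] at this
    exact this
  obtain ⟨R, hRf, h0R, hRB, hR⟩ := exists_smooth_local_inverse
    (B := g ⁻¹' Φ.inChartsDomain φ) (Φ.isOpen_inChartsDomain.preimage hgs.continuous)
    (f := f) (fun z hz => (Φ.contDiffAt_inCharts hφ hz).comp z hgs.contDiffAt)
    (by rw [mem_preimage, hg0]; exact h0mem) he₀
  have hkey : ∀ w ∈ R.target, ∀ e : ((ι → ℝ) × S) ≃L[ℝ] (Fin m → EuclideanSpace ℝ (Fin n)),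
      HasFDerivAt f (e : _ →L[ℝ] _) (R.symm w) → ∀ (b : ι → ℝ) (i : Fin m),
      e (b, 0) i = chartDeriv (φ i)
        (Φ.e ((R.symm w).1, (φ i).symm (h₀ i + ((R.symm w).2 : Fin m → _) i)))
        (Φ.paramDeriv (R.symm w).1 ((φ i).symm (h₀ i + ((R.symm w).2 : Fin m → _) i)) b) :=
    fun w hw e he b i => by
    have hB := hRB (R.map_target hw)
    have h1 := DFunLike.congr_fun (he.unique (hfd _ hB)) (b, 0)
    have h2 := Φ.fderiv_inCharts_inl hφ hB b i
    refine Eq.trans (congrFun h1 i) (Eq.trans ?_ h2)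
    rw [ContinuousLinearMap.comp_apply]
    congr 2
  let U : Set (Fin m → N) := {q | (∀ i, q i ∈ (φ i).source) ∧ chart q ∈ R.target} ∩ O
  have hccont : ∀ q : Fin m → N, (∀ i, q i ∈ (φ i).source) → ContinuousAt chart q := fun q hq =>
    continuousAt_pi.2 fun i => ((φ i).continuousAt (hq i)).comp (f := fun q : Fin m → N => q i)
      (continuous_apply i).continuousAt
  have hRg : ∀ w ∈ R.target, ∀ i, w i = φ i
      (Φ.e ((R.symm w).1, (φ i).symm (h₀ i + ((R.symm w).2 : Fin m → _) i))) := fun w hw i => by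
    conv_lhs => rw [← R.right_inv hw, hRf]
    rfl
  have hbase : ∀ q ∈ U, ∀ i, Φ.e ((R.symm (chart q)).1,
      (φ i).symm (h₀ i + ((R.symm (chart q)).2 : Fin m → _) i)) = q i := fun q hq i =>
    (φ i).injOn (hRB (R.map_target hq.1.2) i).2.2 (hq.1.1 i) (hRg _ hq.1.2 i).symm
  refine ⟨{
    U := U
    α := fun q => (R.symm (chart q)).1
    base := fun q i => (φ i).symm (h₀ i + ((R.symm (chart q)).2 : Fin m → _) i)
    isOpen_U := ?_
    mem_U := ?_
    α_p := ?_
    contMDiffAt_α := fun q hq => ?_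
    mem_D := fun q hq i => (hRB (R.map_target hq.1.2) i).2.1
    e_base := hbase
    eq_zero := fun q hq w hw => ?_
    hasDerivAt := fun y t v w hq hy hw => ?_ }, inter_subset_right⟩
  · refine IsOpen.inter (isOpen_iff_mem_nhds.2 fun q hq => ?_) hO
    have hsrc : ∀ᶠ q in 𝓝 q, ∀ i, q i ∈ (φ i).source := eventually_all.2 fun i =>
      (continuous_apply i).continuousAt.preimage_mem_nhds ((φ i).open_source.mem_nhds (hq.1 i))
    filter_upwards [hsrc, (hccont q hq.1).preimage_mem_nhds (R.open_target.mem_nhds hq.2)]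
      with q' h1 h2
    exact ⟨h1, h2⟩
  · refine ⟨⟨hs, ?_⟩, hpO⟩
    have := R.map_source h0R
    rwa [hRf, show f 0 = chart p by rw [← hh₀, ← hchart0, ← hg0]] at this
  · have h1 : R.symm (chart p) = 0 := by
      rw [← hh₀, ← hchart0, ← hg0, show Φ.inCharts φ (g 0) = R 0 by rw [hRf], R.left_inv h0R]
    simp only [h1, Prod.fst_zero]
  · have h1 : ContMDiffAt (ModelWithCorners.pi fun _ : Fin m => 𝓡 n)
        𝓘(ℝ, Fin m → EuclideanSpace ℝ (Fin n)) ∞ chart q := contMDiffAt_pi_space.2 fun i =>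
      (contMDiffAt_of_mem_maximalAtlas (hφ i) (hq.1.1 i)).comp q (contMDiff_pi_apply i q)
    exact ((contDiffAt_fst.comp _ (hR _ hq.1.2).1).contMDiffAt).comp q h1
  · obtain ⟨-, e, he, -⟩ := hR _ hq.1.2
    have h1 : e (w, 0) = 0 := funext fun i => by
      rw [hkey _ hq.1.2 e he w i]
      exact (congrArg _ (hw i)).trans (map_zero _)
    exact congrArg Prod.fst ((map_eq_zero_iff e e.injective).1 h1)
  · obtain ⟨-, e, he, he'⟩ := hR _ hq.1.2
    have h1 : HasDerivAt (fun t => chart fun i => y i t) (e (w, 0)) t := hasDerivAt_pi.2 fun i => by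
      refine (hasDerivAt_chart_comp (hφ i) (hy i) (hq.1.1 i)).congr_deriv ?_
      rw [hkey _ hq.1.2 e he w i]
      have h2 : ∀ x : N, x = y i t → chartDeriv (φ i) (y i t) (v (y i t)) =
          chartDeriv (φ i) x (v x) := fun x hx => by rw [hx]
      exact (h2 _ (hbase _ hq i)).trans (congrArg _ (hw i)).symm
    have h3 := he'.comp_hasDerivAt t h1
    have h4 := (ContinuousLinearMap.fst ℝ (ι → ℝ) S).hasFDerivAt.comp_hasDerivAt t h3
    refine h4.congr_deriv ?_
    simp

end ParamMap

/-! ### The superposition map -/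

section Superposition

variable {n m : ℕ} {N : Type*} [TopologicalSpace N] [ChartedSpace (EuclideanSpace ℝ (Fin n)) N]
  [IsManifold (𝓡 n) ∞ N] {ι : Type} [Fintype ι]

namespace ParamMap

variable {X : ι → VField n N} {β : ι → C(ℝ, ℝ)} {Φ : Flow X β} {p : Fin m → N} (M : ParamMap Φ p)

lemma continuousAt_α {q : Fin m → N} (hq : q ∈ M.U) : ContinuousAt M.α q :=
  (M.contMDiffAt_α q hq).continuousAt

/-- The set where `e(α(q), c)` is defined. -/
def source : Set ((Fin m → N) × N) := {z | z.1 ∈ M.U ∧ (M.α z.1, z.2) ∈ Φ.D}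

lemma isOpen_source : IsOpen M.source := by
  refine isOpen_iff_mem_nhds.2 fun z hz => ?_
  have h1 : ContinuousAt (fun z : (Fin m → N) × N => (M.α z.1, z.2)) z :=
    ((M.continuousAt_α hz.1).comp (x := z) continuousAt_fst).prodMk continuousAt_snd
  filter_upwards [continuousAt_fst.preimage_mem_nhds (M.isOpen_U.mem_nhds hz.1),
    h1.preimage_mem_nhds (Φ.isOpen_D.mem_nhds hz.2)] with z' h2 h3
  exact ⟨h2, h3⟩

lemma isOpen_image :
    IsOpen ((fun z : (Fin m → N) × N => (z.1, Φ.e (M.α z.1, z.2))) '' M.source) := by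
  refine isOpen_iff_mem_nhds.2 ?_
  rintro _ ⟨⟨q, c⟩, hz, rfl⟩
  have h1 : (fun z : (ι → ℝ) × N => (z.1, Φ.e z)) '' Φ.D ∈ 𝓝 (M.α q, Φ.e (M.α q, c)) := by
    rw [← Φ.map_nhds _ hz.2]
    exact image_mem_map (Φ.isOpen_D.mem_nhds hz.2)
  have h2 : ContinuousAt (fun z : (Fin m → N) × N => (M.α z.1, z.2)) (q, Φ.e (M.α q, c)) :=
    ((M.continuousAt_α hz.1).comp (x := (q, Φ.e (M.α q, c))) continuousAt_fst).prodMk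
      continuousAt_snd
  have h3 : ∀ᶠ z : (Fin m → N) × N in 𝓝 (q, Φ.e (M.α q, c)), z.1 ∈ M.U :=
    continuousAt_fst.preimage_mem_nhds (M.isOpen_U.mem_nhds hz.1)
  filter_upwards [h3, h2.preimage_mem_nhds h1]
  rintro ⟨q', x'⟩ hq' ⟨⟨a, c'⟩, hc', heq⟩
  obtain ⟨h4, h5⟩ := Prod.ext_iff.1 heq
  obtain rfl : a = M.α q' := h4
  obtain rfl : Φ.e (M.α q', c') = x' := h5
  exact ⟨(q', c'), ⟨hq', hc'⟩, rfl⟩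

/-- The superposition map `(q, c) ↦ e(α(q), c)`. -/
def superpositionMap [T2Space N] (hX : ∀ i, IsSmoothField (X i)) : SuperpositionMap n p where
  source := M.source
  toFun := fun q c => Φ.e (M.α q, c)
  isOpen_source := M.isOpen_source
  mem_source := fun c => ⟨M.mem_U, by rw [M.α_p]; exact Φ.zero_mem c⟩
  smooth := fun z hz => by
    have h1 := (M.contMDiffAt_α z.1 hz.1).comp z (contMDiffAt_fst (J := 𝓡 n))
    exact ((Φ.contMDiffAt _ hz.2).comp z (h1.prodMk contMDiffAt_snd)).contMDiffWithinAt
  isOpen_target := M.isOpen_image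
  mem_target := fun x => ⟨(p, x), ⟨M.mem_U, by rw [M.α_p]; exact Φ.zero_mem x⟩, by
    simp only [M.α_p, Φ.e_zero hX]⟩

variable {Y : TField n N} {A : Set N} {J : Set ℝ} {y : Fin m → ℝ → N}

/-- If, on tuples of points of `A`, the velocity of `Y` comes from a motion of the parameters, then
the superposition map sends solutions of `Y` to solutions of `Y`. -/
lemma isSolutionOn (hw : ∀ t ∈ J, ∃ w, ∀ c ∈ A, (M.α fun i => y i t, c) ∈ Φ.D →
      Φ.paramDeriv (M.α fun i => y i t) c w = Y t (Φ.e (M.α fun i => y i t, c)))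
    (hA : ∀ z ∈ Φ.D, Φ.e z ∈ A ↔ z.2 ∈ A) (hy : ∀ i, IsSolutionOn Y (y i) J)
    (hyU : ∀ t ∈ J, (fun i => y i t) ∈ M.U)
    (hyA : ∀ i, ∀ t ∈ J, y i t ∈ A) {c : N} (hc : c ∈ A)
    (hD : ∀ t ∈ J, (M.α fun i => y i t, c) ∈ Φ.D) :
    IsSolutionOn Y (fun t => Φ.e (M.α fun i => y i t, c)) J := by
  intro t ht
  obtain ⟨w, hw⟩ := hw t ht
  have h1 : HasDerivAt (fun t => M.α fun i => y i t) w t :=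
    M.hasDerivAt y t (Y t) w (hyU t ht) (fun i => hy i t ht) fun i =>
      hw _ ((hA _ (M.mem_D _ (hyU t ht) i)).1 (by
        rw [M.e_base _ (hyU t ht)]
        exact hyA i t ht)) (M.mem_D _ (hyU t ht) i)
  have h2 := (Φ.hasMFDerivAt_param (hD t ht)).comp t h1.hasFDerivAt.hasMFDerivAt
  refine h2.congr_mfderiv ?_
  refine ContinuousLinearMap.ext fun (r : ℝ) => ?_
  have h3 : Φ.paramDeriv (M.α fun i => y i t) c (r • w) =
      r • Y t (Φ.e (M.α fun i => y i t, c)) := by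
    rw [map_smul, hw c hc (hD t ht)]
  exact h3

/-- If moreover solutions of `Y` in `A` are determined by their values, then all the solutions of
`Y` in `A` are given by the superposition map, each for a unique parameter. -/
lemma existsUnique [T2Space N] (hX : ∀ i, IsSmoothField (X i)) (hJ : IsOpenInterval J)
    (hw : ∀ t ∈ J, ∃ w, ∀ c ∈ A, (M.α fun i => y i t, c) ∈ Φ.D →
      Φ.paramDeriv (M.α fun i => y i t) c w = Y t (Φ.e (M.α fun i => y i t, c)))
    (hA : ∀ z ∈ Φ.D, Φ.e z ∈ A ↔ z.2 ∈ A)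
    (huniq : ∀ (J' : Set ℝ) (γ₁ γ₂ : ℝ → N), IsPreconnected J' → J' ⊆ J →
      IsSolutionOn Y γ₁ J' → IsSolutionOn Y γ₂ J' → (∀ t ∈ J', γ₁ t ∈ A) → (∀ t ∈ J', γ₂ t ∈ A) →
      ∀ t₀ ∈ J', γ₁ t₀ = γ₂ t₀ → ∀ t ∈ J', γ₁ t = γ₂ t)
    (hy : ∀ i, IsSolutionOn Y (y i) J) (hyA : ∀ i, ∀ t ∈ J, y i t ∈ A) {x : ℝ → N}
    (hx : IsSolutionOn Y x J) (hxA : ∀ t ∈ J, x t ∈ A)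
    (hxT : ∀ t ∈ J, ((fun i => y i t), x t) ∈
      (fun z : (Fin m → N) × N => (z.1, Φ.e (M.α z.1, z.2))) '' M.source) :
    ∃! c : N, c ∈ A ∧ ∀ t ∈ J, ((fun i => y i t), c) ∈ M.source ∧
      x t = Φ.e (M.α fun i => y i t, c) := by
  have hex : ∀ t ∈ J, ∃ c, ((fun i => y i t), c) ∈ M.source ∧
      Φ.e (M.α fun i => y i t, c) = x t := fun t ht => by
    obtain ⟨⟨q, c⟩, hc, heq⟩ := hxT t ht
    obtain ⟨rfl, h2⟩ := Prod.ext_iff.1 heq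
    exact ⟨c, hc, h2⟩
  have hyU : ∀ t ∈ J, (fun i => y i t) ∈ M.U := fun t ht => (hex t ht).choose_spec.1.1
  have hleaf : ∀ t ∈ J, ∀ c, (M.α fun i => y i t, c) ∈ Φ.D →
      Φ.e (M.α fun i => y i t, c) = x t → c ∈ A := fun t ht c hc h =>
    (hA _ hc).1 (h ▸ hxA t ht)
  obtain ⟨t₀, ht₀⟩ := hJ.2.2
  obtain ⟨c, hc, hct₀⟩ := hex t₀ ht₀
  have hcA := hleaf t₀ ht₀ c hc.2 hct₀
  have hJc : IsPreconnected J := hJ.2.1.isPreconnected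
  have hall : ∀ t ∈ J, (M.α fun i => y i t, c) ∈ Φ.D ∧ Φ.e (M.α fun i => y i t, c) = x t := by
    refine forall_mem_of_locally hJc (P := fun t => (M.α fun i => y i t, c) ∈ Φ.D ∧
      Φ.e (M.α fun i => y i t, c) = x t) (fun t ht => ?_) ht₀ ⟨hc.2, hct₀⟩
    obtain ⟨c₁, hc₁, hct⟩ := hex t ht
    have hycont : ContinuousAt (fun t i => y i t) t :=
      continuousAt_pi.2 fun i => (hy i).continuousAt ht
    have hac : ContinuousAt (fun t => (M.α fun i => y i t, c₁)) t :=
      ((M.continuousAt_α (hyU t ht)).comp (x := t) hycont).prodMk continuousAt_const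
    obtain ⟨δ, hδ, hball⟩ := exists_ball_of_eventually (J := J)
      (p := fun t => (M.α fun i => y i t, c₁) ∈ Φ.D) (by
        filter_upwards [hac.preimage_mem_nhds (Φ.isOpen_D.mem_nhds hc₁.2)] with t' h' _
        exact h')
    have hpre : IsPreconnected (J ∩ Metric.ball t δ) :=
      (ordConnected_inter_ball hJc t δ).isPreconnected
    have hsub : J ∩ Metric.ball t δ ⊆ J := inter_subset_left
    have hc₁A := hleaf t ht c₁ hc₁.2 hct
    -- the solution with parameter `c₁` agrees with `x` near `t`
    have heq := huniq (J ∩ Metric.ball t δ) (fun t => Φ.e (M.α fun i => y i t, c₁)) x hpre hsub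
      (M.isSolutionOn (fun t' ht' => hw t' (hsub ht')) hA (fun i => (hy i).mono hsub)
        (fun t' ht' => hyU t' (hsub ht')) (fun i t' ht' => hyA i t' (hsub ht')) hc₁A hball)
      (hx.mono hsub) (fun t' ht' => (hA _ (hball t' ht')).2 hc₁A)
      (fun t' ht' => hxA t' (hsub ht')) t ⟨ht, Metric.mem_ball_self hδ⟩ hct
    refine ⟨_, Metric.ball_mem_nhds t hδ, fun t₁ ht₁ hJ₁ t₂ ht₂ hJ₂ hP => ?_⟩
    have hcc : c = c₁ := Φ.injective hX hP.1 (hball t₁ ⟨hJ₁, ht₁⟩)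
      (hP.2.trans (heq t₁ ⟨hJ₁, ht₁⟩).symm)
    rw [hcc]
    exact ⟨hball t₂ ⟨hJ₂, ht₂⟩, heq t₂ ⟨hJ₂, ht₂⟩⟩
  refine ⟨c, ⟨hcA, fun t ht => ⟨⟨hyU t ht, (hall t ht).1⟩, (hall t ht).2.symm⟩⟩, ?_⟩
  rintro c' ⟨-, hc'⟩
  exact Φ.injective hX (hc' t₀ ht₀).1.2 hc.2 ((hc' t₀ ht₀).2.symm.trans hct₀.symm)

end ParamMap

end Superposition

/-! ### Superposition rules -/

section Rules

variable {n s m : ℕ} {N : Type*} [TopologicalSpace N] [ChartedSpace (EuclideanSpace ℝ (Fin n)) N]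
  [IsManifold (𝓡 n) ∞ N] {V : Submodule ℝ (VField n N)}

lemma IsLieAlgebraOfFields.span_singleton (hV : IsLieAlgebraOfFields V) {W : VField n N}
    (hW : W ∈ V) : IsLieAlgebraOfFields (Submodule.span ℝ {W}) := by
  have hle : Submodule.span ℝ {W} ≤ V := (Submodule.span_singleton_le_iff_mem W V).2 hW
  refine ⟨fun Z hZ => hV.smooth Z (hle hZ), fun Z₁ h₁ Z₂ h₂ => ?_, inferInstance⟩
  obtain ⟨a, rfl⟩ := Submodule.mem_span_singleton.1 h₁
  obtain ⟨b, rfl⟩ := Submodule.mem_span_singleton.1 h₂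
  have hd : ∀ x, MDifferentiableAt (𝓡 n) (𝓡 n).tangent
      (fun x => (⟨x, W x⟩ : TangentBundle (𝓡 n) N)) x := fun x =>
    (hV.smooth W hW x).mdifferentiableAt (by simp)
  have h0 : VectorField.mlieBracket (𝓡 n) (a • W) (b • W) = 0 := funext fun x => by
    rw [VectorField.mlieBracket_const_smul_left (hd x),
      VectorField.mlieBracket_const_smul_right (hd x), VectorField.mlieBracket_self]
    simp
  rw [h0]
  exact Submodule.zero_mem _

/-- A single field is a Lie system. -/
lemma isLieSystem_const (hV : IsLieAlgebraOfFields V) {W : VField n N} (hW : W ∈ V) :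
    IsLieSystem fun _ : ℝ => W := by
  by_cases h0 : W = 0
  · subst h0
    refine ⟨0, Fin.elim0, Fin.elim0, linearIndependent_empty_type, ?_, fun α => α.elim0,
      fun t x => by simp⟩
    have h1 : Submodule.span ℝ (range (Fin.elim0 : Fin 0 → VField n N)) = Submodule.span ℝ {0} := by
      simp
    rw [h1]
    exact hV.span_singleton hW
  · refine ⟨1, fun _ => W, fun _ _ => 1, ?_, ?_, fun α => contDiff_const, fun t x => by simp⟩
    · exact linearIndependent_unique_iff.2 h0
    · rw [range_const]
      exact hV.span_singleton hW

namespace ParamMap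

variable {ι : Type} [Fintype ι] {X : ι → VField n N} {β : ι → C(ℝ, ℝ)} {Φ : Flow X β}
  {p : Fin m → N} (M : ParamMap Φ p)

/-- The superposition map is a superposition rule for any field along which one of the parameters
moves the points. -/
lemma isSuperpositionRule_const [T2Space N] (hX : ∀ i, IsSmoothField (X i)) {W : VField n N}
    (hW : IsSmoothField W) {w : ι → ℝ}
    (hw : ∀ a c, (a, c) ∈ Φ.D → Φ.paramDeriv a c w = W (Φ.e (a, c))) :
    (M.superpositionMap hX).IsSuperpositionRule fun _ => W := by
  have hY : (fun _ : ℝ => W) = controlled (fun _ : Unit => W) (fun _ _ => 1) := by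
    ext t x
    simp [controlled]
  refine fun J y hJ hy => ⟨fun c hc => ?_, fun x hx hxT => ?_⟩
  · exact M.isSolutionOn (A := univ) (fun t _ => ⟨w, fun c _ h => hw _ _ h⟩) (by simp) hy
      (fun t ht => (hc t ht).1) (by simp) (mem_univ c) (fun t ht => (hc t ht).2)
  · have h := M.existsUnique (A := univ) hX hJ (fun t _ => ⟨w, fun c _ h => hw _ _ h⟩) (by simp)
      (fun J' γ₁ γ₂ hJ' _ h₁ h₂ _ _ t₀ ht₀ h₀ => by
        rw [hY] at h₁ h₂
        exact h₁.eq_of_eq_at (fun _ => hW) hJ' (fun _ => continuousOn_const) h₂ ht₀ h₀)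
      hy (by simp) hx (by simp) hxT
    obtain ⟨c, ⟨-, hc⟩, hc'⟩ := h
    exact ⟨c, hc, fun c' h' => hc' c' ⟨mem_univ _, h'⟩⟩

end ParamMap

section Foliated

variable {F : Foliation n N s} {r K : ℕ} {Z : Fin r → VField n N}
  {g : Fin r → ℝ → N → ℝ} {T : TField n N}

/-- A foliated Lie system is, along its solutions, driven by the fields of its Lie algebra: its
solutions stay in the leaves. -/
lemma Generates.solution_mem_leaf (hZ : Generates Z F)
    (hg : ∀ α, Continuous fun q : ℝ × N => g α q.1 q.2)
    (hT : ∀ t x, T t x = ∑ α, g α t x • Z α x) {J : Set ℝ} (hJ : IsPreconnected J) {x : ℝ → N}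
    (hx : IsSolutionOn T x J) {k : F.ι} {t₀ : ℝ} (ht₀ : t₀ ∈ J) (h₀ : x t₀ ∈ F.leaf k) :
    ∀ t ∈ J, x t ∈ F.leaf k := by
  refine hZ.mem_leaf hJ (u := fun α t => g α t (x t)) (fun α t ht => ?_) (fun t ht => ?_) ht₀ h₀
  · have h1 : ContinuousAt (fun t => (t, x t)) t := continuousAt_id.prodMk (hx.continuousAt ht)
    exact (((hg α).continuousAt).comp (x := t) h1).continuousWithinAt
  · have h1 := hx t ht
    rw [hT] at h1
    exact h1

/-- On a leaf, a foliated Lie system is a Lie system, and it can be written in terms of fields that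
generate the Lie algebra modulo the fields that vanish on the leaf. -/
lemma Generates.exists_coefficients [T2Space N] (hZ : Generates Z F) (hZV : ∀ i, Z i ∈ V)
    (hg : ∀ α, ContMDiff (𝓘(ℝ, ℝ).prod (𝓡 n)) 𝓘(ℝ, ℝ) ∞ (fun q : ℝ × N => g α q.1 q.2))
    (hgZ : ∀ (α β : Fin r) (t : ℝ) (x : N), mfderiv (𝓡 n) 𝓘(ℝ, ℝ) (g β t) x (Z α x) = 0)
    (hT : ∀ t x, T t x = ∑ α, g α t x • Z α x) {k : F.ι} {X : Fin K → VField n N}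
    (hsub : ∀ W ∈ V, ∃ w : Fin K → ℝ, W - ∑ j, w j • X j ∈ vanishingOn V (F.leaf k)) :
    ∃ b : Fin K → ℝ → ℝ, (∀ l, Continuous (b l)) ∧
      ∀ t, ∀ x ∈ F.leaf k, T t x = controlled X b t x := by
  obtain ⟨x₀, hx₀⟩ := F.leaf_nonempty k
  choose w hw using fun α => hsub (Z α) (hZV α)
  have hw' : ∀ α, ∀ x ∈ F.leaf k, Z α x = ∑ j, w α j • X j x := fun α x hx => by
    have := (hw α).2 x hx
    rwa [Pi.sub_apply, sub_eq_zero, sum_smul_apply] at this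
  refine ⟨fun l t => ∑ α, g α t x₀ * w α l, fun l => ?_, fun t x hx => ?_⟩
  · refine continuous_finsetSum _ fun α _ => ?_
    exact ((hg α).continuous.comp (Continuous.prodMk_left x₀)).mul continuous_const
  · have h1 : ∀ α, g α t x = g α t x₀ := fun α => by
      refine hZ.eq_on_leaf (fun x => ?_) (fun i x => hgZ i α t x) hx₀ hx
      have h2 : ContMDiffAt (𝓡 n) 𝓘(ℝ, ℝ) ∞ (fun x => g α t x) x :=
        (hg α (t, x)).comp x (contMDiffAt_const.prodMk contMDiffAt_id)
      exact h2.mdifferentiableAt (by simp)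
    rw [hT, controlled]
    simp only [Finset.sum_smul]
    rw [Finset.sum_comm]
    refine Finset.sum_congr rfl fun α _ => ?_
    rw [h1 α, hw' α x hx, Finset.smul_sum]
    simp only [smul_smul]

/-- On a leaf where the fields `X j` generate the Lie algebra, any combination of them comes from a
motion of the parameters. -/
lemma ParamMap.exists_paramDeriv_eq {X : Fin K → VField n N} {β : Fin K → C(ℝ, ℝ)} {Φ : Flow X β}
    {p : Fin m → N} (M : ParamMap Φ p) (hV : IsLieAlgebraOfFields V) (hXV : ∀ j, X j ∈ V)
    {D : (x : N) → Submodule ℝ (TangentSpace (𝓡 n) x)} (hF : F.Integrates D)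
    (hXD : ∀ j x, X j x ∈ D x) {k : F.ι}
    (hsub : ∀ W ∈ V, ∃ w : Fin K → ℝ, W - ∑ j, w j • X j ∈ vanishingOn V (F.leaf k))
    {q : Fin m → N} (hq : q ∈ M.U) (hqk : ∀ i, q i ∈ F.leaf k) (b : Fin K → ℝ) :
    ∃ w, ∀ c ∈ F.leaf k, (M.α q, c) ∈ Φ.D →
      Φ.paramDeriv (M.α q) c w = ∑ l, b l • X l (Φ.e (M.α q, c)) := by
  have hX : ∀ j, IsSmoothField (X j) := fun j => hV.smooth _ (hXV j)
  choose cst hcst using fun i j => hsub _ (hV.bracket_mem _ (hXV i) _ (hXV j))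
  obtain ⟨L, hL⟩ := Φ.exists_paramDeriv_eq (S := F.leaf k) (cst := cst) hX
    (fun x hx i j => by
      have := (hcst i j).2 x hx
      rwa [Pi.sub_apply, sub_eq_zero, sum_smul_apply] at this)
    (fun a Γ hΓ h0 => hΓ.mem_leaf hF hX hXD isPreconnected_Icc
      (fun i => continuousOn_control β a i _) (t₀ := 0) (by simp) h0) (M.α q)
  -- the motion of the parameters is determined by the motion of the tuple
  have hinj : Function.Injective L := by
    refine (injective_iff_map_eq_zero L).2 fun w hw => M.eq_zero q hq w fun i => ?_
    have hD := M.mem_D q hq i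
    rw [hL _ ((Φ.e_mem_leaf_iff hF hX hXD hD).1 (by rw [M.e_base q hq]; exact hqk i)) hD, hw]
    simp
  obtain ⟨w, hw⟩ := (LinearMap.injective_iff_surjective.1 hinj) b
  exact ⟨w, fun c hc hD => by rw [hL c hc hD, hw]⟩

/-- The superposition map is a foliated superposition rule. -/
lemma ParamMap.isFoliatedSuperpositionRule [T2Space N] {X : Fin K → VField n N}
    {β : Fin K → C(ℝ, ℝ)} {Φ : Flow X β} {p : Fin m → N} (M : ParamMap Φ p) (hV : IsLieAlgebraOfFields V)
    (hXV : ∀ j, X j ∈ V) (hZ : Generates Z F) (hZV : Submodule.span ℝ (range Z) = V)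
    (hg : ∀ α, ContMDiff (𝓘(ℝ, ℝ).prod (𝓡 n)) 𝓘(ℝ, ℝ) ∞ (fun q : ℝ × N => g α q.1 q.2))
    (hgZ : ∀ (α β : Fin r) (t : ℝ) (x : N), mfderiv (𝓡 n) 𝓘(ℝ, ℝ) (g β t) x (Z α x) = 0)
    (hT : ∀ t x, T t x = ∑ α, g α t x • Z α x)
    (hsub : ∀ q ∈ M.U, ∀ k, (∀ i, q i ∈ F.leaf k) → ∀ W ∈ V,
      ∃ w : Fin K → ℝ, W - ∑ j, w j • X j ∈ vanishingOn V (F.leaf k))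
    {W : VField n N} (hW : W ∈ V) {w : Fin K → ℝ}
    (hw : ∀ a c, (a, c) ∈ Φ.D → Φ.paramDeriv a c w = W (Φ.e (a, c))) :
    (M.superpositionMap fun j => hV.smooth _ (hXV j)).IsFoliatedSuperpositionRule F T := by
  have hX : ∀ j, IsSmoothField (X j) := fun j => hV.smooth _ (hXV j)
  have hXD : ∀ j x, X j x ∈ Submodule.span ℝ (range fun i => Z i x) := fun j x =>
    apply_mem_span (hZV ▸ hXV j) x
  have hleaf : ∀ k, ∀ z ∈ Φ.D, Φ.e z ∈ F.leaf k ↔ z.2 ∈ F.leaf k := fun k z hz =>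
    Φ.e_mem_leaf_iff hZ.integrates hX hXD hz
  have hcoef : ∀ q ∈ M.U, ∀ k, (∀ i, q i ∈ F.leaf k) → ∃ b : Fin K → ℝ → ℝ,
      (∀ l, Continuous (b l)) ∧ ∀ t, ∀ x ∈ F.leaf k, T t x = controlled X b t x :=
    fun q hq k hqk => hZ.exists_coefficients (fun i => hZV ▸ Submodule.subset_span ⟨i, rfl⟩) hg hgZ
      hT (hsub q hq k hqk)
  have hmove : ∀ q ∈ M.U, ∀ k, (∀ i, q i ∈ F.leaf k) → ∀ t, ∃ w, ∀ c ∈ F.leaf k,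
      (M.α q, c) ∈ Φ.D → Φ.paramDeriv (M.α q) c w = T t (Φ.e (M.α q, c)) :=
    fun q hq k hqk t => by
    obtain ⟨b, -, hb⟩ := hcoef q hq k hqk
    obtain ⟨w, hw⟩ := M.exists_paramDeriv_eq hV hXV hZ.integrates hXD (hsub q hq k hqk) hq hqk
      fun l => b l t
    exact ⟨w, fun c hc hD => by rw [hw c hc hD, hb t _ ((hleaf k _ hD).2 hc)]; rfl⟩
  refine ⟨⟨_, isLieSystem_const hV hW, M.isSuperpositionRule_const hX (hV.smooth W hW) hw⟩,
    fun k q c hz _ hc => (hleaf k _ hz.2).2 hc, fun k J y hJ hy hyk c hc hD => ?_,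
    fun k J y hJ hy hyk x hx hxk hxT => ?_⟩
  · exact M.isSolutionOn (A := F.leaf k)
      (fun t ht => hmove _ (hD t ht).1 k (fun i => hyk i t ht) t) (hleaf k) hy
      (fun t ht => (hD t ht).1) hyk hc (fun t ht => (hD t ht).2)
  · have hU : ∀ t ∈ J, (fun i => y i t) ∈ M.U := fun t ht => by
      obtain ⟨⟨q, c⟩, hc, heq⟩ := hxT t ht
      obtain ⟨rfl, -⟩ := Prod.ext_iff.1 heq
      exact hc.1
    obtain ⟨t₁, ht₁⟩ := hJ.2.2
    obtain ⟨b, hbc, hb⟩ := hcoef _ (hU t₁ ht₁) k fun i => hyk i t₁ ht₁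
    obtain ⟨t₀, ht₀, h₀⟩ := hxk
    have hsol : ∀ (J' : Set ℝ) (γ : ℝ → N), IsSolutionOn T γ J' → (∀ t ∈ J', γ t ∈ F.leaf k) →
        IsSolutionOn (controlled X b) γ J' := fun J' γ hγ hk t ht => by
      have h1 := hγ t ht
      rw [hb t _ (hk t ht)] at h1
      exact h1
    exact M.existsUnique (A := F.leaf k) hX hJ
      (fun t ht => hmove _ (hU t ht) k (fun i => hyk i t ht) t) (hleaf k)
      (fun J' γ₁ γ₂ hJ' _ h₁ h₂ hk₁ hk₂ t₀ ht₀ h₀ => (hsol J' γ₁ h₁ hk₁).eq_of_eq_at hX hJ'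
        (fun l => (hbc l).continuousOn) (hsol J' γ₂ h₂ hk₂) ht₀ h₀) hy hyk hx
      (hZ.solution_mem_leaf (fun α => (hg α).continuous) hT hJ.2.1.isPreconnected hx ht₀ h₀) hxT

end Foliated

end Rules

/-! ### Existence of foliated superposition rules -/

section Existence

variable {n s : ℕ} {N : Type*} [TopologicalSpace N] [ChartedSpace (EuclideanSpace ℝ (Fin n)) N]
  {V : Submodule ℝ (VField n N)} {F : Foliation n N s}

lemma distribution_span {r : ℕ} (Z : Fin r → VField n N) (x : N) :
    distribution (Submodule.span ℝ (range Z)) x = Submodule.span ℝ (range fun i => Z i x) := by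
  rw [distribution, Submodule.map_span, ← range_comp]
  rfl

/-- Fields tangent to zero-dimensional leaves are zero. -/
lemma finrank_eq_zero_of_integrates {F : Foliation n N 0} (hF : F.Integrates (distribution V)) :
    Module.finrank ℝ V = 0 := by
  have h : V = ⊥ := by
    refine (Submodule.eq_bot_iff V).2 fun Z hZ => funext fun x => ?_
    obtain ⟨k, ⟨y, rfl⟩, -⟩ := F.partition x
    have h1 : Z (F.incl k y) ∈ distribution V (F.incl k y) := ⟨Z, hZ, rfl⟩
    rw [← hF k y] at h1
    obtain ⟨ξ, hξ⟩ := h1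
    rw [← hξ, show ξ = 0 from Subsingleton.elim (α := EuclideanSpace ℝ (Fin 0)) _ _, map_zero]
    rfl
  rw [h, finrank_bot]

variable [IsManifold (𝓡 n) ∞ N]

/-- A complement of the space of fields that vanish on a generic leaf remains a complement for the
leaves nearby, as long as they contain tuples that separate its elements. -/
lemma Separates.exists_sub_mem (hV : IsLieAlgebraOfFields V) {m K : ℕ} {X : Fin K → VField n N}
    (hXV : ∀ j, X j ∈ V) {p q : Fin m → N} (hm : Module.finrank ℝ V = m)
    (hK : ∀ i, K + vanishingDim V F (p i) = Module.finrank ℝ V)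
    (hpq : ∀ i, vanishingDim V F (q i) = vanishingDim V F (p i)) (hq : Separates X q) {k : F.ι}
    (hqk : ∀ i, q i ∈ F.leaf k) {W : VField n N} (hW : W ∈ V) :
    ∃ w : Fin K → ℝ, W - ∑ j, w j • X j ∈ vanishingOn V (F.leaf k) := by
  have := hV.finite
  rcases Nat.eq_zero_or_pos m with h0 | h0
  · rw [h0, Submodule.finrank_eq_zero] at hm
    rw [hm, Submodule.mem_bot] at hW
    exact ⟨0, by simp [hW]⟩
  · refine exists_sub_mem_of_independent (vanishingOn_le _ _) hXV (hq.eq_zero hqk) ?_ hW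
    rw [← F.leafOf_eq (hqk ⟨0, h0⟩), ← hK ⟨0, h0⟩, ← hpq]
    rfl

/-- One may choose the controls so that there is a field of the family, or the zero field if the
family is empty, along which one of the parameters moves the points. -/
lemma exists_flow_with_direction [T2Space N] {K : ℕ} {X : Fin K → VField n N}
    (hX : ∀ i, IsSmoothField (X i)) (hXV : ∀ i, X i ∈ V) :
    ∃ (β : Fin K → C(ℝ, ℝ)) (Φ : Flow X β), (∀ i, ∫ u in (0 : ℝ)..1, β i u = 1) ∧
      ∃ W ∈ V, ∃ w : Fin K → ℝ, ∀ a c, (a, c) ∈ Φ.D → Φ.paramDeriv a c w = W (Φ.e (a, c)) := by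
  rcases Nat.eq_zero_or_pos K with h0 | h0
  · obtain ⟨β, hβ, -⟩ := exists_controls (ι := Fin K) none
    obtain ⟨Φ⟩ := Flow.nonempty hX β
    exact ⟨β, Φ, hβ, 0, V.zero_mem, 0, fun a c _ => map_zero _⟩
  · obtain ⟨β, hβ, hβ'⟩ := exists_controls (some (⟨0, h0⟩ : Fin K))
    obtain ⟨Φ⟩ := Flow.nonempty hX β
    exact ⟨β, Φ, hβ, X ⟨0, h0⟩, hXV _, Pi.single ⟨0, h0⟩ 1, fun a c hz =>
      Φ.paramDeriv_single hX (hβ _) (fun i hi => hβ' i _ rfl hi) hz⟩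

end Existence

end FoliatedLie

end

theorem mainTheorem4 {n s : ℕ} {N : Type*} [TopologicalSpace N]
    [ChartedSpace (EuclideanSpace ℝ (Fin n)) N] [IsManifold (𝓡 n) ∞ N]
    [T2Space N] [SecondCountableTopology N] [ConnectedSpace N]
    (F : FoliatedLie.Foliation n N s) (X : FoliatedLie.TField n N)
    (V : Submodule ℝ (FoliatedLie.VField n N))
    (hX : FoliatedLie.IsFoliatedLieSystemAlong F X V) :
    ∃ m : ℕ, Module.finrank ℝ V ≤ m * s ∧
      FoliatedLie.AdmitsFoliatedSuperpositionRule F X m := by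
  open FoliatedLie in
  obtain ⟨⟨hV, -, r, Z, g, -, hZV, hg, hgZ, hT⟩, hF⟩ := hX
  have := hV.finite
  have hZmem : ∀ i, Z i ∈ V := fun i => hZV ▸ Submodule.subset_span ⟨i, rfl⟩
  have hZ : Generates Z F := ⟨fun i => hV.smooth _ (hZmem i), fun k y =>
    (hF k y).trans (by rw [← hZV]; exact distribution_span Z _)⟩
  refine ⟨Module.finrank ℝ V, ?_, genericPoints V F, isOpen_genericPoints V F,
    hZ.dense_genericPoints hV hZmem, fun k hk => hZ.leaf_subset_genericPoints hk, fun k hk =>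
    ⟨genericTuples V F k _, isOpen_genericTuples hV k _, hZ.dense_genericTuples hV hZmem k le_rfl,
    fun q hq => ?_⟩⟩
  · rcases Nat.eq_zero_or_pos s with rfl | hs
    · rw [finrank_eq_zero_of_integrates hF]
    · exact Nat.le_mul_of_pos_right _ hs
  · obtain ⟨K, Y, hYV, hK, h0, hsub⟩ := exists_complement_basis (vanishingOn_le V (F.leaf k))
    have hY : ∀ j, IsSmoothField (Y j) := fun j => hV.smooth _ (hYV j)
    have hsep := (mem_genericTuples_iff hYV h0 hsub q).1 hq
    obtain ⟨β, Φ, hβ, W, hW, w, hw⟩ := exists_flow_with_direction hY hYV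
    have hev : ∀ᶠ q' in nhds fun i => F.incl k (q i), Separates Y q' :=
      (isOpen_separates hY _).mem_nhds hsep
    have hgen : ∀ i, ∀ᶠ x in nhds (F.incl k (q i)),
        vanishingDim V F x = vanishingDim V F (F.incl k (q i)) := fun i => hk (mem_range_self (q i))
    have hdim : ∀ᶠ q' in nhds fun i => F.incl k (q i), Separates Y q' ∧
        ∀ i, vanishingDim V F (q' i) = vanishingDim V F (F.incl k (q i)) :=
      hev.and (Filter.eventually_all.2 fun i =>
        ((continuous_apply i).tendsto fun i => F.incl k (q i)).eventually (hgen i))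
    obtain ⟨O, hO, hOo, hqO⟩ := eventually_nhds_iff.1 hdim
    obtain ⟨M, hMO⟩ := ParamMap.exists_subset hY hβ Φ hsep hOo hqO
    refine ⟨M.superpositionMap hY, M.isFoliatedSuperpositionRule hV hYV hZ hZV hg hgZ hT
      (fun q' hq' j hj W hW => ?_) hW hw⟩
    refine (hO q' (hMO hq')).1.exists_sub_mem hV hYV rfl (fun i => ?_) (hO q' (hMO hq')).2 hj hW
    rw [← hK, vanishingDim, F.leafOf_eq (mem_range_self (q i))]
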